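/- Let $s\in(0,1)$ and let $N\ge 1$ be an integer with $N>2s$; put $2^*_s=\frac{2N}{N-2s}$. Let $f\in C([0,\infty))$ be real valued with $f(0)=0$ and (f1) $\lim_{t\to0^+}\frac{f(t)}{t}=0$, $\lim_{t\to\infty}\frac{f(t)}{t}=\infty$, and for some $\gamma\in(2,2^*_s)$ and $C_f>0$ the limit $\lim_{t\to\infty}\frac{f(t)}{t^{\gamma-1}}$ exists and is at most $C_f$; (f2) there is $R>0$ such that $t\mapsto \frac{f(t)}{t}$ is non-decreasing on $(R,\infty)$. Let $g\in L^1(\mathbb R^N)\cap L^\infty(\mathbb R^N)$ with $g\ge 0$ a.e. and $g$ not a.e. equal to $0$. For $a>0$ let $f_a(t)=f(t)-a$ for $t\ge0$, $f_a(t)=-a$ for $t\le 0$, and $F_a(t)=\int_0^t f_a(\tau)\,d\tau$. Let $[u]_{s,2}=\left(\iint_{\mathbb R^N\times\mathbb R^N}\frac{(u(x)-u(y))^2}{|x-y|^{N+2s}}\,dx\,dy\right)^{1/2}$, and let $\dot H^s(\mathbb R^N)$ be the closure of $C_c^1(\mathbb R^N)$ with respect to the norm $\|u\|_{\dot H^s}=[u]_{s,2}+\|u\|_{L^{2^*_s}}$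 (inside the space of all $u\in L^{2^*_s}(\mathbb R^N)$ with $[u]_{s,2}<\infty$). Consider $$(-\Delta)^s u=g\,f_a(u)\ \text{ in }\mathbb R^N,\qquad(\mathrm{SP})$$ whose weak solutions are the $u\in\dot H^s(\mathbb R^N)$ with $$\iint_{\mathbb R^N\times\mathbb R^N}\frac{(u(x)-u(y))(\varphi(x)-\varphi(y))}{|x-y|^{N+2s}}\,dx\,dy=\int_{\mathbb R^N} g f_a(u)\varphi\,dx\quad\text{for all }\varphi\in\dot H^s(\mathbb R^N)$$ (the right-hand integrals converging absolutely), and the energy $I_a(u)=\frac12[u]_{s,2}^2-\int_{\mathbb R^N} gF_a(u)\,dx$ on $\dot H^s(\mathbb R^N)$. A weak solution $u$ of (SP) is called a mountain pass solution if - $I_a$ is well defined (i.e. $gF_a(v)\in L^1(\mathbb R^N)$ for all $v\in\dot H^s(\mathbb R^N)$), $I_a\in C^1(\dot H^s(\mathbb R^N),\mathbb R)$, and $I_a'(u)=0$; - (Cerami condition) for every $c\in\mathbb R$: every bounded sequence $(w_n)$ in $\dot H^s(\mathbb R^N)$ with $I_a(w_n)\to c$ and $I_a'(w_n)\to0$ in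 the dual space has a convergent subsequence, and there are $\eta,\beta,\rho>0$ such that $\|I_a'(v)\|\,[v]_{s,2}\ge\beta$ whenever $I_a(v)\in[c-\eta,c+\eta]$ and $[v]_{s,2}\ge\rho$; - (mountain pass geometry and level) there are $\rho,\beta>0$ and $e\in\dot H^s(\mathbb R^N)$ such that $I_a(0)=0$, $I_a(v)\ge\beta$ whenever $[v]_{s,2}=\rho$, $[e]_{s,2}>\rho$, $I_a(e)<0$, and $$I_a(u)=\inf_{p}\max_{t\in[0,1]}I_a(p(t))\ge\beta,$$ where $p$ ranges over the continuous paths $p:[0,1]\to\dot H^s(\mathbb R^N)$ with $p(0)=0$ and $p(1)=e$. Then there is $a_1>0$ and, for every $a\in(0,a_1)$, a mountain pass solution $u_a$ of (SP), such that moreover, for some $a_2\in(0,a_1)$ and $C>0$, $\|u_a\|_{\dot H^s}\le C$ for all $a\in(0,a_2)$. -/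

import Mathlib

open MeasureTheory Set Filter Topology

noncomputable section

/-! ## The critical exponent and the Gagliardo seminorm -/

/-- The critical fractional exponent `2N / (N - 2s)`. -/
def critExp (N : ℕ) (s : ℝ) : ℝ := 2 * (N : ℝ) / ((N : ℝ) - 2 * s)

/-- The integrand `(u(x) - u(y)) (v(x) - v(y)) / |x - y|^(N + 2s)` at `z = (x, y)`. -/
def gagliardoIntegrand (N : ℕ) (s : ℝ) (u v : EuclideanSpace ℝ (Fin N) → ℝ)
    (z : EuclideanSpace ℝ (Fin N) × EuclideanSpace ℝ (Fin N)) : ℝ :=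
  (u z.1 - u z.2) * (v z.1 - v z.2) / ‖z.1 - z.2‖ ^ ((N : ℝ) + 2 * s)

/-- The bilinear form
`∬ (u(x) - u(y)) (v(x) - v(y)) / |x - y|^(N + 2s) dx dy` over `ℝ^N × ℝ^N`. -/
def gagliardoForm (N : ℕ) (s : ℝ) (u v : EuclideanSpace ℝ (Fin N) → ℝ) : ℝ :=
  ∫ z, gagliardoIntegrand N s u v z

/-- The Gagliardo seminorm `[u]_{s,2}`. It is used only for functions for which the double
integral converges. -/
def gagliardoSeminorm (N : ℕ) (s : ℝ) (u : EuclideanSpace ℝ (Fin N) → ℝ) : ℝ :=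
  Real.sqrt (gagliardoForm N s u u)

/-! ### Auxiliary facts: the seminorm is the `L²` norm of a difference quotient -/

lemma one_le_ofReal_critExp {N : ℕ} {s : ℝ} (hs : 0 < s) (hN : 2 * s < N) :
    1 ≤ ENNReal.ofReal (critExp N s) := by
  rw [ENNReal.one_le_ofReal, critExp, le_div_iff₀ (by linarith)]
  linarith

/-- The difference quotient `(u(x) - u(y)) / |x - y|^((N + 2s)/2)`. -/
def diffQuot (N : ℕ) (s : ℝ) (u : EuclideanSpace ℝ (Fin N) → ℝ)
    (z : EuclideanSpace ℝ (Fin N) × EuclideanSpace ℝ (Fin N)) : ℝ :=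
  (u z.1 - u z.2) / ‖z.1 - z.2‖ ^ (((N : ℝ) + 2 * s) / 2)

lemma gagliardoIntegrand_self (N : ℕ) (s : ℝ) (u : EuclideanSpace ℝ (Fin N) → ℝ) :
    gagliardoIntegrand N s u u = fun z => diffQuot N s u z ^ 2 := by
  funext z
  simp only [gagliardoIntegrand, diffQuot, div_pow]
  rw [← Real.rpow_natCast (‖z.1 - z.2‖ ^ _), ← Real.rpow_mul (norm_nonneg _)]
  congr 1
  · ring
  · congr 1
    push_cast
    ring

lemma aestronglyMeasurable_diffQuot (N : ℕ) (s : ℝ) {u : EuclideanSpace ℝ (Fin N) → ℝ}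
    (hu : AEStronglyMeasurable u volume) : AEStronglyMeasurable (diffQuot N s u) volume := by
  have h1 : AEStronglyMeasurable
      (fun z : EuclideanSpace ℝ (Fin N) × EuclideanSpace ℝ (Fin N) => u z.1) volume :=
    hu.comp_quasiMeasurePreserving Measure.quasiMeasurePreserving_fst
  have h2 : AEStronglyMeasurable
      (fun z : EuclideanSpace ℝ (Fin N) × EuclideanSpace ℝ (Fin N) => u z.2) volume :=
    hu.comp_quasiMeasurePreserving Measure.quasiMeasurePreserving_snd
  have h3 : Measurable (fun z : EuclideanSpace ℝ (Fin N) × EuclideanSpace ℝ (Fin N) =>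
      ‖z.1 - z.2‖ ^ (((N : ℝ) + 2 * s) / 2)) := by
    fun_prop
  exact ((h1.sub h2).aemeasurable.div h3.aemeasurable).aestronglyMeasurable

lemma memLp_diffQuot_iff (N : ℕ) (s : ℝ) {u : EuclideanSpace ℝ (Fin N) → ℝ}
    (hu : AEStronglyMeasurable u volume) :
    MemLp (diffQuot N s u) 2 volume ↔ Integrable (gagliardoIntegrand N s u u) volume := by
  rw [gagliardoIntegrand_self]
  exact memLp_two_iff_integrable_sq (aestronglyMeasurable_diffQuot N s hu)

lemma gagliardoSeminorm_eq_lpNorm (N : ℕ) (s : ℝ) {u : EuclideanSpace ℝ (Fin N) → ℝ}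
    (hu : AEStronglyMeasurable u volume) :
    gagliardoSeminorm N s u = lpNorm (diffQuot N s u) 2 volume := by
  rw [lpNorm_eq_integral_norm_rpow_toReal (by norm_num) (by norm_num)
    (aestronglyMeasurable_diffQuot N s hu), gagliardoSeminorm, gagliardoForm,
    gagliardoIntegrand_self, Real.sqrt_eq_rpow]
  simp

lemma diffQuot_congr (N : ℕ) (s : ℝ) {u v : EuclideanSpace ℝ (Fin N) → ℝ}
    (h : u =ᵐ[volume] v) : diffQuot N s u =ᵐ[volume] diffQuot N s v := by
  have h1 : ∀ᵐ z : EuclideanSpace ℝ (Fin N) × EuclideanSpace ℝ (Fin N), u z.1 = v z.1 :=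
    Measure.quasiMeasurePreserving_fst.ae h
  have h2 : ∀ᵐ z : EuclideanSpace ℝ (Fin N) × EuclideanSpace ℝ (Fin N), u z.2 = v z.2 :=
    Measure.quasiMeasurePreserving_snd.ae h
  filter_upwards [h1, h2] with z hz1 hz2
  simp [diffQuot, hz1, hz2]

lemma lpNorm_diffQuot_congr (N : ℕ) (s : ℝ) {u v : EuclideanSpace ℝ (Fin N) → ℝ}
    (h : u =ᵐ[volume] v) :
    lpNorm (diffQuot N s u) 2 volume = lpNorm (diffQuot N s v) 2 volume := by
  have h' := diffQuot_congr N s h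
  have hiff : AEStronglyMeasurable (diffQuot N s u) volume ↔
      AEStronglyMeasurable (diffQuot N s v) volume := aestronglyMeasurable_congr h'
  by_cases hu : AEStronglyMeasurable (diffQuot N s u) volume
  · rw [← toReal_eLpNorm hu, ← toReal_eLpNorm (hiff.1 hu), eLpNorm_congr_ae h']
  · rw [lpNorm_of_not_aestronglyMeasurable hu,
      lpNorm_of_not_aestronglyMeasurable (fun hv => hu (hiff.2 hv))]

lemma diffQuot_add (N : ℕ) (s : ℝ) (u v : EuclideanSpace ℝ (Fin N) → ℝ) :
    diffQuot N s (u + v) = diffQuot N s u + diffQuot N s v := by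
  funext z
  simp only [diffQuot, Pi.add_apply]
  ring

lemma diffQuot_smul (N : ℕ) (s : ℝ) (c : ℝ) (u : EuclideanSpace ℝ (Fin N) → ℝ) :
    diffQuot N s (c • u) = c • diffQuot N s u := by
  funext z
  simp only [diffQuot, Pi.smul_apply, smul_eq_mul]
  ring

/-! ## The homogeneous fractional Sobolev space -/

/-- The (classes of) functions `u ∈ L^{2N/(N-2s)}(ℝ^N)` with `[u]_{s,2} < ∞`. -/
def gagliardoSubmodule (N : ℕ) (s : ℝ) :
    Submodule ℝ (Lp ℝ (ENNReal.ofReal (critExp N s))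
      (volume : Measure (EuclideanSpace ℝ (Fin N)))) where
  carrier := {u | Integrable (gagliardoIntegrand N s u u) volume}
  zero_mem' := by
    rw [mem_ofPred_eq, ← memLp_diffQuot_iff N s (Lp.aestronglyMeasurable _)]
    refine (memLp_congr_ae (diffQuot_congr N s (Lp.coeFn_zero _ _ _))).2 ?_
    have : diffQuot N s (0 : EuclideanSpace ℝ (Fin N) → ℝ) = 0 := by
      funext z; simp [diffQuot]
    rw [this]
    exact MemLp.zero
  add_mem' := by
    intro u v hu hv
    rw [mem_ofPred_eq, ← memLp_diffQuot_iff N s (Lp.aestronglyMeasurable _)] at hu hv ⊢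
    refine (memLp_congr_ae (diffQuot_congr N s (Lp.coeFn_add u v))).2 ?_
    rw [diffQuot_add]
    exact hu.add hv
  smul_mem' := by
    intro c u hu
    rw [mem_ofPred_eq, ← memLp_diffQuot_iff N s (Lp.aestronglyMeasurable _)] at hu ⊢
    refine (memLp_congr_ae (diffQuot_congr N s (Lp.coeFn_smul c u))).2 ?_
    rw [diffQuot_smul]
    exact hu.const_smul c

/-- The space `{u ∈ L^{2N/(N-2s)}(ℝ^N) : [u]_{s,2} < ∞}`, to be normed by
`[u]_{s,2} + ‖u‖_{2N/(N-2s)}`. -/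
def GagliardoSpace {N : ℕ} {s : ℝ} (_hs : 0 < s) (_hN : 2 * s < N) : Type :=
  ↥(gagliardoSubmodule N s)

namespace GagliardoSpace

variable {N : ℕ} {s : ℝ} {hs : 0 < s} {hN : 2 * s < N}

instance : AddCommGroup (GagliardoSpace hs hN) :=
  inferInstanceAs (AddCommGroup ↥(gagliardoSubmodule N s))

instance : Module ℝ (GagliardoSpace hs hN) :=
  inferInstanceAs (Module ℝ ↥(gagliardoSubmodule N s))

/-- The class in `L^{2N/(N-2s)}(ℝ^N)` of an element. -/
def toLp (u : GagliardoSpace hs hN) : Lp ℝ (ENNReal.ofReal (critExp N s))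
    (volume : Measure (EuclideanSpace ℝ (Fin N))) := Subtype.val u

/-- A representative of an element, as a function on `ℝ^N`. -/
instance : CoeFun (GagliardoSpace hs hN) (fun _ => EuclideanSpace ℝ (Fin N) → ℝ) :=
  ⟨fun u => toLp u⟩

instance : Norm (GagliardoSpace hs hN) := ⟨fun u => gagliardoSeminorm N s u + ‖toLp u‖⟩

lemma norm_def (u : GagliardoSpace hs hN) : ‖u‖ = gagliardoSeminorm N s u + ‖toLp u‖ := rfl

lemma memLp_diffQuot (u : GagliardoSpace hs hN) : MemLp (diffQuot N s u) 2 volume :=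
  (memLp_diffQuot_iff N s (Lp.aestronglyMeasurable _)).2 (Subtype.property u)

lemma seminorm_eq (u : GagliardoSpace hs hN) :
    gagliardoSeminorm N s u = lpNorm (diffQuot N s u) 2 volume :=
  gagliardoSeminorm_eq_lpNorm N s (Lp.aestronglyMeasurable _)

lemma coe_add (u v : GagliardoSpace hs hN) :
    (toLp (u + v) : EuclideanSpace ℝ (Fin N) → ℝ) =ᵐ[volume] toLp u + toLp v :=
  Lp.coeFn_add (toLp u) (toLp v)

lemma coe_smul (c : ℝ) (u : GagliardoSpace hs hN) :
    (toLp (c • u) : EuclideanSpace ℝ (Fin N) → ℝ) =ᵐ[volume] c • toLp u :=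
  Lp.coeFn_smul c (toLp u)

lemma seminorm_add_le (u v : GagliardoSpace hs hN) :
    gagliardoSeminorm N s (u + v : GagliardoSpace hs hN)
      ≤ gagliardoSeminorm N s u + gagliardoSeminorm N s v := by
  simp only [seminorm_eq]
  rw [lpNorm_diffQuot_congr N s (coe_add u v), diffQuot_add]
  exact lpNorm_add_le (memLp_diffQuot u) (by norm_num)

lemma seminorm_smul (c : ℝ) (u : GagliardoSpace hs hN) :
    gagliardoSeminorm N s (c • u : GagliardoSpace hs hN) = |c| * gagliardoSeminorm N s u := by
  simp only [seminorm_eq]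
  rw [lpNorm_diffQuot_congr N s (coe_smul c u), diffQuot_smul, lpNorm_const_smul]
  simp

lemma core : NormedSpace.Core ℝ (GagliardoSpace hs hN) := by
  have : Fact (1 ≤ ENNReal.ofReal (critExp N s)) := ⟨one_le_ofReal_critExp hs hN⟩
  refine ⟨⟨fun u => ?_, fun c u => ?_, fun u v => ?_⟩, fun u => ⟨fun h => ?_, fun h => ?_⟩⟩
  · exact add_nonneg (Real.sqrt_nonneg _) (norm_nonneg _)
  · have h : ‖toLp (c • u)‖ = ‖c‖ * ‖toLp u‖ := norm_smul c (toLp u)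
    rw [norm_def, norm_def, seminorm_smul, h, Real.norm_eq_abs]
    ring
  · have h : ‖toLp (u + v)‖ ≤ ‖toLp u‖ + ‖toLp v‖ := norm_add_le (toLp u) (toLp v)
    have := seminorm_add_le u v
    simp only [norm_def]
    linarith
  · rw [norm_def] at h
    have h1 : 0 ≤ gagliardoSeminorm N s u := Real.sqrt_nonneg _
    have h2 : ‖toLp u‖ = 0 := le_antisymm (by linarith) (norm_nonneg _)
    exact Subtype.ext (norm_eq_zero.1 h2)
  · subst h
    have h1 : ‖toLp (0 : GagliardoSpace hs hN)‖ = 0 :=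
      norm_zero (E := Lp ℝ (ENNReal.ofReal (critExp N s))
        (volume : Measure (EuclideanSpace ℝ (Fin N))))
    have h2 := seminorm_smul (0 : ℝ) (0 : GagliardoSpace hs hN)
    rw [zero_smul, abs_zero, zero_mul] at h2
    rw [norm_def, h1, h2, add_zero]

instance : NormedAddCommGroup (GagliardoSpace hs hN) := NormedAddCommGroup.ofCore core

instance : NormedSpace ℝ (GagliardoSpace hs hN) := NormedSpace.ofCore core

end GagliardoSpace

/-- The subspace of (classes of) functions in `C_c^1(ℝ^N)`. -/
def testFunctions {N : ℕ} {s : ℝ} (hs : 0 < s) (hN : 2 * s < N) :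
    Submodule ℝ (GagliardoSpace hs hN) where
  carrier := {u | ∃ φ : EuclideanSpace ℝ (Fin N) → ℝ,
    ContDiff ℝ 1 φ ∧ HasCompactSupport φ ∧ (u : EuclideanSpace ℝ (Fin N) → ℝ) =ᵐ[volume] φ}
  zero_mem' := ⟨0, contDiff_const, HasCompactSupport.zero, Lp.coeFn_zero _ _ _⟩
  add_mem' := by
    rintro u v ⟨φ, hφ, hφc, hu⟩ ⟨ψ, hψ, hψc, hv⟩
    exact ⟨φ + ψ, hφ.add hψ, hφc.add hψc, (GagliardoSpace.coe_add u v).trans (hu.add hv)⟩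
  smul_mem' := by
    rintro c u ⟨φ, hφ, hφc, hu⟩
    exact ⟨c • φ, hφ.const_smul c, hφc.smul_left (f := fun _ => c),
      (GagliardoSpace.coe_smul c u).trans (hu.const_smul c)⟩

/-- The homogeneous fractional Sobolev space: the closure of `C_c^1(ℝ^N)` with respect to the
norm `[u]_{s,2} + ‖u‖_{2N/(N-2s)}`; it carries this norm. -/
abbrev HDot {N : ℕ} {s : ℝ} (hs : 0 < s) (hN : 2 * s < N) : Type :=
  ↥(testFunctions hs hN).topologicalClosure

/-- A representative of an element of the homogeneous space, as a function on `ℝ^N`. -/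
def HDot.fn {N : ℕ} {s : ℝ} {hs : 0 < s} {hN : 2 * s < N} (u : HDot hs hN) :
    EuclideanSpace ℝ (Fin N) → ℝ :=
  GagliardoSpace.toLp (u : GagliardoSpace hs hN)

/-! ## The nonlinearity -/

/-- The growth hypothesis on `f` near `0` and near `∞` (superlinear and subcritical). -/
def HypF1 (N : ℕ) (s : ℝ) (f : ℝ → ℝ) : Prop :=
  Tendsto (fun t => f t / t) (𝓝[>] 0) (𝓝 0) ∧
  Tendsto (fun t => f t / t) atTop atTop ∧
  ∃ γ : ℝ, 2 < γ ∧ γ < critExp N s ∧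
    ∃ C > 0, ∃ L ≤ C, Tendsto (fun t => f t / t ^ (γ - 1)) atTop (𝓝 L)

/-- `f(t)/t` is (not necessarily strictly) increasing for large `t`. -/
def HypF2 (f : ℝ → ℝ) : Prop :=
  ∃ R > 0, MonotoneOn (fun t => f t / t) (Ioi R)

/-- `f_a(t) = f(t) - a` for `t ≥ 0` and `f_a(t) = -a` for `t ≤ 0` (the two agree at `0` when
`f(0) = 0`). -/
def fShift (f : ℝ → ℝ) (a t : ℝ) : ℝ := if 0 ≤ t then f t - a else -a

/-- The primitive `F_a(t) = ∫_0^t f_a`. -/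
def FShift (f : ℝ → ℝ) (a t : ℝ) : ℝ := ∫ τ in (0 : ℝ)..t, fShift f a τ

/-! ## Weak and mountain pass solutions of `(-Δ)^s u = g f_a(u)` -/

section Solutions

variable {N : ℕ} {s : ℝ} {hs : 0 < s} {hN : 2 * s < N}

/-- `u` is a weak solution of `(-Δ)^s u = g f_a(u)` in `ℝ^N`. -/
def IsWeakSolution (f : ℝ → ℝ) (g : EuclideanSpace ℝ (Fin N) → ℝ) (a : ℝ)
    (u : HDot hs hN) : Prop :=
  ∀ φ : HDot hs hN,
    Integrable (fun x => g x * fShift f a (u.fn x) * φ.fn x) volume ∧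
    gagliardoForm N s u.fn φ.fn = ∫ x, g x * fShift f a (u.fn x) * φ.fn x

/-- The energy `I_a(u) = [u]_{s,2}^2 / 2 - ∫ g F_a(u)`. -/
def energy (f : ℝ → ℝ) (g : EuclideanSpace ℝ (Fin N) → ℝ) (a : ℝ) (u : HDot hs hN) : ℝ :=
  gagliardoSeminorm N s u.fn ^ 2 / 2 - ∫ x, g x * FShift f a (u.fn x)

/-- The weakened Palais-Smale (Cerami) condition for a functional `I` on the homogeneous space,
at every level `c`: bounded Palais-Smale sequences have convergent subsequences, and
`‖I'(u)‖ [u]_{s,2}` is bounded away from `0` for `u` large with `I(u)` near `c`. -/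
def SatisfiesCerami (I : HDot hs hN → ℝ) : Prop :=
  ∀ c : ℝ,
    (∀ w : ℕ → HDot hs hN, Bornology.IsBounded (range w) →
      Tendsto (fun n => I (w n)) atTop (𝓝 c) →
      Tendsto (fun n => fderiv ℝ I (w n)) atTop (𝓝 0) →
      ∃ v : HDot hs hN, ∃ k : ℕ → ℕ, StrictMono k ∧ Tendsto (w ∘ k) atTop (𝓝 v)) ∧
    ∃ η > 0, ∃ β > 0, ∃ ρ > 0, ∀ v : HDot hs hN,
      I v ∈ Icc (c - η) (c + η) → ρ ≤ gagliardoSeminorm N s v.fn →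
        β ≤ ‖fderiv ℝ I v‖ * gagliardoSeminorm N s v.fn

/-- `u` is a mountain pass solution of `(-Δ)^s u = g f_a(u)`: a weak solution which is a critical
point of the `C¹` energy functional, where the energy satisfies the Cerami condition and has the
mountain pass geometry, and the energy of `u` is the mountain pass level. -/
def IsMountainPassSolution (f : ℝ → ℝ) (g : EuclideanSpace ℝ (Fin N) → ℝ) (a : ℝ)
    (u : HDot hs hN) : Prop :=
  IsWeakSolution f g a u ∧
  (∀ v : HDot hs hN, Integrable (fun x => g x * FShift f a (v.fn x)) volume) ∧
  ContDiff ℝ 1 (energy f g a : HDot hs hN → ℝ) ∧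
  fderiv ℝ (energy f g a) u = 0 ∧
  SatisfiesCerami (energy f g a : HDot hs hN → ℝ) ∧
  ∃ ρ > 0, ∃ β > 0, ∃ e : HDot hs hN,
    energy f g a (0 : HDot hs hN) = 0 ∧
    (∀ v : HDot hs hN, gagliardoSeminorm N s v.fn = ρ → β ≤ energy f g a v) ∧
    ρ < gagliardoSeminorm N s e.fn ∧ energy f g a e < 0 ∧
    β ≤ energy f g a u ∧
    -- the level is the infimum over continuous paths from `0` to `e` of the maximal energy
    IsGLB (range fun p : Path (0 : HDot hs hN) e => ⨆ t, energy f g a (p t)) (energy f g a u)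

end Solutions

end

/- For small `a` the energy has the geometry of a mountain pass, with constants and endpoint
independent of `a`: the term `a ∫ g u` is a small perturbation near the sphere, and superlinearity
makes the energy negative far along a ray through a function which is positive somewhere on the
support of `g`. The Brezis–Browder ordering principle, applied to paths with displacements measured
against Cerami's weight `1 + ‖u‖`, gives points `u` whose energy is close to the mountain pass level
and for which `(1 + ‖u‖) ‖I'(u)‖` is small.

Such points are bounded. Otherwise normalise them: superlinearity forces the weak limit to be
nonpositive on the support of `g`, so along the rays through the points the energy reaches
arbitrarily high values. This contradicts Jeanjean's comparison of the energy on a ray with its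
endpoint, which rests on the quasi-monotonicity of `t f(t) - 2 F(t)`; the term `a ∫ g u` entering it
is controlled by testing `I'(u)` with a truncated negative part of `u`, on which `f` vanishes.

As `g` is integrable and bounded, the homogeneous space embeds compactly, by averaging over small
balls, into the subcritical Lebesgue spaces weighted by `g`; so bounded almost critical sequences
converge. All bounds depend on an upper bound for the level only, hence are uniform in `a`. -/

noncomputable section

/-! ### The mountain pass theorem with Cerami's weight -/

section MountainPass

theorem brezis_browder {X : Type*} {r : X → X → Prop} (hrefl : ∀ p, r p p)
    (htrans : ∀ p q q', r p q → r q q' → r p q') {Φ : X → ℝ} (hΦ : BddBelow (range Φ))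
    (hanti : ∀ p q, r p q → Φ q ≤ Φ p)
    (hlim : ∀ P : ℕ → X, (∀ m n, m ≤ n → r (P m) (P n)) → ∃ p, ∀ n, r (P n) p) (x : X) :
    ∃ p, r x p ∧ ∀ q, r p q → Φ q = Φ p := by
  have exists_half_optimal (p : X) : ∃ q, r p q ∧ ∀ q', r p q' → Φ p - Φ q' ≤ 2 * (Φ p - Φ q) := by
    have hbd : BddBelow (Φ '' {q | r p q}) := hΦ.mono (image_subset_range _ _)
    have hle (q) (hq : r p q) : sInf (Φ '' {q | r p q}) ≤ Φ q := csInf_le hbd ⟨q, hq, rfl⟩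
    rcases (hle p (hrefl p)).eq_or_lt with h | h
    · exact ⟨p, hrefl p, fun q' hq' => by linarith [hle q' hq']⟩
    · obtain ⟨_, ⟨q, hq, rfl⟩, hlt⟩ := exists_lt_of_csInf_lt (Set.Nonempty.image _ ⟨p, hrefl p⟩)
        (show sInf (Φ '' {q | r p q}) < (Φ p + sInf (Φ '' {q | r p q})) / 2 by linarith)
      exact ⟨q, hq, fun q' hq' => by linarith [hle q' hq']⟩
  choose next hnext hoptimal using exists_half_optimal
  set P : ℕ → X := fun n => next^[n] x
  have hP (n : ℕ) : P (n + 1) = next (P n) := Function.iterate_succ_apply' _ _ _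
  have hchain (m n : ℕ) (hmn : m ≤ n) : r (P m) (P n) := by
    induction n, hmn using Nat.le_induction with
    | base => exact hrefl _
    | succ n _ ih => exact htrans _ _ _ ih (hP n ▸ hnext (P n))
  obtain ⟨p, hp⟩ := hlim P hchain
  refine ⟨p, hp 0, fun q hq => (hanti p q hq).antisymm ?_⟩
  have hconv : Tendsto (fun n => Φ (P n)) atTop (𝓝 (⨅ n, Φ (P n))) :=
    tendsto_atTop_ciInf (fun m n hmn => hanti _ _ (hchain m n hmn))
      (hΦ.mono (range_comp_subset_range P Φ))
  have hgap : Tendsto (fun n => 2 * (Φ (P n) - Φ (P (n + 1)))) atTop (𝓝 0) := by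
    simpa using (hconv.sub (hconv.comp (tendsto_add_atTop_nat 1))).const_mul 2
  refine sub_nonpos.1 (ge_of_tendsto' hgap fun n => ?_)
  have := hoptimal (P n) q (htrans _ _ _ (hp n) hq)
  rw [← hP] at this
  linarith [hanti _ _ (hp n)]

variable {E : Type*} [NormedAddCommGroup E] {x y : E}

lemma continuous_iSup_comp {I : E → ℝ} (hI : Continuous I) :
    Continuous fun p : C(unitInterval, E) => ⨆ t, I (p t) := by
  have h := isCompact_univ.continuous_sSup (K := (univ : Set unitInterval))
    (f := fun (p : C(unitInterval, E)) t => I (p t)) (by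
      change Continuous fun z : C(unitInterval, E) × unitInterval => I (z.1 z.2)
      fun_prop)
  simpa only [image_univ, sSup_range] using h

lemma le_iSup_comp_path {I : E → ℝ} (hI : Continuous I) (p : Path x y) (t : unitInterval) :
    I (p t) ≤ ⨆ t, I (p t) :=
  le_ciSup (f := fun t => I (p t)) (isCompact_range (by fun_prop)).bddAbove t

/-- The descent relation of the mountain pass argument: `q` lies below `p`, and the drop
`Φ p - Φ q` controls the displacement at each time relative to Cerami's weight `1 + ‖p t‖`. The
exponential turns this relative distance into one satisfying the triangle inequality, which makes
the relation transitive. -/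
def IsWeightedDescent (Φ : Path x y → ℝ) (k : ℝ) (p q : Path x y) : Prop :=
  ∀ t, 1 + ‖p t‖ + ‖q t - p t‖ ≤ Real.exp ((Φ p - Φ q) / k) * (1 + ‖p t‖)

namespace IsWeightedDescent

variable {Φ : Path x y → ℝ} {k : ℝ} {p q q' : Path x y}

lemma refl (p : Path x y) : IsWeightedDescent Φ k p p := fun t => by simp

lemma one_le_exp (h : IsWeightedDescent Φ k p q) : 1 ≤ Real.exp ((Φ p - Φ q) / k) :=
  (le_mul_iff_one_le_left (by positivity : 0 < 1 + ‖p 0‖)).1 <|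
    (le_add_of_nonneg_right (norm_nonneg _)).trans (h 0)

lemma le (hk : 0 < k) (h : IsWeightedDescent Φ k p q) : Φ q ≤ Φ p := by
  have := h.one_le_exp
  rw [Real.one_le_exp_iff, le_div_iff₀ hk] at this
  linarith

lemma one_add_norm_le (h : IsWeightedDescent Φ k p q) (t : unitInterval) :
    1 + ‖q t‖ ≤ Real.exp ((Φ p - Φ q) / k) * (1 + ‖p t‖) := by
  linarith [h t, norm_le_norm_add_norm_sub (p t) (q t), norm_sub_rev (p t) (q t)]

lemma trans (h : IsWeightedDescent Φ k p q) (h' : IsWeightedDescent Φ k q q') :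
    IsWeightedDescent Φ k p q' := fun t => by
  have hexp : Real.exp ((Φ p - Φ q') / k) =
      Real.exp ((Φ q - Φ q') / k) * Real.exp ((Φ p - Φ q) / k) := by
    rw [← Real.exp_add]
    ring_nf
  have hfactor : 0 ≤ Real.exp ((Φ q - Φ q') / k) - 1 := sub_nonneg.2 h'.one_le_exp
  have hqt : 1 + ‖q t‖ ≤ 1 + ‖p t‖ + ‖q t - p t‖ := by
    linarith [norm_le_norm_add_norm_sub (p t) (q t), norm_sub_rev (p t) (q t)]
  calc 1 + ‖p t‖ + ‖q' t - p t‖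
      ≤ 1 + ‖p t‖ + ‖q t - p t‖ + ‖q' t - q t‖ := by
        linarith [norm_sub_le_norm_sub_add_norm_sub (q' t) (q t) (p t)]
    _ ≤ 1 + ‖p t‖ + ‖q t - p t‖ + (Real.exp ((Φ q - Φ q') / k) - 1) * (1 + ‖q t‖) := by
        linarith [h' t]
    _ ≤ 1 + ‖p t‖ + ‖q t - p t‖
        + (Real.exp ((Φ q - Φ q') / k) - 1) * (1 + ‖p t‖ + ‖q t - p t‖) := by
        linarith [mul_le_mul_of_nonneg_left hqt hfactor]
    _ = Real.exp ((Φ q - Φ q') / k) * (1 + ‖p t‖ + ‖q t - p t‖) := by ring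
    _ ≤ Real.exp ((Φ q - Φ q') / k) * (Real.exp ((Φ p - Φ q) / k) * (1 + ‖p t‖)) := by
        gcongr
        exact h t
    _ = Real.exp ((Φ p - Φ q') / k) * (1 + ‖p t‖) := by rw [hexp, mul_assoc]

lemma dist_le (h : IsWeightedDescent Φ k p q) {R : ℝ} (hR : ∀ t, 1 + ‖p t‖ ≤ R) :
    dist p.toContinuousMap q.toContinuousMap ≤ (Real.exp ((Φ p - Φ q) / k) - 1) * R := by
  have hfactor : 0 ≤ Real.exp ((Φ p - Φ q) / k) - 1 := sub_nonneg.2 h.one_le_exp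
  have hR0 : 0 ≤ R := (by positivity : 0 ≤ 1 + ‖p 0‖).trans (hR 0)
  refine (ContinuousMap.dist_le (by positivity)).2 fun t => ?_
  rw [dist_comm, dist_eq_norm]
  calc ‖q t - p t‖ ≤ (Real.exp ((Φ p - Φ q) / k) - 1) * (1 + ‖p t‖) := by linarith [h t]
    _ ≤ (Real.exp ((Φ p - Φ q) / k) - 1) * R := by gcongr; exact hR t

lemma exists_limit [CompleteSpace E] {Ψ : C(unitInterval, E) → ℝ} (hΨ : Continuous Ψ)
    (hΦ : ∀ p : Path x y, Φ p = Ψ p.toContinuousMap) (hbdd : BddBelow (range Φ))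
    (hk : 0 < k) {P : ℕ → Path x y}
    (hP : ∀ m n, m ≤ n → IsWeightedDescent Φ k (P m) (P n)) :
    ∃ p, ∀ n, IsWeightedDescent Φ k (P n) p := by
  obtain ⟨b, hb⟩ := hbdd
  have hbddP : BddBelow (range fun n => Φ (P n)) := 
    ⟨b, by rintro _ ⟨n, rfl⟩; exact hb ⟨P n, rfl⟩⟩
  set R : ℝ := Real.exp ((Φ (P 0) - b) / k) * (1 + ‖(P 0).toContinuousMap‖)
  have hR (n t) : 1 + ‖P n t‖ ≤ R := by
    refine ((hP 0 n n.zero_le).one_add_norm_le t).trans ?_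
    simp only [R]
    gcongr
    · exact hb ⟨P n, rfl⟩
    · exact (P 0).toContinuousMap.norm_coe_le_norm t
  have hconv : Tendsto (fun n => Φ (P n)) atTop (𝓝 (⨅ n, Φ (P n))) :=
    tendsto_atTop_ciInf (fun m n hmn => (hP m n hmn).le hk) hbddP
  have hgap : Tendsto (fun n => (Real.exp ((Φ (P n) - ⨅ n, Φ (P n)) / k) - 1) * R) atTop (𝓝 0) := by
    have : Tendsto (fun n => (Φ (P n) - ⨅ n, Φ (P n)) / k) atTop (𝓝 0) := by
      simpa using (hconv.sub_const (⨅ n, Φ (P n))).div_const k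
    simpa using (((Real.continuous_exp.tendsto 0).comp this).sub_const 1).mul_const R
  have hcauchy : CauchySeq fun n => (P n).toContinuousMap := by
    refine cauchySeq_of_le_tendsto_0' (fun n => (Real.exp ((Φ (P n) - ⨅ n, Φ (P n)) / k) - 1) * R)
      (fun m n hmn => ((hP m n hmn).dist_le (hR m)).trans ?_) hgap
    have _ : 0 ≤ R := by positivity
    gcongr
    exact ciInf_le hbddP n
  obtain ⟨p, hp⟩ := cauchySeq_tendsto_of_complete hcauchy
  have heval (t) : Tendsto (fun n => P n t) atTop (𝓝 (p t)) :=
    ((continuous_eval_const t).tendsto p).comp hp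
  let p' : Path x y := ⟨p, tendsto_nhds_unique (heval 0) (by simp),
    tendsto_nhds_unique (heval 1) (by simp)⟩
  have hΦp : Tendsto (fun n => Φ (P n)) atTop (𝓝 (Φ p')) := by
    simp only [hΦ]
    exact (hΨ.tendsto p).comp hp
  refine ⟨p', fun n t => le_of_tendsto_of_tendsto
    (((heval t).sub_const (P n t)).norm.const_add (1 + ‖P n t‖))
    (((Real.continuous_exp.tendsto _).comp ((hΦp.const_sub (Φ (P n))).div_const k)).mul_const _)
    (eventually_atTop.2 ⟨n, fun m hm => hP n m hm t⟩)⟩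

end IsWeightedDescent

variable [NormedSpace ℝ E]

lemma exists_norm_le_one_apply_lt_neg {L : E →L[ℝ] ℝ} {δ : ℝ} (h : δ < ‖L‖) :
    ∃ v, ‖v‖ ≤ 1 ∧ L v < -δ := by
  obtain ⟨w, hw, hLw⟩ := L.exists_lt_apply_of_lt_opNorm h
  rcases lt_abs.1 hLw with h | h
  · exact ⟨-w, by simpa using hw.le, by simpa using h⟩
  · exact ⟨w, hw.le, by linarith⟩

lemma exists_descent_field {X : Type*} [TopologicalSpace X] [NormalSpace X] [ParacompactSpace X]
    {L : X → E →L[ℝ] ℝ} (hL : Continuous L) {δ : X → ℝ} (hδ : Continuous δ)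
    {A B : Set X} (hA : IsClosed A) (hB : IsClosed B) (hAB : Disjoint A B)
    (hlt : ∀ x ∈ A, δ x < ‖L x‖) :
    ∃ v : C(X, E), ∀ x, ‖v x‖ ≤ 1 ∧ (x ∈ A → L x (v x) < -δ x) ∧ (x ∈ B → v x = 0) := by
  refine exists_continuous_forall_mem_convex_of_local_const
    (t := fun x => {v | ‖v‖ ≤ 1 ∧ (x ∈ A → L x v < -δ x) ∧ (x ∈ B → v = 0)})
    (fun x => ?_) fun x => ?_
  · have hconvex : Convex ℝ ({v | ‖v‖ ≤ 1} ∩ {v | x ∈ A → L x v < -δ x} ∩ {v | x ∈ B → v = 0}) := by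
      refine ((?_ : Convex ℝ _).inter ?_).inter ?_
      · simpa [Metric.closedBall, dist_zero_right] using convex_closedBall (0 : E) 1
      · by_cases hx : x ∈ A
        · simpa [hx] using convex_halfSpace_lt (L x).isLinear (-δ x)
        · simp [hx, convex_univ]
      · by_cases hx : x ∈ B
        · simp [hx]
        · simp [hx, convex_univ]
    simpa only [inter_def, mem_ofPred_eq, and_assoc] using hconvex
  · by_cases hx : x ∈ A
    · obtain ⟨v, hv, hLv⟩ := exists_norm_le_one_apply_lt_neg (hlt x hx)
      have hxB : x ∈ Bᶜ := disjoint_left.1 hAB hx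
      have hcont : Continuous fun y => L y v + δ y := by fun_prop
      refine ⟨v, ?_⟩
      filter_upwards [hcont.continuousAt.eventually_lt_const (show L x v + δ x < 0 by linarith),
        hB.isOpen_compl.mem_nhds hxB] with y hy hyB
      exact ⟨hv, fun _ => by linarith, fun h => (hyB h).elim⟩
    · refine ⟨0, ?_⟩
      filter_upwards [hA.isOpen_compl.mem_nhds hx] with y hy
      exact ⟨by simp, fun h => (hy h).elim, fun _ => rfl⟩

lemma image_add_smul_sub_le {I : E → ℝ} {I' : E → E →L[ℝ] ℝ} (hI : ∀ u, HasFDerivAt I (I' u) u)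
    {u w : E} {τ C : ℝ} (hτ : 0 ≤ τ) (hle : ∀ σ ∈ Ioo 0 τ, I' (u + σ • w) w ≤ C) :
    I (u + τ • w) - I u ≤ C * τ := by
  have hd (σ : ℝ) : HasDerivAt (fun σ : ℝ => I (u + σ • w)) (I' (u + σ • w) w) σ := by
    have hline : HasDerivAt (fun σ : ℝ => u + σ • w) w σ := by
      simpa using ((hasDerivAt_id σ).smul_const w).const_add u
    exact (hI _).comp_hasDerivAt σ hline
  simpa using (convex_Icc (0 : ℝ) τ).image_sub_le_mul_sub_of_deriv_le
    (fun σ _ => (hd σ).continuousAt.continuousWithinAt)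
    (fun σ _ => (hd σ).differentiableAt.differentiableWithinAt)
    (fun σ hσ => (hd σ).deriv ▸ hle σ (interior_Icc (α := ℝ) ▸ hσ))
    0 (left_mem_Icc.2 hτ) τ (right_mem_Icc.2 hτ) hτ

lemma exists_forall_small_step {X : Type*} [TopologicalSpace X] [CompactSpace X] {I : E → ℝ}
    {I' : E → E →L[ℝ] ℝ} (hI : Continuous I) (hI' : Continuous I') {p w : X → E}
    (hp : Continuous p) (hw : Continuous w) {A : Set X} (hA : IsClosed A) {δ κ : ℝ} (hκ : 0 < κ)
    (hlt : ∀ x ∈ A, I' (p x) (w x) < -δ) :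
    ∃ r > 0, ∀ σ : ℝ, |σ| < r → (∀ x ∈ A, I' (p x + σ • w x) (w x) < -δ) ∧
      ∀ x, I (p x + σ • w x) - I (p x) < κ := by
  have hderiv : ∀ᶠ σ in 𝓝 (0 : ℝ), ∀ x ∈ A, I' (p x + σ • w x) (w x) < -δ := by
    refine hA.isCompact.eventually_forall_of_forall_eventually fun x hx => ?_
    have hcont : Continuous fun z : ℝ × X => I' (p z.2 + z.1 • w z.2) := by fun_prop
    have hcont' : Continuous fun z : ℝ × X => I' (p z.2 + z.1 • w z.2) (w z.2) :=
      hcont.clm_apply (by fun_prop)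
    exact (hcont'.tendsto (0, x)).eventually_lt_const (by simpa using hlt x hx)
  have hvalue : ∀ᶠ σ in 𝓝 (0 : ℝ), ∀ x ∈ univ, I (p x + σ • w x) - I (p x) < κ := by
    refine isCompact_univ.eventually_forall_of_forall_eventually fun x _ => ?_
    have hcont : Continuous fun z : ℝ × X => I (p z.2 + z.1 • w z.2) - I (p z.2) := by fun_prop
    exact (hcont.tendsto (0, x)).eventually_lt_const (by simpa using hκ)
  obtain ⟨r, hr, h⟩ := Metric.eventually_nhds_iff.1 (hderiv.and hvalue)
  refine ⟨r, hr, fun σ hσ => ?_⟩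
  have := h (y := σ) (by simpa using hσ)
  exact ⟨this.1, fun x => this.2 x (mem_univ x)⟩

lemma exists_path_descent {I : E → ℝ} {I' : E → E →L[ℝ] ℝ}
    (hI : ∀ u, HasFDerivAt I (I' u) u) (hI' : Continuous I') (p : Path x y) {M κ δ : ℝ}
    (hκ : 0 < κ) (hδ : 0 < δ) (hle : ∀ t, I (p t) ≤ M) (hx : I x < M - κ) (hy : I y < M - κ)
    (hgrad : ∀ t, M - κ ≤ I (p t) → δ ≤ ‖I' (p t)‖ * (1 + ‖p t‖)) :
    ∃ τ > 0, ∃ q : Path x y,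
      (∀ t, ‖q t - p t‖ ≤ τ * (1 + ‖p t‖)) ∧ ∀ t, I (q t) ≤ M - τ * (δ / 2) := by
  have hIc : Continuous I := continuous_iff_continuousAt.2 fun u => (hI u).continuousAt
  set A : Set unitInterval := {t | M - κ ≤ I (p t)} with hA
  have hAclosed : IsClosed A := isClosed_le continuous_const (by fun_prop)
  have hAB : Disjoint A {0, 1} := by
    rw [disjoint_left]
    rintro t ht (rfl | rfl) <;> simp only [hA, mem_ofPred_eq, p.source, p.target] at ht <;> linarith
  obtain ⟨v, hv⟩ := exists_descent_field (L := fun t => I' (p t))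
    (δ := fun t => δ / 2 / (1 + ‖p t‖)) (by fun_prop)
    (by fun_prop (disch := intro t; positivity)) hAclosed
    (by simp : ({0, 1} : Set unitInterval).Finite).isClosed hAB fun t ht => by
      rw [div_lt_iff₀ (by positivity)]
      linarith [hgrad t ht]
  set w : unitInterval → E := fun t => (1 + ‖p t‖) • v t with hw
  have hwc : Continuous w := by fun_prop
  have hw_deriv (t) (ht : t ∈ A) : I' (p t) (w t) < -(δ / 2) := by
    have := mul_lt_mul_of_pos_left ((hv t).2.1 ht) (by positivity : 0 < 1 + ‖p t‖)
    rwa [mul_neg, mul_div_cancel₀ _ (by positivity), ← smul_eq_mul, ← map_smul] at this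
  obtain ⟨r, hr, hstep⟩ := exists_forall_small_step hIc hI' (by fun_prop) hwc hAclosed
    (half_pos hκ) hw_deriv
  obtain ⟨τ, hτ, hτr, hτκ⟩ : ∃ τ > 0, τ < r ∧ τ * (δ / 2) ≤ κ / 2 := by
    refine ⟨min (r / 2) (κ / δ), by positivity, (min_le_left _ _).trans_lt (by linarith), ?_⟩
    calc min (r / 2) (κ / δ) * (δ / 2) ≤ κ / δ * (δ / 2) := by gcongr; exact min_le_right _ _
      _ = κ / 2 := by field_simp
  refine ⟨τ, hτ, ⟨⟨fun t => p t + τ • w t, by fun_prop⟩, ?_, ?_⟩, fun t => ?_, fun t => ?_⟩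
  · simp [hw, (hv 0).2.2 (by simp)]
  · simp [hw, (hv 1).2.2 (by simp)]
  · have hwt : ‖w t‖ ≤ 1 + ‖p t‖ := by
      rw [hw, norm_smul, Real.norm_of_nonneg (by positivity)]
      exact mul_le_of_le_one_right (by positivity) (hv t).1
    simpa [norm_smul, abs_of_pos hτ] using mul_le_mul_of_nonneg_left hwt hτ.le
  · change I (p t + τ • w t) ≤ _
    by_cases ht : t ∈ A
    · have := image_add_smul_sub_le hI hτ.le fun σ hσ =>
        ((hstep σ (by rw [abs_of_pos hσ.1]; exact hσ.2.trans hτr)).1 t ht).le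
      linarith [hle t]
    · linarith [(hstep τ (by rwa [abs_of_pos hτ])).2 t, show I (p t) < M - κ from not_le.1 ht]

theorem exists_almost_critical_of_mountainPass [CompleteSpace E] {I : E → ℝ}
    {I' : E → E →L[ℝ] ℝ} (hI : ∀ u, HasFDerivAt I (I' u) u) (hI' : Continuous I') {c : ℝ}
    (hc : IsGLB (range fun p : Path x y => ⨆ t, I (p t)) c) (hx : I x < c) (hy : I y < c)
    {ε : ℝ} (hε : 0 < ε) : ∃ u, |I u - c| ≤ ε ∧ ‖I' u‖ * (1 + ‖u‖) < ε := by
  by_contra! hcon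
  have hIc : Continuous I := continuous_iff_continuousAt.2 fun u => (hI u).continuousAt
  set Φ : Path x y → ℝ := fun p => ⨆ t, I (p t)
  have hε2 : 0 < ε / 2 := half_pos hε
  obtain ⟨_, ⟨p₀, rfl⟩, -, hp₀⟩ := hc.exists_between (show c < c + ε by linarith)
  obtain ⟨p, hp₀p, hmin⟩ := brezis_browder (r := IsWeightedDescent Φ (ε / 2))
    IsWeightedDescent.refl (fun _ _ _ h h' => h.trans h') ⟨c, hc.1⟩
    (fun _ _ h => h.le hε2)
    (fun P hP => IsWeightedDescent.exists_limit (continuous_iSup_comp hIc) (fun _ => rfl)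
      ⟨c, hc.1⟩ hε2 hP) p₀
  have hcp : c ≤ Φ p := hc.1 ⟨p, rfl⟩
  have hpε : Φ p < c + ε := (hp₀p.le hε2).trans_lt hp₀
  obtain ⟨κ, hκ, hκε, hκx, hκy⟩ : ∃ κ > 0, κ ≤ ε ∧ κ < c - I x ∧ κ < c - I y := by
    have hx' := sub_pos.2 hx
    have hy' := sub_pos.2 hy
    obtain ⟨κ, hκ, hlt⟩ := exists_between (lt_min hε (lt_min hx' hy'))
    simp only [lt_min_iff] at hlt
    exact ⟨κ, hκ, hlt.1.le, hlt.2⟩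
  obtain ⟨τ, hτ, q, hqp, hqI⟩ := exists_path_descent hI hI' p hκ hε
    (le_iSup_comp_path hIc p) (by linarith) (by linarith) fun t ht => hcon _ (by
      rw [abs_le]
      constructor <;> linarith [le_iSup_comp_path hIc p t])
  have hΦq : Φ q ≤ Φ p - τ * (ε / 2) := ciSup_le hqI
  have hτ_le : τ ≤ (Φ p - Φ q) / (ε / 2) := by
    rw [le_div_iff₀ hε2]
    linarith
  refine (hmin q fun t => ?_).not_lt (by linarith [mul_pos hτ hε2])
  calc 1 + ‖p t‖ + ‖q t - p t‖ ≤ (τ + 1) * (1 + ‖p t‖) := by linarith [hqp t]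
    _ ≤ Real.exp ((Φ p - Φ q) / (ε / 2)) * (1 + ‖p t‖) := by
        gcongr
        exact (Real.add_one_le_exp τ).trans (Real.exp_le_exp.2 hτ_le)

end MountainPass

/-! ### Superposition operators between Lebesgue spaces -/

section Superposition

variable {α : Type*} [MeasurableSpace α] {μ : Measure α}

/-- `φ` has growth at most `1 + |t| ^ m`, the hypothesis under which `v ↦ φ ∘ v` maps `L ^ p` to
`L ^ (p / m)`. -/
def PowerGrowth (φ : ℝ → ℝ) (m : ℝ) : Prop := ∃ C, 0 ≤ C ∧ ∀ t, |φ t| ≤ C * (1 + |t| ^ m)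

lemma unifIntegrable_of_eLpNorm_le {ι : Type*} {q r : ENNReal} (hq : q ≠ 0) (hqr : q < r)
    {f : ι → α → ℝ} (hf : ∀ i, AEStronglyMeasurable (f i) μ) {M : ENNReal} (hM : M ≠ ⊤)
    (h : ∀ i, eLpNorm (f i) r μ ≤ M) : UnifIntegrable f q μ := by
  intro ε hε
  have hqtop : q ≠ ⊤ := ne_top_of_lt hqr
  set e : ℝ := 1 / q.toReal - 1 / r.toReal with he
  have hq0 : 0 < q.toReal := ENNReal.toReal_pos hq hqtop
  have he0 : 0 < e := by
    rw [he, sub_pos]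
    rcases eq_or_ne r ⊤ with rfl | hr
    · simpa using hq0
    · exact one_div_lt_one_div_of_lt hq0 ((ENNReal.toReal_lt_toReal hqtop hr).2 hqr)
  set m : ℝ := M.toReal + 1
  have hm0 : 0 < m := by positivity
  refine ⟨(ε / m) ^ (1 / e), by positivity, fun i s hs hμs => ?_⟩
  rw [eLpNorm_indicator_eq_eLpNorm_restrict hs]
  calc eLpNorm (f i) q (μ.restrict s)
      ≤ eLpNorm (f i) r (μ.restrict s) * (μ.restrict s) univ ^ e :=
        eLpNorm_le_eLpNorm_mul_rpow_measure_univ hqr.le (hf i).restrict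
    _ ≤ ENNReal.ofReal m * ENNReal.ofReal ((ε / m) ^ (1 / e)) ^ e := by
        gcongr
        · calc eLpNorm (f i) r (μ.restrict s) ≤ eLpNorm (f i) r μ :=
                eLpNorm_mono_measure _ Measure.restrict_le_self
            _ ≤ M := h i
            _ = ENNReal.ofReal M.toReal := (ENNReal.ofReal_toReal hM).symm
            _ ≤ ENNReal.ofReal m := ENNReal.ofReal_le_ofReal (by linarith)
        · rwa [Measure.restrict_apply_univ]
    _ = ENNReal.ofReal ε := by
        rw [ENNReal.ofReal_rpow_of_nonneg (by positivity) he0.le, ← Real.rpow_mul (by positivity),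
          one_div_mul_cancel he0.ne', Real.rpow_one, ← ENNReal.ofReal_mul hm0.le]
        congr 1
        field_simp

lemma eLpNorm_comp_le {φ : ℝ → ℝ} {m p C : ℝ} (hm : 0 < m) (hmp : m ≤ p) (hC : 0 ≤ C)
    (hφ : ∀ t, |φ t| ≤ C * (1 + |t| ^ m)) {v : α → ℝ} (hv : AEStronglyMeasurable v μ) :
    eLpNorm (fun x => φ (v x)) (ENNReal.ofReal (p / m)) μ ≤ ENNReal.ofReal C *
      (eLpNorm (fun _ => (1 : ℝ)) (ENNReal.ofReal (p / m)) μ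
        + eLpNorm v (ENNReal.ofReal p) μ ^ m) := by
  have hexp : (1 : ENNReal) ≤ ENNReal.ofReal (p / m) := by
    rwa [ENNReal.one_le_ofReal, one_le_div hm]
  have hpow : eLpNorm (fun x => ‖v x‖ ^ m) (ENNReal.ofReal (p / m)) μ
      = eLpNorm v (ENNReal.ofReal p) μ ^ m := by
    rw [eLpNorm_norm_rpow _ hm, ← ENNReal.ofReal_mul (div_nonneg (hm.le.trans hmp) hm.le),
      div_mul_cancel₀ _ hm.ne']
  calc eLpNorm (fun x => φ (v x)) (ENNReal.ofReal (p / m)) μ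
      ≤ eLpNorm (C • ((fun _ => (1 : ℝ)) + fun x => ‖v x‖ ^ m)) (ENNReal.ofReal (p / m)) μ :=
        eLpNorm_mono_real fun x => by simpa using hφ (v x)
    _ ≤ ENNReal.ofReal C * eLpNorm ((fun _ => (1 : ℝ)) + fun x => ‖v x‖ ^ m)
          (ENNReal.ofReal (p / m)) μ := by
        rw [eLpNorm_const_smul, ← ofReal_norm, Real.norm_of_nonneg hC]
    _ ≤ _ := by
        rw [← hpow]
        gcongr
        exact eLpNorm_add_le aestronglyMeasurable_const
          ((hv.norm.aemeasurable.pow_const m).aestronglyMeasurable) hexp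

lemma PowerGrowth.memLp_comp [IsFiniteMeasure μ] {φ : ℝ → ℝ}
    (hφc : Continuous φ) {m p : ℝ} (hm : 0 < m)
    (hmp : m ≤ p) (hφ : PowerGrowth φ m) {v : α → ℝ} (hv : MemLp v (ENNReal.ofReal p) μ) :
    MemLp (fun x => φ (v x)) (ENNReal.ofReal (p / m)) μ := by
  obtain ⟨C, hC, hφ⟩ := hφ
  refine ⟨hφc.comp_aestronglyMeasurable hv.1, (eLpNorm_comp_le hm hmp hC hφ hv.1).trans_lt ?_⟩
  have hone : eLpNorm (fun _ => (1 : ℝ)) (ENNReal.ofReal (p / m)) μ < ⊤ := (memLp_const (1 : ℝ)).2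
  exact ENNReal.mul_lt_top ENNReal.ofReal_lt_top
    (ENNReal.add_lt_top.2 ⟨hone, ENNReal.rpow_lt_top_of_nonneg hm.le hv.2.ne⟩)

lemma memLp_of_ae_tendsto_of_eLpNorm_le {p : ENNReal} {v : ℕ → α → ℝ} {w : α → ℝ}
    (hv : ∀ n, AEStronglyMeasurable (v n) μ) {M : ENNReal} (hM : M ≠ ⊤)
    (hb : ∀ n, eLpNorm (v n) p μ ≤ M)
    (h : ∀ᵐ x ∂μ, Tendsto (fun n => v n x) atTop (𝓝 (w x))) : MemLp w p μ :=
  ⟨aestronglyMeasurable_of_tendsto_ae _ hv h,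
    ((Lp.eLpNorm_lim_le_liminf_eLpNorm hv w h).trans
      (liminf_le_of_le (by isBoundedDefault) fun b hb' => by
        obtain ⟨n, hn⟩ := hb'.exists
        exact hn.trans (hb n))).trans_lt hM.lt_top⟩

lemma PowerGrowth.tendsto_eLpNorm_comp_sub [IsFiniteMeasure μ] {φ : ℝ → ℝ}
    (hφc : Continuous φ) {m p : ℝ} (hm : 0 < m)
    (hφ : PowerGrowth φ m) {q : ENNReal} (hq : 1 ≤ q) (hqp : q < ENNReal.ofReal (p / m))
    {v : ℕ → α → ℝ} {w : α → ℝ}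
    (hv : ∀ n, AEStronglyMeasurable (v n) μ) {M : ENNReal} (hM : M ≠ ⊤)
    (hb : ∀ n, eLpNorm (v n) (ENNReal.ofReal p) μ ≤ M)
    (h : ∀ᵐ x ∂μ, Tendsto (fun n => v n x) atTop (𝓝 (w x))) :
    Tendsto (fun n => eLpNorm ((fun x => φ (v n x)) - fun x => φ (w x)) q μ) atTop (𝓝 0) := by
  have hmp : m ≤ p := by
    rw [← one_le_div hm, ← ENNReal.one_le_ofReal]
    exact hq.trans hqp.le
  have hw := memLp_of_ae_tendsto_of_eLpNorm_le hv hM hb h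
  have hφw := (hφ.memLp_comp hφc hm hmp hw).mono_exponent hqp.le
  obtain ⟨C, hC, hφ⟩ := hφ
  refine tendsto_Lp_finite_of_tendsto_ae hq (ne_top_of_lt hqp)
    (fun n => hφc.comp_aestronglyMeasurable (hv n)) hφw
    (unifIntegrable_of_eLpNorm_le (r := ENNReal.ofReal (p / m)) (M := ENNReal.ofReal C *
      (eLpNorm (fun _ => (1 : ℝ)) (ENNReal.ofReal (p / m)) μ + M ^ m))
      (zero_lt_one.trans_le hq).ne' hqp
      (fun n => hφc.comp_aestronglyMeasurable (hv n)) ?_ fun n => ?_) ?_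
  · have hone : eLpNorm (fun _ => (1 : ℝ)) (ENNReal.ofReal (p / m)) μ < ⊤ := (memLp_const 1).2
    exact (ENNReal.mul_lt_top ENNReal.ofReal_lt_top
      (ENNReal.add_lt_top.2 ⟨hone, ENNReal.rpow_lt_top_of_nonneg hm.le hM⟩)).ne
  · refine (eLpNorm_comp_le hm hmp hC hφ (hv n)).trans ?_
    gcongr
    exact hb n
  · filter_upwards [h] with x hx
    exact (hφc.tendsto _).comp hx

lemma PowerGrowth.integrable_comp [IsFiniteMeasure μ] {φ : ℝ → ℝ}
    (hφc : Continuous φ) {m p : ℝ} (hm : 0 < m)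
    (hmp : m ≤ p) (hφ : PowerGrowth φ m) {v : α → ℝ} (hv : MemLp v (ENNReal.ofReal p) μ) :
    Integrable (fun x => φ (v x)) μ :=
  (hφ.memLp_comp hφc hm hmp hv).integrable
    (by rwa [ENNReal.one_le_ofReal, one_le_div hm])

lemma PowerGrowth.tendsto_integral_comp [IsFiniteMeasure μ] {φ : ℝ → ℝ}
    (hφc : Continuous φ) {m p : ℝ} (hm : 0 < m)
    (hφ : PowerGrowth φ m) (hmp : m < p) {v : ℕ → α → ℝ} {w : α → ℝ}
    (hv : ∀ n, AEStronglyMeasurable (v n) μ) {M : ENNReal} (hM : M ≠ ⊤)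
    (hb : ∀ n, eLpNorm (v n) (ENNReal.ofReal p) μ ≤ M)
    (h : ∀ᵐ x ∂μ, Tendsto (fun n => v n x) atTop (𝓝 (w x))) :
    Tendsto (fun n => ∫ x, φ (v n x) ∂μ) atTop (𝓝 (∫ x, φ (w x) ∂μ)) := by
  have hlt : 1 < ENNReal.ofReal (p / m) := by
    rwa [ENNReal.one_lt_ofReal, one_lt_div hm]
  have hmem : ∀ n, MemLp (v n) (ENNReal.ofReal p) μ := fun n => ⟨hv n, (hb n).trans_lt hM.lt_top⟩
  refine tendsto_integral_of_L1' _
    (hφ.integrable_comp hφc hm hmp.le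
      (memLp_of_ae_tendsto_of_eLpNorm_le hv hM hb h)).aestronglyMeasurable
    (Eventually.of_forall fun n => hφ.integrable_comp hφc hm hmp.le (hmem n)) ?_
  exact hφ.tendsto_eLpNorm_comp_sub hφc hm le_rfl hlt hv hM hb h

lemma PowerGrowth.exists_memLp_bound_segment [IsFiniteMeasure μ] {φ : ℝ → ℝ} {m p : ℝ}
    (hφ : PowerGrowth φ m) (hm : 0 < m) (hmp : m ≤ p) {u v : α → ℝ}
    (hu : MemLp u (ENNReal.ofReal p) μ) (hv : MemLp v (ENNReal.ofReal p) μ) {T : ℝ} (hT : 0 ≤ T) :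
    ∃ b : α → ℝ, MemLp b (ENNReal.ofReal (p / m)) μ ∧
      ∀ x σ, |σ| ≤ T → |φ (u x + σ * v x)| ≤ b x := by
  obtain ⟨C, hC, hφ⟩ := hφ
  have hψc : Continuous fun t : ℝ => C * (1 + |t| ^ m) := by
    have : Continuous fun t : ℝ => |t| ^ m := continuous_abs.rpow_const fun _ => Or.inr hm.le
    fun_prop
  have hψ : PowerGrowth (fun t => C * (1 + |t| ^ m)) m :=
    ⟨C, hC, fun t => by rw [abs_of_nonneg (by positivity)]⟩
  have hb : MemLp (fun x => |u x| + T * |v x|) (ENNReal.ofReal p) μ :=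
    hu.abs.add (hv.abs.const_mul T)
  refine ⟨_, hψ.memLp_comp hψc hm hmp hb, fun x σ hσ => ?_⟩
  have hle : |u x + σ * v x| ≤ |u x| + T * |v x| :=
    (abs_add_le _ _).trans (by rw [abs_mul]; gcongr)
  have hsum : |(|u x| + T * |v x|)| = |u x| + T * |v x| := abs_of_nonneg (by positivity)
  refine (hφ _).trans ?_
  rw [hsum]
  gcongr

end Superposition

lemma PowerGrowth.primitive {f F : ℝ → ℝ} {m : ℝ} (hf : PowerGrowth f m) (hm : 0 ≤ m)
    (hF : ∀ t, HasDerivAt F (f t) t) (hF0 : F 0 = 0) : PowerGrowth F (m + 1) := by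
  obtain ⟨C, hC, h⟩ := hf
  refine ⟨2 * C, by positivity, fun t => ?_⟩
  have hmvt := (convex_Icc (-|t|) |t|).norm_image_sub_le_of_norm_hasDerivWithin_le (f := F)
    (C := C * (1 + |t| ^ m)) (x := 0) (y := t)
    (fun x _ => (hF x).hasDerivWithinAt) (fun x hx => ?_)
    ⟨by simp, by simp⟩ ⟨neg_abs_le t, le_abs_self t⟩
  · rw [hF0, sub_zero, sub_zero, Real.norm_eq_abs, Real.norm_eq_abs] at hmvt
    have hmul : |t| ^ m * |t| = |t| ^ (m + 1) := by
      rcases (abs_nonneg t).eq_or_lt with h0 | h0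
      · rw [← h0, mul_zero, Real.zero_rpow (by linarith)]
      · rw [← Real.rpow_add_one h0.ne']
    have hle : |t| ≤ 1 + |t| ^ (m + 1) := by
      rcases le_total |t| 1 with h1 | h1
      · linarith [Real.rpow_nonneg (abs_nonneg t) (m + 1)]
      · have := Real.rpow_le_rpow_of_exponent_le h1 (show 1 ≤ m + 1 by linarith)
        rw [Real.rpow_one] at this
        linarith
    calc |F t| ≤ C * (1 + |t| ^ m) * |t| := hmvt
      _ = C * (|t| + |t| ^ (m + 1)) := by rw [← hmul]; ring
      _ ≤ C * (2 * (1 + |t| ^ (m + 1))) := by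
        gcongr
        linarith
      _ = _ := by ring
  · refine (h x).trans ?_
    have : |x| ≤ |t| := abs_le.2 hx
    gcongr

lemma hasFDerivAt_of_hasDerivAt_line {E : Type*} [NormedAddCommGroup E] [NormedSpace ℝ E]
    {K : E → ℝ} {K' : E → E →L[ℝ] ℝ} (hK : ∀ u v : E, ∀ θ : ℝ,
      HasDerivAt (fun θ : ℝ => K (u + θ • v)) (K' (u + θ • v) v) θ) (hK' : Continuous K') (u : E) :
    HasFDerivAt K (K' u) u := by
  rw [hasFDerivAt_iff_isLittleO_nhds_zero, Asymptotics.isLittleO_iff]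
  intro ε hε
  have hev : ∀ᶠ w in 𝓝 u, ‖K' w - K' u‖ < ε := by
    have : Tendsto (fun w => ‖K' w - K' u‖) (𝓝 u) (𝓝 0) := by
      have := ((hK'.sub continuous_const).norm.tendsto u : Tendsto (fun w => ‖K' w - K' u‖) _ _)
      simpa using this
    exact this.eventually_lt_const hε
  obtain ⟨r, hr, hball⟩ := Metric.eventually_nhds_iff_ball.1 hev
  filter_upwards [Metric.ball_mem_nhds (0 : E) hr] with h hh
  have hd : ∀ θ : ℝ, HasDerivAt (fun θ : ℝ => K (u + θ • h) - θ * K' u h)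
      (K' (u + θ • h) h - K' u h) θ := fun θ => by
    simpa using (hK u h θ).fun_sub ((hasDerivAt_id' θ).mul_const (K' u h))
  have := norm_image_sub_le_of_norm_deriv_le_segment_01' (C := ε * ‖h‖)
    (fun θ _ => (hd θ).hasDerivWithinAt) (fun θ hθ => ?_)
  · simp only [one_smul, one_mul, zero_smul, zero_mul, add_zero, sub_zero] at this
    rwa [sub_right_comm]
  · have hmem : u + θ • h ∈ Metric.ball u r := by
      rw [Metric.mem_ball, dist_eq_norm, add_sub_cancel_left, norm_smul, Real.norm_of_nonneg hθ.1]
      have : ‖h‖ < r := by simpa using hh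
      nlinarith [hθ.2, norm_nonneg h]
    exact ((K' (u + θ • h) - K' u).le_opNorm h).trans (by gcongr; exact (hball _ hmem).le)

instance fact_one_le_ofReal {p : ℝ} [h : Fact (1 < p)] : Fact (1 ≤ ENNReal.ofReal p) :=
  ⟨ENNReal.one_le_ofReal.2 h.out.le⟩

instance fact_one_le_ofReal_conjExponent {p : ℝ} [h : Fact (1 < p)] :
    Fact (1 ≤ ENNReal.ofReal p.conjExponent) :=
  ⟨ENNReal.one_le_ofReal.2 (Real.HolderConjugate.conjExponent h.out).symm.lt.le⟩

instance holderConjugate_ofReal_conjExponent {p : ℝ} [h : Fact (1 < p)] :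
    ENNReal.HolderConjugate (ENNReal.ofReal p.conjExponent) (ENNReal.ofReal p) :=
  (Real.HolderConjugate.conjExponent h.out).symm.ennrealOfReal

/-! ### Semilinear problems in an abstract energy space -/

/-- The superlinear subcritical nonlinearities `f`, with primitive `F`, vanishing on the negative
half-line. The field `quasi_mono` is the substitute for the monotonicity of `t ↦ f t / t`. -/
structure IsNonlinearity (p γ : ℝ) (f F : ℝ → ℝ) : Prop where
  two_lt : 2 < γ
  lt_crit : γ < p
  cont : Continuous f
  hasDerivAt : ∀ t, HasDerivAt F (f t) t
  zero_of_nonpos : ∀ t ≤ 0, f t = 0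
  prim_zero_of_nonpos : ∀ t ≤ 0, F t = 0
  growth : PowerGrowth f (γ - 1)
  prim_le : ∀ ε > 0, ∃ C ≥ 0, ∀ t, F t ≤ ε * t ^ 2 + C * |t| ^ γ
  superlinear : ∀ M, ∃ C ≥ 0, ∀ t ≥ 0, M * t ^ 2 - C ≤ F t
  quasi_mono : ∃ C ≥ 0, ∀ t θ, 0 ≤ θ → θ ≤ 1 →
    θ * t * f (θ * t) - 2 * F (θ * t) ≤ t * f t - 2 * F t + C

namespace IsNonlinearity

variable {p γ : ℝ} {f F : ℝ → ℝ}

lemma cont_prim (hf : IsNonlinearity p γ f F) : Continuous F :=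
  continuous_iff_continuousAt.2 fun t => (hf.hasDerivAt t).continuousAt

lemma growth_prim (hf : IsNonlinearity p γ f F) : PowerGrowth F γ := by
  have := hf.growth.primitive (by linarith [hf.two_lt]) hf.hasDerivAt
    (hf.prim_zero_of_nonpos 0 le_rfl)
  rwa [sub_add_cancel] at this

lemma conjExponent_lt (hf : IsNonlinearity p γ f F) :
    ENNReal.ofReal p.conjExponent < ENNReal.ofReal (p / (γ - 1)) := by
  have hγ := hf.two_lt
  have hγp := hf.lt_crit
  rw [ENNReal.ofReal_lt_ofReal_iff (div_pos (by linarith) (by linarith)), Real.conjExponent]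
  exact div_lt_div_of_pos_left (by linarith) (by linarith) (by linarith)

variable {α : Type*} [MeasurableSpace α] {μ : Measure α} [IsFiniteMeasure μ]

lemma memLp_comp (hf : IsNonlinearity p γ f F) {v : α → ℝ} (hv : MemLp v (ENNReal.ofReal p) μ) :
    MemLp (fun x => f (v x)) (ENNReal.ofReal p.conjExponent) μ :=
  (hf.growth.memLp_comp hf.cont (by linarith [hf.two_lt]) (by linarith [hf.lt_crit])
    hv).mono_exponent hf.conjExponent_lt.le

lemma integrable_prim_comp (hf : IsNonlinearity p γ f F) {v : α → ℝ}
    (hv : MemLp v (ENNReal.ofReal p) μ) : Integrable (fun x => F (v x)) μ :=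
  hf.growth_prim.integrable_comp hf.cont_prim (by linarith [hf.two_lt]) hf.lt_crit.le hv

lemma hasDerivAt_integral_prim_line [Fact (1 < p)] (hf : IsNonlinearity p γ f F) {u v : α → ℝ}
    (hu : MemLp u (ENNReal.ofReal p) μ) (hv : MemLp v (ENNReal.ofReal p) μ) (θ : ℝ) :
    HasDerivAt (fun θ => ∫ x, F (u x + θ * v x) ∂μ) (∫ x, f (u x + θ * v x) * v x ∂μ) θ := by
  have hline (θ : ℝ) : MemLp (fun x => u x + θ * v x) (ENNReal.ofReal p) μ :=
    hu.add (hv.const_mul θ)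
  obtain ⟨b, hb, hfb⟩ := hf.growth.exists_memLp_bound_segment (by linarith [hf.two_lt])
    (by linarith [hf.lt_crit]) hu hv (by positivity : 0 ≤ |θ| + 1)
  refine (hasDerivAt_integral_of_dominated_loc_of_deriv_le (s := Metric.ball θ 1)
    (F' := fun θ x => f (u x + θ * v x) * v x) (bound := fun x => b x * |v x|)
    (Metric.ball_mem_nhds θ one_pos)
    (Eventually.of_forall fun σ => hf.cont_prim.comp_aestronglyMeasurable (hline σ).1)
    (hf.integrable_prim_comp (hline θ))
    ((hf.cont.comp_aestronglyMeasurable (hline θ).1).mul hv.1)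
    (ae_of_all _ fun x σ hσ => ?_)
    ((hb.mono_exponent hf.conjExponent_lt.le).integrable_mul hv.abs)
    (ae_of_all _ fun x σ _ => ?_)).2
  · have hσ' : |σ| ≤ |θ| + 1 := by
      rw [Metric.mem_ball, Real.dist_eq] at hσ
      linarith [abs_sub_abs_le_abs_sub σ θ]
    rw [norm_mul]
    exact mul_le_mul_of_nonneg_right (hfb x σ hσ') (abs_nonneg _)
  · have hlineDeriv : HasDerivAt (fun σ : ℝ => u x + σ * v x) (v x) σ := by
      simpa using ((hasDerivAt_id σ).mul_const (v x)).const_add (u x)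
    exact (hf.hasDerivAt _).comp σ hlineDeriv

end IsNonlinearity

/-- A Banach space with an equivalent inner product `form`, mapped compactly (in the sense of
almost everywhere convergence of subsequences) into functions of `L^p(μ)`, in which negative parts
can be truncated. -/
structure EnergySpace (E : Type*) [NormedAddCommGroup E] [NormedSpace ℝ E] {α : Type*}
    [MeasurableSpace α] (μ : Measure α) (p : ℝ) [Fact (1 < p)] where
  /-- the inner product -/
  form : E →L[ℝ] E →L[ℝ] ℝ
  form_symm : ∀ u v, form u v = form v u
  /-- the coercivity constant -/
  lower : ℝ
  lower_pos : 0 < lower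
  le_form : ∀ u, lower * ‖u‖ ^ 2 ≤ form u u
  /-- the embedding into `L^p` -/
  emb : E →L[ℝ] Lp ℝ (ENNReal.ofReal p) μ
  exists_ae_tendsto : ∀ (w : ℕ → E) (M : ℝ), (∀ n, ‖w n‖ ≤ M) → ∃ k : ℕ → ℕ, StrictMono k ∧
    ∃ v : α → ℝ, ∀ᵐ x ∂μ, Tendsto (fun n => emb (w (k n)) x) atTop (𝓝 (v x))
  exists_trunc : ∃ D : Set E, Dense D ∧ ∀ u ∈ D, ∃ v,
    (∀ᵐ x ∂μ, emb v x ≤ emb u x + 1 ∧ (emb v x = 0 ∨ emb u x ≤ 0)) ∧ form v v ≤ form u v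

namespace EnergySpace

variable {E : Type*} [NormedAddCommGroup E] [NormedSpace ℝ E] {α : Type*}
    [MeasurableSpace α] {μ : Measure α} {p : ℝ} [Fact (1 < p)]
    (S : EnergySpace E μ p) {γ : ℝ} {f F : ℝ → ℝ}

lemma form_self_le (u : E) : S.form u u ≤ ‖S.form‖ * ‖u‖ ^ 2 := by
  simpa only [sq, mul_assoc] using (le_abs_self _).trans (S.form.le_opNorm₂ u u)

lemma lower_mul_norm_sub_le (u v : E) : S.lower * ‖u - v‖ ≤ ‖S.form u - S.form v‖ := by
  rcases (norm_nonneg (u - v)).eq_or_lt with h | h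
  · rw [← h, mul_zero]
    exact norm_nonneg _
  · refine le_of_mul_le_mul_right ?_ h
    calc S.lower * ‖u - v‖ * ‖u - v‖ = S.lower * ‖u - v‖ ^ 2 := by ring
      _ ≤ S.form (u - v) (u - v) := S.le_form _
      _ ≤ ‖S.form (u - v) (u - v)‖ := le_abs_self _
      _ ≤ ‖S.form (u - v)‖ * ‖u - v‖ := (S.form (u - v)).le_opNorm _
      _ = ‖S.form u - S.form v‖ * ‖u - v‖ := by rw [map_sub]

lemma isClosedEmbedding_form [CompleteSpace E] : IsClosedEmbedding S.form := by
  have h : AntilipschitzWith (Real.toNNReal S.lower⁻¹) S.form :=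
    AntilipschitzWith.of_le_mul_dist fun u v => by
      rw [dist_eq_norm, dist_eq_norm, Real.coe_toNNReal _ (inv_nonneg.2 S.lower_pos.le),
        inv_mul_eq_div, le_div_iff₀ S.lower_pos, mul_comm]
      exact S.lower_mul_norm_sub_le u v
  exact h.isClosedEmbedding S.form.uniformContinuous

lemma emb_smul (t : ℝ) (u : E) : ∀ᵐ x ∂μ, S.emb (t • u) x = t * S.emb u x := by
  rw [map_smul]
  filter_upwards [Lp.coeFn_smul t (S.emb u)] with x hx
  rw [hx, Pi.smul_apply, smul_eq_mul]

lemma emb_add_smul (u v : E) (θ : ℝ) :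
    ∀ᵐ x ∂μ, S.emb (u + θ • v) x = S.emb u x + θ * S.emb v x := by
  rw [map_add]
  filter_upwards [Lp.coeFn_add (S.emb u) (S.emb (θ • v)), S.emb_smul θ v] with x hadd hsmul
  rw [hadd, Pi.add_apply, hsmul]

lemma eLpNorm_emb_le {M : ℝ} {u : E} (hu : ‖u‖ ≤ M) :
    eLpNorm (S.emb u) (ENNReal.ofReal p) μ ≤ ENNReal.ofReal (‖S.emb‖ * M) := by
  rw [← Lp.enorm_def, ← ofReal_norm]
  exact ENNReal.ofReal_le_ofReal ((S.emb.le_opNorm u).trans (by gcongr))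

lemma memLp_of_ae_tendsto {w : ℕ → E} {M : ℝ} (hM : ∀ n, ‖w n‖ ≤ M) {v : α → ℝ}
    (h : ∀ᵐ x ∂μ, Tendsto (fun n => S.emb (w n) x) atTop (𝓝 (v x))) :
    MemLp v (ENNReal.ofReal p) μ :=
  memLp_of_ae_tendsto_of_eLpNorm_le (fun _ => Lp.aestronglyMeasurable _)
    (ENNReal.ofReal_ne_top) (fun n => S.eLpNorm_emb_le (hM n)) h

/-- The pairing of `L^{p'}(μ)` with the energy space. -/
def pair : Lp ℝ (ENNReal.ofReal p.conjExponent) μ →L[ℝ] E →L[ℝ] ℝ :=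
  (ContinuousLinearMap.compL ℝ E (Lp ℝ (ENNReal.ofReal p) μ) ℝ).flip S.emb ∘L
    (ContinuousLinearMap.mul ℝ ℝ).lpPairing μ (ENNReal.ofReal p.conjExponent) (ENNReal.ofReal p)

lemma pair_apply (h : Lp ℝ (ENNReal.ofReal p.conjExponent) μ) (v : E) :
    S.pair h v = ∫ x, h x * S.emb v x ∂μ := by
  simp [pair, ContinuousLinearMap.lpPairing_eq_integral]

lemma pair_toLp_apply {h : α → ℝ} (hh : MemLp h (ENNReal.ofReal p.conjExponent) μ) (v : E) :
    S.pair (hh.toLp h) v = ∫ x, h x * S.emb v x ∂μ := by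
  rw [pair_apply]
  refine integral_congr_ae ?_
  filter_upwards [hh.coeFn_toLp] with x hx
  rw [hx]

variable (F) in
/-- The potential energy `u ↦ ∫ F(u) dμ`. -/
def pot (u : E) : ℝ := ∫ x, F (S.emb u x) ∂μ

lemma pot_zero (hF : F 0 = 0) : S.pot F 0 = 0 := by
  refine integral_eq_zero_of_ae ?_
  rw [map_zero]
  filter_upwards [Lp.coeFn_zero ℝ (ENNReal.ofReal p) μ] with x hx
  rw [hx]
  exact hF

variable [IsFiniteMeasure μ]

/-- The functional `u ↦ ∫ u dμ`. -/
def mass : E →L[ℝ] ℝ := S.pair ((memLp_const (1 : ℝ)).toLp _)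

lemma mass_apply (u : E) : S.mass u = ∫ x, S.emb u x ∂μ := by
  simp only [mass, pair_toLp_apply, one_mul]

lemma integrable_emb (u : E) : Integrable (fun x => S.emb u x) μ :=
  (Lp.memLp (S.emb u)).integrable Fact.out

lemma mass_le_of_le_add_one {u v : E} (h : ∀ᵐ x ∂μ, S.emb v x ≤ S.emb u x + 1) :
    S.mass v ≤ S.mass u + μ.real univ := by
  rw [mass_apply, mass_apply]
  calc ∫ x, S.emb v x ∂μ ≤ ∫ x, (S.emb u x + 1) ∂μ :=
        integral_mono_ae (S.integrable_emb v) ((S.integrable_emb u).add (integrable_const 1)) h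
    _ = _ := by rw [integral_add (S.integrable_emb u) (integrable_const 1)]; simp

/-- The derivative of `u ↦ ∫ F(u) dμ`. -/
def dPot (hf : IsNonlinearity p γ f F) (u : E) : E →L[ℝ] ℝ :=
  S.pair ((hf.memLp_comp (Lp.memLp (S.emb u))).toLp _)

lemma dPot_apply (hf : IsNonlinearity p γ f F) (u v : E) :
    S.dPot hf u v = ∫ x, f (S.emb u x) * S.emb v x ∂μ := by
  rw [dPot, pair_toLp_apply]

lemma integrable_dPot (hf : IsNonlinearity p γ f F) (u v : E) :
    Integrable (fun x => f (S.emb u x) * S.emb v x) μ :=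
  (hf.memLp_comp (Lp.memLp (S.emb u))).integrable_mul (Lp.memLp (S.emb v))

lemma integrable_pot (hf : IsNonlinearity p γ f F) (u : E) :
    Integrable (fun x => F (S.emb u x)) μ :=
  hf.integrable_prim_comp (Lp.memLp (S.emb u))

lemma tendsto_pot (hf : IsNonlinearity p γ f F) {w : ℕ → E} {M : ℝ} (hM : ∀ n, ‖w n‖ ≤ M)
    {v : α → ℝ} (h : ∀ᵐ x ∂μ, Tendsto (fun n => S.emb (w n) x) atTop (𝓝 (v x))) :
    Tendsto (fun n => S.pot F (w n)) atTop (𝓝 (∫ x, F (v x) ∂μ)) :=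
  hf.growth_prim.tendsto_integral_comp hf.cont_prim (by linarith [hf.two_lt]) hf.lt_crit
    (fun _ => Lp.aestronglyMeasurable _) ENNReal.ofReal_ne_top
    (fun n => S.eLpNorm_emb_le (hM n)) h

lemma tendsto_dPot (hf : IsNonlinearity p γ f F) {w : ℕ → E} {M : ℝ} (hM : ∀ n, ‖w n‖ ≤ M)
    {v : α → ℝ} (h : ∀ᵐ x ∂μ, Tendsto (fun n => S.emb (w n) x) atTop (𝓝 (v x)))
    (hv : MemLp v (ENNReal.ofReal p) μ) :
    Tendsto (fun n => S.dPot hf (w n)) atTop (𝓝 (S.pair ((hf.memLp_comp hv).toLp _))) := by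
  refine (S.pair.continuous.tendsto _).comp ?_
  rw [Lp.tendsto_Lp_iff_tendsto_eLpNorm'']
  exact hf.growth.tendsto_eLpNorm_comp_sub hf.cont (by linarith [hf.two_lt])
    (Fact.out : 1 ≤ ENNReal.ofReal p.conjExponent) hf.conjExponent_lt
    (fun n => (Lp.aestronglyMeasurable _)) ENNReal.ofReal_ne_top
    (fun n => S.eLpNorm_emb_le (hM n)) h

lemma continuous_dPot (hf : IsNonlinearity p γ f F) : Continuous (S.dPot hf) := by
  rw [continuous_iff_seqContinuous]
  intro w u hw
  refine tendsto_of_subseq_tendsto fun ns hns => ?_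
  have hw' := hw.comp hns
  obtain ⟨M, hM⟩ := hw'.norm.bddAbove_range
  obtain ⟨ms, -, hms⟩ := (tendstoInMeasure_of_tendsto_Lp
    ((S.emb.continuous.tendsto u).comp hw')).exists_seq_tendsto_ae
  exact ⟨ms, S.tendsto_dPot hf (fun n => hM ⟨ms n, rfl⟩) hms (Lp.memLp _)⟩

lemma hasDerivAt_pot_line (hf : IsNonlinearity p γ f F) (u v : E) (θ : ℝ) :
    HasDerivAt (fun θ : ℝ => S.pot F (u + θ • v)) (S.dPot hf (u + θ • v) v) θ := by
  have hpot : (fun θ : ℝ => S.pot F (u + θ • v))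
      = fun θ => ∫ x, F (S.emb u x + θ * S.emb v x) ∂μ := by
    funext θ
    refine integral_congr_ae ?_
    filter_upwards [S.emb_add_smul u v θ] with x hx
    rw [hx]
  have hdPot : S.dPot hf (u + θ • v) v = ∫ x, f (S.emb u x + θ * S.emb v x) * S.emb v x ∂μ := by
    rw [dPot_apply]
    refine integral_congr_ae ?_
    filter_upwards [S.emb_add_smul u v θ] with x hx
    rw [hx]
  rw [hpot, hdPot]
  exact hf.hasDerivAt_integral_prim_line (Lp.memLp _) (Lp.memLp _) θ

lemma hasFDerivAt_pot (hf : IsNonlinearity p γ f F) (u : E) :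
    HasFDerivAt (S.pot F) (S.dPot hf u) u :=
  hasFDerivAt_of_hasDerivAt_line (fun u v θ => S.hasDerivAt_pot_line hf u v θ)
    (S.continuous_dPot hf) u

variable (F) in
/-- The energy functional `½ B(u,u) - ∫ F(u) dμ + a ∫ u dμ`. -/
def action (a : ℝ) (u : E) : ℝ := S.form u u / 2 - S.pot F u + a * S.mass u

/-- The derivative of the energy functional. -/
def dAction (hf : IsNonlinearity p γ f F) (a : ℝ) (u : E) : E →L[ℝ] ℝ :=
  S.form u - S.dPot hf u + a • S.mass

lemma dAction_apply (hf : IsNonlinearity p γ f F) (a : ℝ) (u v : E) :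
    S.dAction hf a u v = S.form u v - S.dPot hf u v + a * S.mass v := rfl

lemma action_zero (hf : IsNonlinearity p γ f F) (a : ℝ) : S.action F a 0 = 0 := by
  simp [action, S.pot_zero (hf.prim_zero_of_nonpos 0 le_rfl)]

lemma hasFDerivAt_action (hf : IsNonlinearity p γ f F) (a : ℝ) (u : E) :
    HasFDerivAt (S.action F a) (S.dAction hf a u) u := by
  have hform : HasFDerivAt (fun u => S.form u u / 2) (S.form u) u := by
    have h := ((S.form.hasFDerivAt (x := u)).clm_apply (hasFDerivAt_id u)).mul_const (1 / 2 : ℝ)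
    simp only [id_eq, mul_one_div] at h
    refine h.congr_fderiv ?_
    ext v
    simp [S.form_symm v u]
    ring
  exact (hform.sub (S.hasFDerivAt_pot hf u)).add (S.mass.hasFDerivAt.const_mul a)

lemma continuous_dAction (hf : IsNonlinearity p γ f F) (a : ℝ) : Continuous (S.dAction hf a) :=
  (S.form.continuous.sub (S.continuous_dPot hf)).add continuous_const

lemma fderiv_action (hf : IsNonlinearity p γ f F) (a : ℝ) :
    fderiv ℝ (S.action F a) = S.dAction hf a :=
  funext fun u => (S.hasFDerivAt_action hf a u).fderiv

lemma contDiff_action (hf : IsNonlinearity p γ f F) (a : ℝ) : ContDiff ℝ 1 (S.action F a) := by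
  rw [contDiff_one_iff_fderiv, S.fderiv_action hf]
  exact ⟨fun u => (S.hasFDerivAt_action hf a u).differentiableAt, S.continuous_dAction hf a⟩

lemma hasDerivAt_action_ray (hf : IsNonlinearity p γ f F) (a : ℝ) (u : E) (θ : ℝ) :
    HasDerivAt (fun θ : ℝ => S.action F a (θ • u)) (S.dAction hf a (θ • u) u) θ := by
  have hray : HasDerivAt (fun θ : ℝ => θ • u) u θ := by
    simpa using (hasDerivAt_id θ).smul_const u
  exact (S.hasFDerivAt_action hf a _).comp_hasDerivAt θ hray

lemma exists_subseq_tendsto [CompleteSpace E] (hf : IsNonlinearity p γ f F) {a : ℝ} {w : ℕ → E}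
    {M : ℝ} (hM : ∀ n, ‖w n‖ ≤ M)
    (h : Tendsto (fun n => S.dAction hf a (w n)) atTop (𝓝 0)) :
    ∃ v, ∃ k : ℕ → ℕ, StrictMono k ∧ Tendsto (w ∘ k) atTop (𝓝 v) := by
  obtain ⟨k, hk, v, hv⟩ := S.exists_ae_tendsto w M hM
  have hvp := S.memLp_of_ae_tendsto (fun n => hM (k n)) hv
  have hform : Tendsto (fun n => S.form (w (k n))) atTop
      (𝓝 (0 + S.pair ((hf.memLp_comp hvp).toLp _) - a • S.mass)) := by
    refine (((h.comp hk.tendsto_atTop).add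
      (S.tendsto_dPot hf (fun n => hM (k n)) hv hvp)).sub_const (a • S.mass)).congr fun n => ?_
    simp only [dAction, Function.comp_apply]
    abel
  have hemb := S.isClosedEmbedding_form
  obtain ⟨u, hu⟩ := hemb.isClosed_range.mem_of_tendsto hform
    (Eventually.of_forall fun n => ⟨_, rfl⟩)
  refine ⟨u, k, hk, ?_⟩
  rw [hemb.isEmbedding.tendsto_nhds_iff, hu]
  exact hform

lemma lower_mul_norm_le_of_dPot_eq_zero (hf : IsNonlinearity p γ f F) {a : ℝ} (ha : 0 ≤ a)
    {u v : E} (hpot : S.dPot hf u v = 0) (hform : S.form v v ≤ S.form u v) :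
    S.lower * ‖v‖ ≤ ‖S.dAction hf a u‖ + a * ‖S.mass‖ := by
  rcases (norm_nonneg v).eq_or_lt with h0 | h0
  · rw [← h0, mul_zero]
    positivity
  · refine le_of_mul_le_mul_right ?_ h0
    have hmass : -(a * S.mass v) ≤ a * (‖S.mass‖ * ‖v‖) := by
      rw [← mul_neg]
      exact mul_le_mul_of_nonneg_left ((neg_le_abs _).trans (S.mass.le_opNorm v)) ha
    calc S.lower * ‖v‖ * ‖v‖ = S.lower * ‖v‖ ^ 2 := by ring
      _ ≤ S.form u v := (S.le_form v).trans hform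
      _ = S.dAction hf a u v - a * S.mass v := by rw [dAction_apply, hpot]; ring
      _ ≤ ‖S.dAction hf a u‖ * ‖v‖ + a * (‖S.mass‖ * ‖v‖) := by
        linarith [(le_abs_self _).trans ((S.dAction hf a u).le_opNorm v)]
      _ = (‖S.dAction hf a u‖ + a * ‖S.mass‖) * ‖v‖ := by ring

/- Testing `I'(u)` with a truncated negative part `v` of `u` eliminates the nonlinearity, so `v` is
controlled linearly by `‖I'(u)‖`. -/
lemma exists_neg_mass_le (hf : IsNonlinearity p γ f F) : ∃ C ≥ 0, ∀ a ≥ 0, ∀ u,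
    -S.mass u ≤ C * (1 + a + ‖S.dAction hf a u‖) := by
  have hl := S.lower_pos
  set K := ‖S.mass‖
  set C := μ.real univ + K / S.lower * (1 + K)
  have hC : 0 ≤ C := by positivity
  refine ⟨C, hC, fun a ha => ?_⟩
  obtain ⟨D, hD, hDt⟩ := S.exists_trunc
  have hclosed : IsClosed {u | -S.mass u ≤ C * (1 + a + ‖S.dAction hf a u‖)} := by
    have := S.continuous_dAction hf a
    exact isClosed_le (by fun_prop) (by fun_prop)
  suffices h : D ⊆ {u | -S.mass u ≤ C * (1 + a + ‖S.dAction hf a u‖)} from fun u =>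
    hclosed.closure_subset_iff.2 h (hD u)
  intro u hu
  obtain ⟨v, hv, hform⟩ := hDt u hu
  have hpot : S.dPot hf u v = 0 := by
    rw [dPot_apply]
    refine integral_eq_zero_of_ae ?_
    filter_upwards [hv] with x hx
    rcases hx.2 with h | h
    · simp [h]
    · simp [hf.zero_of_nonpos _ h]
  set d := ‖S.dAction hf a u‖
  have hd : 0 ≤ d := norm_nonneg _
  have hnorm : ‖v‖ ≤ (d + a * K) / S.lower := by
    rw [le_div_iff₀' hl]
    exact S.lower_mul_norm_le_of_dPot_eq_zero hf ha hpot hform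
  calc -S.mass u ≤ μ.real univ + K * ‖v‖ := by
        linarith [S.mass_le_of_le_add_one (hv.mono fun x hx => hx.1),
          (neg_le_abs _).trans (S.mass.le_opNorm v)]
    _ ≤ μ.real univ + K * ((d + a * K) / S.lower) := by gcongr
    _ = μ.real univ * 1 + K / S.lower * (d + K * a) := by ring
    _ ≤ μ.real univ * (1 + a + d) + K / S.lower * ((1 + K) * (1 + a + d)) := by
        gcongr
        · linarith
        · nlinarith [norm_nonneg S.mass, mul_nonneg (norm_nonneg S.mass) hd]
    _ = C * (1 + a + d) := by ring

end EnergySpace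

/-! ### Almost critical points are bounded -/

lemma powerGrowth_posPart_sq : PowerGrowth (fun t => (max t 0) ^ 2) 2 :=
  ⟨1, zero_le_one, fun t => by
    simp only [one_mul, abs_of_nonneg (sq_nonneg (max t 0)), Real.rpow_two, sq_abs]
    rcases le_total t 0 with h | h
    · rw [max_eq_right h]; nlinarith [sq_nonneg t]
    · rw [max_eq_left h]; linarith⟩

lemma continuous_posPart_sq : Continuous fun t : ℝ => (max t 0) ^ 2 := by fun_prop

namespace EnergySpace

variable {E : Type*} [NormedAddCommGroup E] [NormedSpace ℝ E] {α : Type*}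
    [MeasurableSpace α] {μ : Measure α} {p : ℝ} [Fact (1 < p)]
    (S : EnergySpace E μ p) {γ : ℝ} {f F : ℝ → ℝ}

lemma integral_posPart_sq_emb_smul {r : ℝ} (hr : 0 ≤ r) (u : E) :
    ∫ x, (max (S.emb (r • u) x) 0) ^ 2 ∂μ = r ^ 2 * ∫ x, (max (S.emb u x) 0) ^ 2 ∂μ := by
  rw [← integral_const_mul]
  refine integral_congr_ae ?_
  filter_upwards [S.emb_smul r u] with x hx
  rw [hx, ← mul_pow, mul_max_of_nonneg _ _ hr, mul_zero]

variable [IsFiniteMeasure μ]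

lemma integrable_posPart_sq_emb (hp : 2 ≤ p) (u : E) :
    Integrable (fun x => (max (S.emb u x) 0) ^ 2) μ :=
  powerGrowth_posPart_sq.integrable_comp continuous_posPart_sq two_pos hp (Lp.memLp _)

lemma abs_mul_mass_le {a A : ℝ} (ha : 0 ≤ a) (haA : a ≤ A) (u : E) :
    |a * S.mass u| ≤ A * ‖S.mass‖ * ‖u‖ := by
  rw [abs_mul, abs_of_nonneg ha, mul_assoc]
  have := S.mass.le_opNorm u
  rw [Real.norm_eq_abs] at this
  gcongr
  exact ha.trans haA

lemma le_action {a A : ℝ} (ha : 0 ≤ a) (haA : a ≤ A) (u : E) :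
    S.lower / 2 * ‖u‖ ^ 2 - S.pot F u - A * ‖S.mass‖ * ‖u‖ ≤ S.action F a u := by
  rw [action]
  linarith [S.le_form u, (abs_le.1 (S.abs_mul_mass_le ha haA u)).1]

lemma action_le {a A : ℝ} (ha : 0 ≤ a) (haA : a ≤ A) (u : E) :
    S.action F a u ≤ ‖S.form‖ / 2 * ‖u‖ ^ 2 - S.pot F u + A * ‖S.mass‖ * ‖u‖ := by
  rw [action]
  linarith [S.form_self_le u, (abs_le.1 (S.abs_mul_mass_le ha haA u)).2]

lemma mul_integral_posPart_sq_le_pot (hf : IsNonlinearity p γ f F) {M C : ℝ} (hC : 0 ≤ C)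
    (hFM : ∀ t ≥ 0, M * t ^ 2 - C ≤ F t) (u : E) :
    M * ∫ x, (max (S.emb u x) 0) ^ 2 ∂μ - C * μ.real univ ≤ S.pot F u := by
  have hint := (S.integrable_posPart_sq_emb (hf.two_lt.trans hf.lt_crit).le u).const_mul M
  calc M * ∫ x, (max (S.emb u x) 0) ^ 2 ∂μ - C * μ.real univ
      = ∫ x, (M * (max (S.emb u x) 0) ^ 2 - C) ∂μ := by
        rw [integral_sub hint (integrable_const C), integral_const_mul, integral_const,
          smul_eq_mul, mul_comm C]
    _ ≤ S.pot F u := by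
        refine integral_mono (hint.sub (integrable_const C)) (S.integrable_pot hf u) fun x => ?_
        rcases le_total (S.emb u x) 0 with h | h
        · simpa [max_eq_right h, hf.prim_zero_of_nonpos _ h] using hC
        · simpa only [max_eq_left h] using hFM _ h

/- Superlinearity: the limit `v` of normalised functions satisfies `M ∫ (v⁺)² ≤ ‖B‖ / 2` for
every `M`. -/
lemma ae_nonpos_of_action_bounded (hf : IsNonlinearity p γ f F) {A Λ : ℝ} {a : ℕ → ℝ}
    (ha0 : ∀ n, 0 ≤ a n) (haA : ∀ n, a n ≤ A) {w : ℕ → E} {r : ℕ → ℝ} (hr : ∀ n, 0 < r n)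
    (hrt : Tendsto r atTop atTop) (hw : ∀ n, ‖w n‖ = 1)
    (hI : ∀ n, -Λ ≤ S.action F (a n) (r n • w n)) {v : α → ℝ}
    (hv : ∀ᵐ x ∂μ, Tendsto (fun n => S.emb (w n) x) atTop (𝓝 (v x))) : ∀ᵐ x ∂μ, v x ≤ 0 := by
  have h2p : 2 < p := hf.two_lt.trans hf.lt_crit
  have hlim : Tendsto (fun n => ∫ x, (max (S.emb (w n) x) 0) ^ 2 ∂μ) atTop
      (𝓝 (∫ x, (max (v x) 0) ^ 2 ∂μ)) :=
    powerGrowth_posPart_sq.tendsto_integral_comp continuous_posPart_sq two_pos h2p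
      (fun _ => Lp.aestronglyMeasurable _) ENNReal.ofReal_ne_top
      (fun n => S.eLpNorm_emb_le (hw n).le) hv
  have hbound (M : ℝ) : M * ∫ x, (max (v x) 0) ^ 2 ∂μ ≤ ‖S.form‖ / 2 := by
    obtain ⟨C, hC, hFM⟩ := hf.superlinear M
    have hrinv := tendsto_inv_atTop_zero.comp hrt
    have hrhs : Tendsto (fun n => ‖S.form‖ / 2 + A * ‖S.mass‖ * (r n)⁻¹
        + (Λ + C * μ.real univ) * ((r n)⁻¹ * (r n)⁻¹)) atTop (𝓝 (‖S.form‖ / 2)) := by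
      simpa using (tendsto_const_nhds.add (hrinv.const_mul (A * ‖S.mass‖))).add
        ((hrinv.mul hrinv).const_mul (Λ + C * μ.real univ))
    refine le_of_tendsto_of_tendsto' (hlim.const_mul M) hrhs fun n => ?_
    have hrn := hr n
    have hpot := S.mul_integral_posPart_sq_le_pot hf hC hFM (r n • w n)
    have haction := (hI n).trans (S.action_le (F := F) (ha0 n) (haA n) (r n • w n))
    rw [S.integral_posPart_sq_emb_smul hrn.le] at hpot
    rw [norm_smul, Real.norm_of_nonneg hrn.le, hw n, mul_one] at haction
    refine le_of_mul_le_mul_left (?_ : r n ^ 2 * _ ≤ r n ^ 2 * _) (by positivity)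
    calc r n ^ 2 * (M * ∫ x, (max (S.emb (w n) x) 0) ^ 2 ∂μ)
        ≤ ‖S.form‖ / 2 * r n ^ 2 + A * ‖S.mass‖ * r n + (Λ + C * μ.real univ) := by linarith
      _ = _ := by field_simp
  have hzero : ∫ x, (max (v x) 0) ^ 2 ∂μ = 0 := by
    refine le_antisymm ?_ (integral_nonneg fun x => sq_nonneg _)
    by_contra! hpos
    have := hbound ((‖S.form‖ / 2 + 1) / ∫ x, (max (v x) 0) ^ 2 ∂μ)
    rw [div_mul_cancel₀ _ hpos.ne'] at this
    linarith
  rw [integral_eq_zero_iff_of_nonneg (fun x => sq_nonneg _) (powerGrowth_posPart_sq.integrable_comp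
    continuous_posPart_sq two_pos h2p.le (S.memLp_of_ae_tendsto (fun n => (hw n).le) hv))] at hzero
  filter_upwards [hzero] with x hx
  exact max_eq_right_iff.1 (pow_eq_zero_iff two_ne_zero |>.1 hx)

lemma tendsto_pot_smul_of_ae_nonpos (hf : IsNonlinearity p γ f F) {w : ℕ → E}
    (hw : ∀ n, ‖w n‖ = 1) {v : α → ℝ}
    (hv : ∀ᵐ x ∂μ, Tendsto (fun n => S.emb (w n) x) atTop (𝓝 (v x))) (hv0 : ∀ᵐ x ∂μ, v x ≤ 0)
    {T : ℝ} (hT : 0 ≤ T) : Tendsto (fun n => S.pot F (T • w n)) atTop (𝓝 0) := by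
  have hlim : ∀ᵐ x ∂μ, Tendsto (fun n => S.emb (T • w n) x) atTop (𝓝 (T * v x)) := by
    filter_upwards [hv, ae_all_iff.2 fun n => S.emb_smul T (w n)] with x hx hx'
    simpa only [hx'] using hx.const_mul T
  have hzero : ∫ x, F (T * v x) ∂μ = 0 := by
    refine integral_eq_zero_of_ae ?_
    filter_upwards [hv0] with x hx
    exact hf.prim_zero_of_nonpos _ (mul_nonpos_of_nonneg_of_nonpos hT hx)
  rw [← hzero]
  refine S.tendsto_pot hf (M := T) (fun n => ?_) hlim
  rw [norm_smul, Real.norm_of_nonneg hT, hw n, mul_one]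

lemma integrable_defect (hf : IsNonlinearity p γ f F) (u : E) :
    Integrable (fun x => S.emb u x * f (S.emb u x) - 2 * F (S.emb u x)) μ := by
  refine Integrable.sub ?_ ((S.integrable_pot hf u).const_mul 2)
  simpa only [mul_comm] using S.integrable_dPot hf u u

lemma two_mul_action_sub_dAction (hf : IsNonlinearity p γ f F) (a : ℝ) (u : E) :
    2 * S.action F a u - S.dAction hf a u u
      = ∫ x, (S.emb u x * f (S.emb u x) - 2 * F (S.emb u x)) ∂μ + a * S.mass u := by
  have hint : Integrable (fun x => S.emb u x * f (S.emb u x)) μ := by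
    simpa only [mul_comm] using S.integrable_dPot hf u u
  rw [integral_sub hint ((S.integrable_pot hf u).const_mul 2), integral_const_mul, dAction_apply,
    dPot_apply, action, pot]
  simp only [mul_comm (S.emb u _)]
  ring

/- Jeanjean's monotonicity argument: quasi-monotonicity of `t f(t) - 2 F(t)` compares the energy at
a critical point of the ray through `u` with the energy at `u`. -/
lemma action_smul_le (hf : IsNonlinearity p γ f F) {C : ℝ}
    (hC : ∀ t θ, 0 ≤ θ → θ ≤ 1 →
      θ * t * f (θ * t) - 2 * F (θ * t) ≤ t * f t - 2 * F t + C) (a : ℝ) (u : E) {θ : ℝ}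
    (h0 : 0 ≤ θ) (h1 : θ ≤ 1) (hcrit : S.dAction hf a (θ • u) (θ • u) = 0) :
    2 * S.action F a (θ • u) ≤ 2 * S.action F a u - S.dAction hf a u u + C * μ.real univ
      + a * ((1 - θ) * -S.mass u) := by
  have hθ := S.two_mul_action_sub_dAction hf a (θ • u)
  have hu := S.two_mul_action_sub_dAction hf a u
  rw [hcrit, sub_zero, S.mass.map_smul, smul_eq_mul] at hθ
  have hdefect : ∫ x, (S.emb (θ • u) x * f (S.emb (θ • u) x) - 2 * F (S.emb (θ • u) x)) ∂μ
      ≤ ∫ x, (S.emb u x * f (S.emb u x) - 2 * F (S.emb u x) + C) ∂μ := by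
    refine integral_mono_ae (S.integrable_defect hf _)
      ((S.integrable_defect hf u).add (integrable_const C)) ?_
    filter_upwards [S.emb_smul θ u] with x hx
    rw [hx]
    exact hC _ θ h0 h1
  rw [integral_add (S.integrable_defect hf u) (integrable_const C), integral_const, smul_eq_mul,
    mul_comm _ C] at hdefect
  rw [hθ, hu]
  linarith

lemma exists_critical_on_ray (hf : IsNonlinearity p γ f F) {a : ℝ} {u : E} {t : ℝ}
    (ht : t ∈ Icc (0 : ℝ) 1) (h0 : 0 < S.action F a (t • u))
    (h1 : S.action F a u < S.action F a (t • u)) :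
    ∃ θ ∈ Icc (0 : ℝ) 1, S.action F a (t • u) ≤ S.action F a (θ • u) ∧
      S.dAction hf a (θ • u) (θ • u) = 0 := by
  have hderiv := S.hasDerivAt_action_ray hf a u
  obtain ⟨θ, hθ, hmax⟩ := (isCompact_Icc (a := (0 : ℝ)) (b := 1)).exists_isMaxOn
    ⟨0, by simp⟩ (f := fun θ : ℝ => S.action F a (θ • u))
    (fun θ _ => (hderiv θ).continuousAt.continuousWithinAt)
  have hle : S.action F a (t • u) ≤ S.action F a (θ • u) := hmax ht
  have hθ0 : θ ≠ 0 := by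
    rintro rfl
    rw [zero_smul, S.action_zero hf] at hle
    linarith
  have hθ1 : θ ≠ 1 := by
    rintro rfl
    rw [one_smul] at hle
    linarith
  have hloc : IsLocalMax (fun θ : ℝ => S.action F a (θ • u)) θ :=
    hmax.isLocalMax (Icc_mem_nhds (hθ.1.lt_of_ne' hθ0) (hθ.2.lt_of_ne hθ1))
  refine ⟨θ, hθ, hle, ?_⟩
  rw [map_smul, hloc.hasDerivAt_eq_zero (hderiv θ), smul_zero]

lemma exists_action_smul_le (hf : IsNonlinearity p γ f F) (A Λ : ℝ) :
    ∃ B, ∀ a ≥ 0, a ≤ A → ∀ u, |S.action F a u| ≤ Λ → 1 ≤ ‖u‖ →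
      ‖S.dAction hf a u‖ * ‖u‖ ≤ Λ → ∀ t ∈ Icc (0 : ℝ) 1, S.action F a (t • u) ≤ B := by
  obtain ⟨Cn, hCn, hneg⟩ := S.exists_neg_mass_le hf
  obtain ⟨Cq, hCq, hquasi⟩ := hf.quasi_mono
  refine ⟨2 * Λ + Λ + Cq * μ.real univ + A * (Cn * (1 + A + Λ)),
    fun a ha haA u hI hu hI' t ht => ?_⟩
  have hΛ : 0 ≤ Λ := (abs_nonneg _).trans hI
  have hA : 0 ≤ A := ha.trans haA
  have hCqμ : 0 ≤ Cq * μ.real univ := by positivity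
  have hX : 0 ≤ Cn * (1 + A + Λ) := by positivity
  have hAX : 0 ≤ A * (Cn * (1 + A + Λ)) := by positivity
  by_contra! hlarge
  obtain ⟨θ, hθ, hle, hcrit⟩ := S.exists_critical_on_ray hf ht (by linarith)
    (by linarith [le_of_abs_le hI])
  have hd : ‖S.dAction hf a u‖ ≤ Λ := (le_mul_of_one_le_right (norm_nonneg _) hu).trans hI'
  have hself : -(S.dAction hf a u u) ≤ Λ :=
    (neg_le_abs _).trans (((S.dAction hf a u).le_opNorm _).trans hI')
  have hmass : -S.mass u ≤ Cn * (1 + A + Λ) := (hneg a ha u).trans (by gcongr)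
  have hdrift : a * ((1 - θ) * -S.mass u) ≤ A * (Cn * (1 + A + Λ)) :=
    calc a * ((1 - θ) * -S.mass u) ≤ a * ((1 - θ) * (Cn * (1 + A + Λ))) := by
          have := sub_nonneg.2 hθ.2
          gcongr
      _ ≤ A * (Cn * (1 + A + Λ)) :=
          mul_le_mul haA (mul_le_of_le_one_left hX (by linarith [hθ.1]))
            (mul_nonneg (sub_nonneg.2 hθ.2) hX) hA
  linarith [S.action_smul_le hf hquasi a u hθ.1 hθ.2 hcrit, le_of_abs_le hI]

/- Otherwise normalise a divergent sequence: the limit direction is nonpositive, so along the rays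
the energy reaches arbitrarily high values, against `exists_action_smul_le`. -/
theorem exists_norm_bound (hf : IsNonlinearity p γ f F) (A Λ : ℝ) : ∃ ρ > 0, ∀ a ≥ 0, a ≤ A → ∀ u,
    |S.action F a u| ≤ Λ → ‖S.dAction hf a u‖ * ‖u‖ ≤ Λ → ‖u‖ ≤ ρ := by
  by_contra! hcon
  choose a ha0 haA u hI hI' hu using fun n : ℕ => hcon ((n : ℝ) + 1) (by positivity)
  obtain ⟨B, hB⟩ := S.exists_action_smul_le hf A Λ
  have hr1 (n) : 1 ≤ ‖u n‖ := (le_add_of_nonneg_left n.cast_nonneg).trans (hu n).le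
  have hr0 (n) : 0 < ‖u n‖ := zero_lt_one.trans_le (hr1 n)
  have hrt : Tendsto (fun n => ‖u n‖) atTop atTop :=
    tendsto_atTop_mono (fun n => (hu n).le)
      (tendsto_atTop_add_const_right _ 1 tendsto_natCast_atTop_atTop)
  set w : ℕ → E := fun n => ‖u n‖⁻¹ • u n with hwdef
  have hw (n) : ‖w n‖ = 1 := by
    rw [hwdef, norm_smul, norm_inv, norm_norm, inv_mul_cancel₀ (hr0 n).ne']
  have huw (n) : ‖u n‖ • w n = u n := by rw [hwdef, smul_inv_smul₀ (hr0 n).ne']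
  obtain ⟨k, hk, v, hv⟩ := S.exists_ae_tendsto w 1 fun n => (hw n).le
  have hrk : Tendsto (fun n => ‖u (k n)‖) atTop atTop := hrt.comp hk.tendsto_atTop
  have hv0 : ∀ᵐ x ∂μ, v x ≤ 0 := S.ae_nonpos_of_action_bounded hf (Λ := Λ) (a := a ∘ k)
    (w := w ∘ k) (fun n => ha0 _) (fun n => haA _) (fun n => hr0 (k n)) hrk (fun n => hw _)
    (fun n => by simpa only [Function.comp_apply, huw] using (abs_le.1 (hI (k n))).1) hv
  have hquad : Tendsto (fun T : ℝ => (S.lower / 2 * T - A * ‖S.mass‖) * T) atTop atTop :=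
    (tendsto_atTop_add_const_right _ _
      (tendsto_id.const_mul_atTop (half_pos S.lower_pos))).atTop_mul_atTop₀ tendsto_id
  obtain ⟨T, hT0, hTB⟩ := ((eventually_ge_atTop 0).and (hquad.eventually_gt_atTop (B + 1))).exists
  have hpot := S.tendsto_pot_smul_of_ae_nonpos hf (fun n => hw (k n)) hv hv0 hT0
  obtain ⟨n, hpotn, hTn⟩ :=
    ((hpot.eventually_lt_const one_pos).and (hrk.eventually_ge_atTop T)).exists
  have hlow := S.le_action (F := F) (ha0 (k n)) (haA (k n)) (T • w (k n))
  have hupp := hB _ (ha0 (k n)) (haA (k n)) _ (hI (k n)) (hr1 _) (hI' (k n)) (T / ‖u (k n)‖)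
    ⟨by positivity, (div_le_one (hr0 _)).2 hTn⟩
  rw [norm_smul, Real.norm_of_nonneg hT0, hw, mul_one] at hlow
  rw [div_eq_mul_inv, mul_smul] at hupp
  linarith

lemma exists_critical_of_cerami [CompleteSpace E] (hf : IsNonlinearity p γ f F) {a : ℝ}
    (ha : 0 ≤ a) {c : ℝ} (h : ∀ ε > 0, ∃ u, |S.action F a u - c| ≤ ε ∧
      ‖S.dAction hf a u‖ * (1 + ‖u‖) < ε) :
    ∃ u, S.action F a u = c ∧ S.dAction hf a u = 0 := by
  choose u hu hu' using fun n : ℕ => h (1 / ((n : ℝ) + 1)) (by positivity)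
  have hle (n : ℕ) : 1 / ((n : ℝ) + 1) ≤ 1 :=
    (div_le_one (by positivity)).2 (le_add_of_nonneg_left n.cast_nonneg)
  obtain ⟨ρ, -, hρ⟩ := S.exists_norm_bound hf a (|c| + 1)
  have hbd (n) : ‖u n‖ ≤ ρ := by
    refine hρ a ha le_rfl _ ?_ ?_
    · linarith [(hu n).trans (hle n), abs_sub_abs_le_abs_sub (S.action F a (u n)) c]
    · linarith [(hu' n).trans_le (hle n), norm_nonneg (S.dAction hf a (u n)), abs_nonneg c]
  have hlim := tendsto_one_div_add_atTop_nhds_zero_nat (𝕜 := ℝ)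
  have hd : Tendsto (fun n => S.dAction hf a (u n)) atTop (𝓝 0) :=
    squeeze_zero_norm (fun n => (le_mul_of_one_le_right (norm_nonneg _)
      (le_add_of_nonneg_right (norm_nonneg _))).trans (hu' n).le) hlim
  have hI : Tendsto (fun n => S.action F a (u n)) atTop (𝓝 c) :=
    tendsto_iff_dist_tendsto_zero.2 (squeeze_zero (fun n => dist_nonneg) hu hlim)
  obtain ⟨v, k, hk, hv⟩ := S.exists_subseq_tendsto hf hbd hd
  exact ⟨v, tendsto_nhds_unique (((S.contDiff_action hf a).continuous.tendsto v).comp hv)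
      (hI.comp hk.tendsto_atTop),
    tendsto_nhds_unique (((S.continuous_dAction hf a).tendsto v).comp hv)
      (hd.comp hk.tendsto_atTop)⟩

theorem exists_critical_of_mountainPass [CompleteSpace E] (hf : IsNonlinearity p γ f F) {a : ℝ}
    (ha : 0 ≤ a) {e : E} {c : ℝ}
    (hc : IsGLB (range fun q : Path (0 : E) e => ⨆ t, S.action F a (q t)) c) (hc0 : 0 < c)
    (he : S.action F a e < c) : ∃ u, S.action F a u = c ∧ S.dAction hf a u = 0 :=
  S.exists_critical_of_cerami hf ha fun _ hε =>
    exists_almost_critical_of_mountainPass (S.hasFDerivAt_action hf a) (S.continuous_dAction hf a)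
      hc (by rwa [S.action_zero hf]) he hε

end EnergySpace

/-! ### Averages over balls and the fractional Sobolev inequality -/

section SetAverage

variable {α : Type*} [MeasurableSpace α] {μ : Measure α} {B : Set α} {h : α → ℝ}

lemma enorm_setAverage_le (hB0 : μ B ≠ 0) (hB : μ B ≠ ⊤) {q : ENNReal} (hq : 1 ≤ q)
    (hh : AEStronglyMeasurable h (μ.restrict B)) :
    ‖⨍ y in B, h y ∂μ‖ₑ ≤ eLpNorm h q (μ.restrict B) * μ B ^ (-(1 / q.toReal)) := by
  have havg : ‖⨍ y in B, h y ∂μ‖ₑ ≤ (μ B)⁻¹ * eLpNorm h 1 (μ.restrict B) := by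
    rw [setAverage_eq, enorm_smul, eLpNorm_one_eq_lintegral_enorm]
    gcongr
    · rw [measureReal_def, ← ENNReal.toReal_inv, ← ofReal_norm, Real.norm_of_nonneg (by positivity),
        ENNReal.ofReal_toReal (ENNReal.inv_ne_top.2 hB0)]
    · exact enorm_integral_le_lintegral_enorm _
  have hholder := eLpNorm_le_eLpNorm_mul_rpow_measure_univ (μ := μ.restrict B) hq hh
  rw [Measure.restrict_apply_univ, ENNReal.toReal_one, div_one] at hholder
  calc ‖⨍ y in B, h y ∂μ‖ₑ
      ≤ (μ B)⁻¹ * (eLpNorm h q (μ.restrict B) * μ B ^ (1 - 1 / q.toReal)) :=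
        havg.trans (by gcongr)
    _ = eLpNorm h q (μ.restrict B) * (μ B ^ (-1 : ℝ) * μ B ^ (1 - 1 / q.toReal)) := by
        rw [ENNReal.rpow_neg_one]
        ring
    _ = eLpNorm h q (μ.restrict B) * μ B ^ (-(1 / q.toReal)) := by
        rw [← ENNReal.rpow_add _ _ hB0 hB]
        ring_nf

lemma sub_setAverage_eq (hB0 : μ B ≠ 0) (hB : μ B ≠ ⊤) (hh : IntegrableOn h B μ) (c : ℝ) :
    c - ⨍ y in B, h y ∂μ = ⨍ y in B, (c - h y) ∂μ := by
  have : IsFiniteMeasure (μ.restrict B) := isFiniteMeasure_restrict.2 hB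
  rw [setAverage_eq, setAverage_eq, integral_sub (integrable_const c) hh, smul_sub,
    setIntegral_const, smul_smul, inv_mul_cancel₀ ((measureReal_ne_zero_iff hB).2 hB0), one_smul]

end SetAverage

section Sobolev

variable {N : ℕ} {s : ℝ}

local notation "V" => EuclideanSpace ℝ (Fin N)

/-- The density `x ↦ ∫ (u(x) - u(y))² / |x - y|^(N + 2s) dy` of the Gagliardo energy. -/
def localEnergy (N : ℕ) (s : ℝ) (u : EuclideanSpace ℝ (Fin N) → ℝ)
    (x : EuclideanSpace ℝ (Fin N)) : ENNReal :=
  ∫⁻ y, ‖diffQuot N s u (x, y)‖ₑ ^ (2 : ℝ)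

lemma lintegral_localEnergy {u : V → ℝ} (hu : AEStronglyMeasurable u volume) :
    ∫⁻ x, localEnergy N s u x = eLpNorm (diffQuot N s u) 2 volume ^ (2 : ℝ) := by
  have hm := (aestronglyMeasurable_diffQuot N s hu).enorm.pow_const (2 : ℝ)
  rw [eLpNorm_eq_lintegral_rpow_enorm_toReal (by norm_num) (by norm_num), ← ENNReal.rpow_mul,
    ENNReal.toReal_ofNat, one_div, inv_mul_cancel₀ (two_ne_zero' ℝ), ENNReal.rpow_one]
  rw [Measure.volume_eq_prod] at hm ⊢
  exact (lintegral_prod _ hm).symm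

lemma aemeasurable_localEnergy {u : V → ℝ} (hu : AEStronglyMeasurable u volume) :
    AEMeasurable (localEnergy N s u) volume := by
  have hm := (aestronglyMeasurable_diffQuot N s hu).enorm.pow_const (2 : ℝ)
  rw [Measure.volume_eq_prod] at hm
  exact hm.lintegral_prod_right'

variable (N) in
/-- The volume of the unit ball of `ℝ^N`. -/
def unitBallVolume : ℝ := volume.real (Metric.ball (0 : V) 1)

variable (N) in
lemma unitBallVolume_pos : 0 < unitBallVolume N :=
  ENNReal.toReal_pos (Metric.measure_ball_pos volume _ one_pos).ne' measure_ball_lt_top.ne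

lemma volume_ball_eq (x : V) {r : ℝ} (hr : 0 < r) :
    volume (Metric.ball x r) = ENNReal.ofReal (unitBallVolume N * r ^ (N : ℝ)) := by
  rw [Measure.addHaar_ball_of_pos volume x hr, finrank_euclideanSpace, Fintype.card_fin,
    Real.rpow_natCast, mul_comm, ENNReal.ofReal_mul (unitBallVolume_pos N).le, unitBallVolume,
    ofReal_measureReal measure_ball_lt_top.ne]

lemma volume_ball_rpow (x : V) {r : ℝ} (hr : 0 < r) (e : ℝ) :
    volume (Metric.ball x r) ^ e = ENNReal.ofReal (unitBallVolume N ^ e * r ^ (N * e)) := by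
  have := unitBallVolume_pos N
  rw [volume_ball_eq x hr, ENNReal.ofReal_rpow_of_pos (by positivity),
    Real.mul_rpow (by positivity) (by positivity), ← Real.rpow_mul hr.le]

lemma enorm_sub_le_diffQuot (hs : 0 ≤ s) (u : V → ℝ) {x y : V} {r : ℝ} (hxy : ‖x - y‖ ≤ r) :
    ‖u x - u y‖ₑ
      ≤ ENNReal.ofReal (r ^ (((N : ℝ) + 2 * s) / 2)) * ‖diffQuot N s u (x, y)‖ₑ := by
  have hr : 0 ≤ r := (norm_nonneg _).trans hxy
  rw [← ofReal_norm, ← ofReal_norm, ← ENNReal.ofReal_mul (by positivity), Real.norm_eq_abs,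
    Real.norm_eq_abs, diffQuot, abs_div]
  refine ENNReal.ofReal_le_ofReal ?_
  rcases eq_or_ne x y with rfl | hne
  · simp
  · have hpow : 0 < ‖x - y‖ ^ (((N : ℝ) + 2 * s) / 2) :=
      Real.rpow_pos_of_pos (norm_pos_iff.2 (sub_ne_zero.2 hne)) _
    rw [abs_of_pos hpow, mul_div_assoc', le_div_iff₀ hpow, mul_comm]
    gcongr

lemma eLpNorm_sub_restrict_ball_le (hs : 0 ≤ s) (u : V → ℝ) (x : V) {r : ℝ} :
    eLpNorm (fun y => u x - u y) 2 (volume.restrict (Metric.ball x r)) ≤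
      ENNReal.ofReal (r ^ (((N : ℝ) + 2 * s) / 2)) * localEnergy N s u x ^ (1 / 2 : ℝ) := by
  set k := ENNReal.ofReal (r ^ (((N : ℝ) + 2 * s) / 2))
  rw [eLpNorm_eq_lintegral_rpow_enorm_toReal (by norm_num) (by norm_num), ENNReal.toReal_ofNat]
  calc (∫⁻ y in Metric.ball x r, ‖u x - u y‖ₑ ^ (2 : ℝ)) ^ (1 / 2 : ℝ)
      ≤ (∫⁻ y in Metric.ball x r, k ^ (2 : ℝ) * ‖diffQuot N s u (x, y)‖ₑ ^ (2 : ℝ))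
          ^ (1 / 2 : ℝ) := by
        refine ENNReal.rpow_le_rpow (setLIntegral_mono' Metric.isOpen_ball.measurableSet
          fun y hy => ?_) (by norm_num)
        rw [← ENNReal.mul_rpow_of_nonneg _ _ (by norm_num)]
        refine ENNReal.rpow_le_rpow (enorm_sub_le_diffQuot hs u ?_) (by norm_num)
        rw [← dist_eq_norm, dist_comm]
        exact (Metric.mem_ball.1 hy).le
    _ = (k ^ (2 : ℝ) * ∫⁻ y in Metric.ball x r, ‖diffQuot N s u (x, y)‖ₑ ^ (2 : ℝ))
          ^ (1 / 2 : ℝ) := by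
        rw [lintegral_const_mul' _ _ (by finiteness)]
    _ ≤ (k ^ (2 : ℝ) * localEnergy N s u x) ^ (1 / 2 : ℝ) := by
        gcongr
        exact setLIntegral_le_lintegral _ _
    _ = k * localEnergy N s u x ^ (1 / 2 : ℝ) := by
        rw [ENNReal.mul_rpow_of_nonneg _ _ (by norm_num), ← ENNReal.rpow_mul,
          mul_one_div_cancel (by norm_num), ENNReal.rpow_one]

lemma enorm_sub_average_le (hs : 0 ≤ s) {u : V → ℝ} (hu : LocallyIntegrable u volume) (x : V)
    {r : ℝ} (hr : 0 < r) :
    ‖u x - ⨍ y in Metric.ball x r, u y‖ₑ ≤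
      ENNReal.ofReal (unitBallVolume N ^ (-(1 / 2) : ℝ) * r ^ s)
        * localEnergy N s u x ^ (1 / 2 : ℝ) := by
  have hB0 : volume (Metric.ball x r) ≠ 0 := (Metric.measure_ball_pos volume x hr).ne'
  have hB : volume (Metric.ball x r) ≠ ⊤ := measure_ball_lt_top.ne
  have hint : IntegrableOn u (Metric.ball x r) :=
    (hu.integrableOn_isCompact (isCompact_closedBall x r)).mono_set Metric.ball_subset_closedBall
  rw [sub_setAverage_eq hB0 hB hint]
  calc ‖⨍ y in Metric.ball x r, (u x - u y)‖ₑ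
      ≤ eLpNorm (fun y => u x - u y) 2 (volume.restrict (Metric.ball x r))
          * volume (Metric.ball x r) ^ (-(1 / (2 : ENNReal).toReal)) :=
        enorm_setAverage_le hB0 hB (by norm_num) (aestronglyMeasurable_const.sub hint.1)
    _ ≤ (ENNReal.ofReal (r ^ (((N : ℝ) + 2 * s) / 2)) * localEnergy N s u x ^ (1 / 2 : ℝ))
          * volume (Metric.ball x r) ^ (-(1 / (2 : ENNReal).toReal)) := by
        gcongr
        exact eLpNorm_sub_restrict_ball_le hs u x
    _ = _ := by
        rw [volume_ball_rpow x hr, mul_right_comm, ← ENNReal.ofReal_mul (by positivity),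
          ENNReal.toReal_ofNat, mul_comm (r ^ _), mul_assoc (_ ^ _), ← Real.rpow_add hr]
        ring_nf

lemma abs_average_le {p : ℝ} (hp : 1 ≤ p) {u : V → ℝ} (hu : MemLp u (ENNReal.ofReal p) volume)
    (x : V) {r : ℝ} (hr : 0 < r) :
    |⨍ y in Metric.ball x r, u y| ≤ unitBallVolume N ^ (-(1 / p)) * r ^ (-(N / p))
      * (eLpNorm u (ENNReal.ofReal p) volume).toReal := by
  have hω := unitBallVolume_pos N
  rw [← ENNReal.ofReal_le_ofReal_iff (by positivity), ← Real.norm_eq_abs, ofReal_norm]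
  refine (enorm_setAverage_le (Metric.measure_ball_pos volume x hr).ne' measure_ball_lt_top.ne
    (ENNReal.one_le_ofReal.2 hp) hu.1.restrict).trans ?_
  rw [volume_ball_rpow x hr, ENNReal.toReal_ofReal (by linarith), mul_comm,
    ENNReal.ofReal_mul (q := ENNReal.toReal _) (by positivity), ENNReal.ofReal_toReal hu.2.ne,
    show (N : ℝ) * -(1 / p) = -(N / p) by ring]
  gcongr
  exact Measure.restrict_le_self

/- The two terms balance at the radius `r = (U / D) ^ (2 / n)`; replacing `D` by `d ↓ D` covers
`D = 0`. -/
lemma le_rpow_mul_rpow_of_forall_radius {A D U c₁ c₂ n s : ℝ} (hn : 0 < n) (hsn : 2 * s < n)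
    (hc₁ : 0 ≤ c₁) (hD : 0 ≤ D) (hU : 0 < U)
    (h : ∀ r > 0, A ≤ c₁ * r ^ s * D + c₂ * r ^ (-((n - 2 * s) / 2)) * U) :
    A ≤ (c₁ + c₂) * (U ^ (2 * s / n) * D ^ (1 - 2 * s / n)) := by
  have hlt : ∀ d > D, A ≤ (c₁ + c₂) * (U ^ (2 * s / n) * d ^ (1 - 2 * s / n)) := by
    intro d hd
    have hd0 : 0 < d := hD.trans_lt hd
    have hq : 0 < U / d := by positivity
    have hA := h ((U / d) ^ (2 / n)) (by positivity)
    rw [← Real.rpow_mul hq.le, ← Real.rpow_mul hq.le] at hA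
    have hfst : (U / d) ^ (2 / n * s) * d = U ^ (2 * s / n) * d ^ (1 - 2 * s / n) := by
      rw [show 2 / n * s = 2 * s / n by ring, Real.div_rpow hU.le hd0.le, Real.rpow_sub hd0,
        Real.rpow_one]
      ring
    have hsnd : (U / d) ^ (2 / n * -((n - 2 * s) / 2)) * U
        = U ^ (2 * s / n) * d ^ (1 - 2 * s / n) := by
      rw [show 2 / n * -((n - 2 * s) / 2) = -(1 - 2 * s / n) by field_simp, Real.rpow_neg hq.le,
        Real.div_rpow hU.le hd0.le, inv_div, div_mul_eq_mul_div, mul_div_assoc, mul_comm]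
      congr 1
      rw [div_eq_iff (by positivity), ← Real.rpow_add hU, add_sub_cancel, Real.rpow_one]
    calc A ≤ c₁ * (U / d) ^ (2 / n * s) * D
            + c₂ * (U / d) ^ (2 / n * -((n - 2 * s) / 2)) * U := hA
      _ ≤ c₁ * (U / d) ^ (2 / n * s) * d
            + c₂ * (U / d) ^ (2 / n * -((n - 2 * s) / 2)) * U := by gcongr
      _ = _ := by rw [mul_assoc, hfst, mul_assoc, hsnd]; ring
  have hexp : 0 ≤ 1 - 2 * s / n := by
    rw [sub_nonneg, div_le_one hn]
    exact hsn.le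
  have hcont : Continuous fun d : ℝ => (c₁ + c₂) * (U ^ (2 * s / n) * d ^ (1 - 2 * s / n)) :=
    continuous_const.mul (continuous_const.mul (continuous_id.rpow_const fun _ => Or.inr hexp))
  exact ge_of_tendsto ((hcont.tendsto D).mono_left nhdsWithin_le_nhds : Tendsto _ (𝓝[>] D) _)
    (eventually_mem_nhdsWithin.mono hlt)

lemma critExp_gt_two (hs : 0 < s) (hN : 2 * s < N) : 2 < critExp N s := by
  rw [critExp, lt_div_iff₀ (by linarith)]
  linarith

lemma natCast_div_critExp (hs : 0 ≤ s) (hN : 2 * s < N) :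
    N / critExp N s = ((N : ℝ) - 2 * s) / 2 := by
  have hN0 : (N : ℝ) ≠ 0 := by linarith
  have hNs : (N : ℝ) - 2 * s ≠ 0 := by linarith
  rw [critExp]
  field_simp

lemma one_sub_mul_critExp (hs : 0 ≤ s) (hN : 2 * s < N) :
    (1 - 2 * s / N) * critExp N s = 2 := by
  have hN0 : (N : ℝ) ≠ 0 := by linarith
  have hNs : (N : ℝ) - 2 * s ≠ 0 := by linarith
  rw [critExp]
  field_simp

/-- The constant `c` of the pointwise estimate
`|u(x)| ≤ c ‖u‖_{L^{2^*_s}}^(2s/N) localEnergy(x)^((1 - 2s/N)/2)`. -/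
def pointwiseConst (N : ℕ) (s : ℝ) : ℝ :=
  unitBallVolume N ^ (-(1 / 2) : ℝ) + unitBallVolume N ^ (-(1 / critExp N s))

lemma pointwiseConst_pos (N : ℕ) (s : ℝ) : 0 < pointwiseConst N s := by
  have := unitBallVolume_pos N
  rw [pointwiseConst]
  positivity

lemma abs_le_pointwiseConst_mul (hs : 0 < s) (hN : 2 * s < N) {u : V → ℝ}
    (hu : MemLp u (ENNReal.ofReal (critExp N s)) volume)
    (hu0 : 0 < (eLpNorm u (ENNReal.ofReal (critExp N s)) volume).toReal) {x : V}
    (hx : localEnergy N s u x < ⊤) :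
    |u x| ≤ pointwiseConst N s
      * ((eLpNorm u (ENNReal.ofReal (critExp N s)) volume).toReal ^ (2 * s / N)
        * √(localEnergy N s u x).toReal ^ (1 - 2 * s / N)) := by
  have hω := unitBallVolume_pos N
  have hp1 : 1 ≤ critExp N s := by linarith [critExp_gt_two hs hN]
  refine le_rpow_mul_rpow_of_forall_radius (by linarith) hN (by positivity) (Real.sqrt_nonneg _)
    hu0 fun r hr => ?_
  have hdiff : |u x - ⨍ y in Metric.ball x r, u y| ≤
      unitBallVolume N ^ (-(1 / 2) : ℝ) * r ^ s * √(localEnergy N s u x).toReal := by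
    have henergy : localEnergy N s u x ^ (1 / 2 : ℝ)
        = ENNReal.ofReal √(localEnergy N s u x).toReal := by
      rw [Real.sqrt_eq_rpow, ← ENNReal.ofReal_rpow_of_nonneg (by positivity) (by norm_num),
        ENNReal.ofReal_toReal hx.ne]
    rw [← ENNReal.ofReal_le_ofReal_iff (by positivity), ← Real.norm_eq_abs, ofReal_norm,
      ENNReal.ofReal_mul (by positivity), ← henergy]
    exact enorm_sub_average_le hs.le (hu.locallyIntegrable (ENNReal.one_le_ofReal.2 hp1)) x hr
  have havg := abs_average_le hp1 hu x hr
  rw [natCast_div_critExp hs.le hN] at havg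
  calc |u x| = |(u x - ⨍ y in Metric.ball x r, u y) + ⨍ y in Metric.ball x r, u y| := by
        rw [sub_add_cancel]
    _ ≤ _ := (abs_add_le _ _).trans (add_le_add hdiff havg)

lemma enorm_rpow_critExp_le (hs : 0 < s) (hN : 2 * s < N) {u : V → ℝ}
    (hu : MemLp u (ENNReal.ofReal (critExp N s)) volume)
    (hu0 : 0 < (eLpNorm u (ENNReal.ofReal (critExp N s)) volume).toReal) {x : V}
    (hx : localEnergy N s u x < ⊤) :
    ‖u x‖ₑ ^ critExp N s ≤ ENNReal.ofReal (pointwiseConst N s ^ critExp N s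
      * (eLpNorm u (ENNReal.ofReal (critExp N s)) volume).toReal ^ (2 * s / N * critExp N s))
        * localEnergy N s u x := by
  have hp0 : 0 ≤ critExp N s := by linarith [critExp_gt_two hs hN]
  have hc := pointwiseConst_pos N s
  rw [← ofReal_norm, ENNReal.ofReal_rpow_of_nonneg (norm_nonneg _) hp0,
    ← ENNReal.ofReal_toReal hx.ne, ← ENNReal.ofReal_mul (by positivity)]
  refine ENNReal.ofReal_le_ofReal ((Real.rpow_le_rpow (norm_nonneg _)
    (abs_le_pointwiseConst_mul hs hN hu hu0 hx) hp0).trans_eq ?_)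
  rw [Real.mul_rpow hc.le (by positivity), Real.mul_rpow (by positivity) (by positivity),
    ← Real.rpow_mul hu0.le, ← Real.rpow_mul (Real.sqrt_nonneg _), one_sub_mul_critExp hs.le hN,
    Real.rpow_two, Real.sq_sqrt ENNReal.toReal_nonneg, mul_assoc]

lemma rpow_critExp_norm_le (hs : 0 < s) (hN : 2 * s < N) {u : V → ℝ}
    (hu : MemLp u (ENNReal.ofReal (critExp N s)) volume) (hd : MemLp (diffQuot N s u) 2 volume)
    (hu0 : 0 < (eLpNorm u (ENNReal.ofReal (critExp N s)) volume).toReal) :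
    (eLpNorm u (ENNReal.ofReal (critExp N s)) volume).toReal ^ critExp N s
      ≤ pointwiseConst N s ^ critExp N s
        * (eLpNorm u (ENNReal.ofReal (critExp N s)) volume).toReal ^ (2 * s / N * critExp N s)
        * (eLpNorm (diffQuot N s u) 2 volume).toReal ^ 2 := by
  have hp0 : 0 < critExp N s := by linarith [critExp_gt_two hs hN]
  have hc := pointwiseConst_pos N s
  have henergy : ∫⁻ x, localEnergy N s u x
      = ENNReal.ofReal ((eLpNorm (diffQuot N s u) 2 volume).toReal ^ 2) := by
    rw [lintegral_localEnergy hu.1, ENNReal.ofReal_pow ENNReal.toReal_nonneg,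
      ENNReal.ofReal_toReal hd.2.ne, ENNReal.rpow_two]
  have hfin : ∀ᵐ x : V, localEnergy N s u x < ⊤ :=
    ae_lt_top' (aemeasurable_localEnergy hu.1) (henergy ▸ ENNReal.ofReal_ne_top)
  have hnorm : ENNReal.ofReal ((eLpNorm u (ENNReal.ofReal (critExp N s)) volume).toReal
      ^ critExp N s) = ∫⁻ x, ‖u x‖ₑ ^ critExp N s := by
    rw [← ENNReal.ofReal_rpow_of_nonneg hu0.le hp0.le, ENNReal.ofReal_toReal hu.2.ne,
      eLpNorm_eq_lintegral_rpow_enorm_toReal (ENNReal.ofReal_pos.2 hp0).ne' ENNReal.ofReal_ne_top,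
      ENNReal.toReal_ofReal hp0.le, ← ENNReal.rpow_mul, one_div_mul_cancel hp0.ne',
      ENNReal.rpow_one]
  rw [← ENNReal.ofReal_le_ofReal_iff (by positivity), hnorm,
    ENNReal.ofReal_mul (by positivity), ← henergy,
    ← lintegral_const_mul' _ _ ENNReal.ofReal_ne_top]
  exact lintegral_mono_ae (hfin.mono fun x hx => enorm_rpow_critExp_le hs hN hu hu0 hx)

theorem exists_sobolev_const (hs : 0 < s) (hN : 2 * s < N) : ∃ C > 0, ∀ u : V → ℝ,
    MemLp u (ENNReal.ofReal (critExp N s)) volume → MemLp (diffQuot N s u) 2 volume →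
    (eLpNorm u (ENNReal.ofReal (critExp N s)) volume).toReal
      ≤ C * (eLpNorm (diffQuot N s u) 2 volume).toReal := by
  have hc := pointwiseConst_pos N s
  refine ⟨pointwiseConst N s ^ (critExp N s / 2), by positivity, fun u hu hd => ?_⟩
  rcases (ENNReal.toReal_nonneg :
    0 ≤ (eLpNorm u (ENNReal.ofReal (critExp N s)) volume).toReal).eq_or_lt with hu0 | hu0
  · rw [← hu0]
    positivity
  have hle := rpow_critExp_norm_le hs hN hu hd hu0
  set U := (eLpNorm u (ENNReal.ofReal (critExp N s)) volume).toReal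
  set G := (eLpNorm (diffQuot N s u) 2 volume).toReal
  have hU : U ^ critExp N s = U ^ (2 * s / N * critExp N s) * U ^ 2 := by
    rw [← Real.rpow_two, ← Real.rpow_add hu0]
    congr 1
    linarith [one_sub_mul_critExp hs.le hN]
  have hc2 : (pointwiseConst N s ^ (critExp N s / 2)) ^ 2 = pointwiseConst N s ^ critExp N s := by
    rw [← Real.rpow_two, ← Real.rpow_mul hc.le, div_mul_cancel₀ _ two_ne_zero]
  rw [hU, mul_comm (_ ^ critExp N s), mul_assoc] at hle
  refine (sq_le_sq₀ hu0.le (by positivity)).1 ?_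
  rw [mul_pow, hc2]
  exact le_of_mul_le_mul_left hle (by positivity)

end Sobolev

/-! ### The fractional Rellich theorem -/

section LpCompactness

variable {α : Type*} [MeasurableSpace α] {μ : Measure α}

/- Bounded subsets of `L^p` are weak-* relatively sequentially compact as functionals on the dual
exponent; test them against indicators. -/
lemma exists_subseq_tendsto_setIntegral [IsSeparable μ] {p : ℝ} [Fact (1 < p)]
    (u : ℕ → Lp ℝ (ENNReal.ofReal p) μ) {M : ℝ} (hM : ∀ n, ‖u n‖ ≤ M) :
    ∃ k : ℕ → ℕ, StrictMono k ∧ ∀ B, MeasurableSet B → μ B ≠ ⊤ →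
      ∃ c, Tendsto (fun n => ∫ x in B, u (k n) x ∂μ) atTop (𝓝 c) := by
  have : Fact (ENNReal.ofReal p.conjExponent ≠ ⊤) := ⟨ENNReal.ofReal_ne_top⟩
  set Q := ((ContinuousLinearMap.mul ℝ ℝ).lpPairing μ (ENNReal.ofReal p.conjExponent)
    (ENNReal.ofReal p)).flip with hQ
  obtain ⟨ℓ, -, k, hk, hlim⟩ := WeakDual.isSeqCompact_closedBall ℝ
    (Lp ℝ (ENNReal.ofReal p.conjExponent) μ) 0 (‖Q‖ * M)
    (x := fun n => StrongDual.toWeakDual (Q (u n))) (fun n => by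
      change dist (Q (u n)) 0 ≤ _
      rw [dist_zero_right]
      exact (Q.le_opNorm _).trans (by gcongr; exact hM n))
  refine ⟨k, hk, fun B hB hBt => ⟨ℓ (indicatorConstLp _ hB hBt 1), ?_⟩⟩
  refine (((WeakDual.eval_continuous (indicatorConstLp (ENNReal.ofReal p.conjExponent)
    hB hBt (1 : ℝ))).tendsto ℓ).comp hlim).congr fun n => ?_
  change Q (u (k n)) (indicatorConstLp _ hB hBt 1) = _
  rw [hQ, ContinuousLinearMap.flip_apply, ContinuousLinearMap.lpPairing_eq_integral,
    ← integral_indicator hB]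
  refine integral_congr_ae ?_
  filter_upwards [indicatorConstLp_coeFn (p := ENNReal.ofReal p.conjExponent) (hs := hB)
    (hμs := hBt) (c := (1 : ℝ))] with x hx
  rw [hx]
  by_cases hxB : x ∈ B <;> simp [hxB]

lemma cauchySeq_toLp_of_eventually_close {q : ENNReal} [Fact (1 ≤ q)] {w : ℕ → α → ℝ}
    (hw : ∀ n, MemLp (w n) q μ)
    (hclose : ∀ ε : ENNReal, ε ≠ 0 → ∃ a : α → ℝ, AEStronglyMeasurable a μ ∧
      ∀ᶠ n in atTop, eLpNorm (w n - a) q μ ≤ ε) :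
    CauchySeq fun n => (hw n).toLp (w n) := by
  rw [EMetric.cauchySeq_iff]
  intro ε hε
  obtain ⟨δ, hδ, hδε⟩ := exists_between hε
  obtain ⟨a, ham, ha⟩ := hclose (δ / 2) (ENNReal.half_pos hδ.ne').ne'
  obtain ⟨n₀, hn₀⟩ := eventually_atTop.1 ha
  refine ⟨n₀, fun m hm n hn => ?_⟩
  calc edist ((hw m).toLp (w m)) ((hw n).toLp (w n))
      = eLpNorm ((w m - a) - (w n - a)) q μ := by rw [Lp.edist_toLp_toLp, sub_sub_sub_cancel_right]
    _ ≤ eLpNorm (w m - a) q μ + eLpNorm (w n - a) q μ :=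
        eLpNorm_sub_le ((hw m).1.sub ham) ((hw n).1.sub ham) Fact.out
    _ ≤ δ / 2 + δ / 2 := add_le_add (hn₀ m hm) (hn₀ n hn)
    _ < ε := by rwa [ENNReal.add_halves]

lemma exists_subseq_ae_tendsto_of_cauchySeq {q : ENNReal} [Fact (1 ≤ q)] {w : ℕ → α → ℝ}
    (hw : ∀ n, MemLp (w n) q μ) (hc : CauchySeq fun n => (hw n).toLp (w n)) :
    ∃ j : ℕ → ℕ, StrictMono j ∧ ∃ v : α → ℝ,
      ∀ᵐ x ∂μ, Tendsto (fun n => w (j n) x) atTop (𝓝 (v x)) := by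
  obtain ⟨v, hv⟩ := cauchySeq_tendsto_of_complete hc
  obtain ⟨j, hj, hjv⟩ := (tendstoInMeasure_of_tendsto_Lp hv).exists_seq_tendsto_ae
  refine ⟨j, hj, v, ?_⟩
  filter_upwards [hjv, ae_all_iff.2 fun n => (hw n).coeFn_toLp] with x hx hcoe
  exact hx.congr fun n => hcoe (j n)

lemma eLpNorm_le_of_le_smul {ν : Measure α} {c : ENNReal} (hμ : μ ≤ c • ν) {p : ENNReal}
    (hp : p ≠ ⊤) (u : α → ℝ) : eLpNorm u p μ ≤ c ^ (1 / p).toReal * eLpNorm u p ν := by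
  refine (eLpNorm_mono_measure u hμ).trans_eq ?_
  rw [eLpNorm_smul_measure_of_ne_top hp, smul_eq_mul]

end LpCompactness

section Rellich

variable {N : ℕ} {s : ℝ}

local notation "V" => EuclideanSpace ℝ (Fin N)

lemma stronglyMeasurable_average {u : V → ℝ} (hu : StronglyMeasurable u) (r : ℝ) :
    StronglyMeasurable fun x => ⨍ y in Metric.ball x r, u y := by
  have havg (x : V) : ⨍ y in Metric.ball x r, u y =
      (volume.real (Metric.ball (0 : V) r))⁻¹ *
        ∫ y, {z : V × V | dist z.2 z.1 < r}.indicator (fun z => u z.2) (x, y) := by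
    rw [setAverage_eq, smul_eq_mul, ← integral_indicator Metric.isOpen_ball.measurableSet,
      measureReal_def, measureReal_def, Measure.addHaar_ball_center]
    rfl
  simp_rw [havg]
  exact StronglyMeasurable.const_mul (StronglyMeasurable.integral_prod_right'
    ((hu.comp_measurable measurable_snd).indicator
      (measurableSet_lt (by fun_prop) measurable_const))) _

lemma eLpNorm_sub_average_le (hs : 0 ≤ s) {u : V → ℝ} (hum : AEStronglyMeasurable u volume)
    (hu : LocallyIntegrable u volume) {r : ℝ} (hr : 0 < r) :
    eLpNorm (fun x => u x - ⨍ y in Metric.ball x r, u y) 2 volume ≤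
      ENNReal.ofReal (unitBallVolume N ^ (-(1 / 2) : ℝ) * r ^ s)
        * eLpNorm (diffQuot N s u) 2 volume := by
  rw [eLpNorm_eq_lintegral_rpow_enorm_toReal (by norm_num) (by norm_num), ENNReal.toReal_ofNat]
  set c := ENNReal.ofReal (unitBallVolume N ^ (-(1 / 2) : ℝ) * r ^ s)
  calc (∫⁻ x, ‖u x - ⨍ y in Metric.ball x r, u y‖ₑ ^ (2 : ℝ)) ^ (1 / 2 : ℝ)
      ≤ (∫⁻ x, c ^ (2 : ℝ) * localEnergy N s u x) ^ (1 / 2 : ℝ) := by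
        refine ENNReal.rpow_le_rpow (lintegral_mono fun x => ?_) (by norm_num)
        refine (ENNReal.rpow_le_rpow (enorm_sub_average_le hs hu x hr) (by norm_num)).trans_eq ?_
        rw [ENNReal.mul_rpow_of_nonneg _ _ (by norm_num), ← ENNReal.rpow_mul,
          one_div_mul_cancel (by norm_num), ENNReal.rpow_one]
    _ = (c ^ (2 : ℝ) * eLpNorm (diffQuot N s u) 2 volume ^ (2 : ℝ)) ^ (1 / 2 : ℝ) := by
        rw [lintegral_const_mul' _ _ (ENNReal.rpow_ne_top_of_nonneg (by norm_num)
          ENNReal.ofReal_ne_top), lintegral_localEnergy hum]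
    _ = c * eLpNorm (diffQuot N s u) 2 volume := by
        rw [← ENNReal.mul_rpow_of_nonneg _ _ (by norm_num), ← ENNReal.rpow_mul,
          mul_one_div_cancel (by norm_num), ENNReal.rpow_one]

variable {μ : Measure (EuclideanSpace ℝ (Fin N))} {c : ENNReal}

lemma eLpNorm_one_sub_average_le (hs : 0 ≤ s) (hμ : μ ≤ c • volume) {u : V → ℝ}
    (hum : StronglyMeasurable u) (hu : LocallyIntegrable u volume) {r : ℝ} (hr : 0 < r) :
    eLpNorm (fun x => u x - ⨍ y in Metric.ball x r, u y) 1 μ ≤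
      ENNReal.ofReal (unitBallVolume N ^ (-(1 / 2) : ℝ) * r ^ s)
        * (c ^ (1 / 2 : ENNReal).toReal * eLpNorm (diffQuot N s u) 2 volume
          * μ univ ^ (1 / 2 : ℝ)) := by
  have hmeas := hum.sub (stronglyMeasurable_average hum r)
  calc eLpNorm (fun x => u x - ⨍ y in Metric.ball x r, u y) 1 μ
      ≤ eLpNorm (fun x => u x - ⨍ y in Metric.ball x r, u y) 2 μ
          * μ univ ^ (1 / (1 : ENNReal).toReal - 1 / (2 : ENNReal).toReal) :=
        eLpNorm_le_eLpNorm_mul_rpow_measure_univ (by norm_num) hmeas.aestronglyMeasurable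
    _ ≤ (c ^ (1 / 2 : ENNReal).toReal *
          (ENNReal.ofReal (unitBallVolume N ^ (-(1 / 2) : ℝ) * r ^ s)
            * eLpNorm (diffQuot N s u) 2 volume))
          * μ univ ^ (1 / (1 : ENNReal).toReal - 1 / (2 : ENNReal).toReal) := by
        gcongr
        refine (eLpNorm_le_of_le_smul hμ (by norm_num) _).trans ?_
        gcongr
        exact eLpNorm_sub_average_le hs hum.aestronglyMeasurable hu hr
    _ = _ := by
        rw [ENNReal.toReal_one, ENNReal.toReal_ofNat, show (1 : ℝ) / 1 - 1 / 2 = 1 / 2 by norm_num]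
        ring

variable [IsFiniteMeasure μ]

lemma exists_radius_eLpNorm_sub_average_le (hs : 0 < s) (hc : c ≠ ⊤) (hμ : μ ≤ c • volume)
    (M : ℝ) {ε : ENNReal} (hε : ε ≠ 0) :
    ∃ r > 0, ∀ u : V → ℝ, StronglyMeasurable u → LocallyIntegrable u volume →
      eLpNorm (diffQuot N s u) 2 volume ≤ ENNReal.ofReal M →
      eLpNorm (fun x => u x - ⨍ y in Metric.ball x r, u y) 1 μ ≤ ε := by
  set L : ENNReal := c ^ (1 / 2 : ENNReal).toReal * ENNReal.ofReal M * μ univ ^ (1 / 2 : ℝ)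
  have hL : L ≠ ⊤ := by finiteness
  have hzero : Tendsto (fun r : ℝ =>
      ENNReal.ofReal (unitBallVolume N ^ (-(1 / 2) : ℝ) * r ^ s) * L) (𝓝[>] 0) (𝓝 0) := by
    have hreal : Tendsto (fun r : ℝ => unitBallVolume N ^ (-(1 / 2) : ℝ) * r ^ s) (𝓝 0)
        (𝓝 (unitBallVolume N ^ (-(1 / 2) : ℝ) * 0 ^ s)) :=
      (Real.continuousAt_rpow_const 0 s (Or.inr hs.le)).tendsto.const_mul _
    rw [Real.zero_rpow hs.ne', mul_zero] at hreal
    simpa using ENNReal.Tendsto.mul_const (b := L)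
      (ENNReal.tendsto_ofReal (hreal.mono_left nhdsWithin_le_nhds)) (Or.inr hL)
  obtain ⟨r, hrε, hr⟩ := ((hzero.eventually_le_const (pos_iff_ne_zero.2 hε)).and
    self_mem_nhdsWithin).exists
  refine ⟨r, hr, fun u hum hu hM => ?_⟩
  calc eLpNorm (fun x => u x - ⨍ y in Metric.ball x r, u y) 1 μ
      ≤ ENNReal.ofReal (unitBallVolume N ^ (-(1 / 2) : ℝ) * r ^ s)
        * (c ^ (1 / 2 : ENNReal).toReal * eLpNorm (diffQuot N s u) 2 volume
          * μ univ ^ (1 / 2 : ℝ)) := eLpNorm_one_sub_average_le hs.le hμ hum hu hr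
    _ ≤ ENNReal.ofReal (unitBallVolume N ^ (-(1 / 2) : ℝ) * r ^ s) * L := by
        simp only [L]
        gcongr
    _ ≤ ε := hrε

variable {p : ℝ} [Fact (1 < p)] {M : ℝ}

lemma exists_tendsto_eLpNorm_average_sub
    (u : ℕ → Lp ℝ (ENNReal.ofReal p) (volume : Measure V)) (hM : ∀ n, ‖u n‖ ≤ M) {r : ℝ}
    (hr : 0 < r)
    (hlim : ∀ x, ∃ b, Tendsto (fun n => ∫ y in Metric.ball x r, u n y) atTop (𝓝 b)) :
    ∃ a : V → ℝ, AEStronglyMeasurable a μ ∧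
      Tendsto (fun n => eLpNorm (fun x => (⨍ y in Metric.ball x r, u n y) - a x) 1 μ)
        atTop (𝓝 0) := by
  have hp : 1 < p := Fact.out
  have hω := unitBallVolume_pos N
  choose b hb using hlim
  have hmeas (n : ℕ) : AEStronglyMeasurable (fun x => ⨍ y in Metric.ball x r, u n y) μ :=
    (stronglyMeasurable_average (Lp.stronglyMeasurable _) r).aestronglyMeasurable
  have havg (x : V) : Tendsto (fun n => ⨍ y in Metric.ball x r, u n y) atTop
      (𝓝 ((volume.real (Metric.ball x r))⁻¹ • b x)) := by
    simpa only [setAverage_eq] using (hb x).const_smul _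
  refine ⟨_, aestronglyMeasurable_of_tendsto_ae atTop hmeas (ae_of_all _ havg), ?_⟩
  have hbound (n : ℕ) : eLpNorm (fun x => ⨍ y in Metric.ball x r, u n y) (ENNReal.ofReal 2) μ
      ≤ μ univ ^ (ENNReal.ofReal 2).toReal⁻¹
        * ENNReal.ofReal (unitBallVolume N ^ (-(1 / p)) * r ^ (-(N / p)) * M) := by
    refine eLpNorm_le_of_ae_bound (ae_of_all _ fun x => ?_)
    rw [Real.norm_eq_abs]
    refine (abs_average_le hp.le (Lp.memLp (u n)) x hr).trans ?_
    gcongr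
    exact hM n
  exact PowerGrowth.tendsto_eLpNorm_comp_sub (φ := fun t => t) (m := 1)
    continuous_id one_pos ⟨1, zero_le_one, fun t => by simp⟩ le_rfl (by norm_num)
    hmeas (by finiteness) hbound (ae_of_all _ havg)

theorem exists_subseq_ae_tendsto (hs : 0 < s) (hc : c ≠ ⊤) (hμ : μ ≤ c • volume)
    (u : ℕ → Lp ℝ (ENNReal.ofReal p) (volume : Measure V)) (hM : ∀ n, ‖u n‖ ≤ M)
    (hM' : ∀ n, eLpNorm (diffQuot N s (u n)) 2 volume ≤ ENNReal.ofReal M) :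
    ∃ k : ℕ → ℕ, StrictMono k ∧ ∃ v : V → ℝ,
      ∀ᵐ x ∂μ, Tendsto (fun n => u (k n) x) atTop (𝓝 (v x)) := by
  have hp : 1 ≤ ENNReal.ofReal p := ENNReal.one_le_ofReal.2 (Fact.out : 1 < p).le
  have hac : μ ≪ volume := Measure.absolutelyContinuous_of_le_smul hμ
  obtain ⟨k, hk, hlim⟩ := exists_subseq_tendsto_setIntegral u hM
  have hmem (n : ℕ) : MemLp (u (k n)) 1 μ := by
    refine MemLp.mono_exponent (q := ENNReal.ofReal p)
      ⟨(Lp.aestronglyMeasurable _).mono_ac hac,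
        (eLpNorm_le_of_le_smul hμ ENNReal.ofReal_ne_top _).trans_lt ?_⟩ hp
    exact ENNReal.mul_lt_top (by finiteness) (Lp.memLp (u (k n))).2
  have hclose (ε : ENNReal) (hε : ε ≠ 0) : ∃ a : V → ℝ, AEStronglyMeasurable a μ ∧
      ∀ᶠ n in atTop, eLpNorm (⇑(u (k n)) - a) 1 μ ≤ ε := by
    have hε2 : ε / 2 ≠ 0 := (ENNReal.half_pos hε).ne'
    obtain ⟨r, hr, hnear⟩ := exists_radius_eLpNorm_sub_average_le hs hc hμ M hε2
    obtain ⟨a, ham, ha⟩ := exists_tendsto_eLpNorm_average_sub (μ := μ) (fun n => u (k n))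
      (fun n => hM (k n)) hr
      fun x => hlim _ Metric.isOpen_ball.measurableSet measure_ball_lt_top.ne
    refine ⟨a, ham, (ha.eventually_le_const (pos_iff_ne_zero.2 hε2)).mono fun n hn => ?_⟩
    have hA := stronglyMeasurable_average (Lp.stronglyMeasurable (u (k n))) r
    calc eLpNorm (⇑(u (k n)) - a) 1 μ
        = eLpNorm ((fun x => u (k n) x - ⨍ y in Metric.ball x r, u (k n) y)
            + fun x => (⨍ y in Metric.ball x r, u (k n) y) - a x) 1 μ := by
          congr 1
          funext x
          simp
      _ ≤ ε / 2 + ε / 2 := (eLpNorm_add_le ((hmem n).1.sub hA.aestronglyMeasurable)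
          (hA.aestronglyMeasurable.sub ham) le_rfl).trans (add_le_add
            (hnear _ (Lp.stronglyMeasurable _) ((Lp.memLp _).locallyIntegrable hp) (hM' _)) hn)
      _ = ε := ENNReal.add_halves ε
  obtain ⟨j, hj, v, hv⟩ := exists_subseq_ae_tendsto_of_cauchySeq hmem
    (cauchySeq_toLp_of_eventually_close hmem hclose)
  exact ⟨k ∘ j, hk.comp hj, v, hv⟩

end Rellich

/-! ### The Gagliardo space and its test functions -/

namespace GagliardoSpace

variable {N : ℕ} {s : ℝ} {hs : 0 < s} {hN : 2 * s < N}

lemma norm_toLp_nonneg (u : GagliardoSpace hs hN) : 0 ≤ ‖toLp u‖ := ENNReal.toReal_nonneg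

lemma norm_toLp_le_norm (u : GagliardoSpace hs hN) : ‖toLp u‖ ≤ ‖u‖ := by
  rw [norm_def]
  exact le_add_of_nonneg_left (Real.sqrt_nonneg _)

lemma seminorm_le_norm (u : GagliardoSpace hs hN) : gagliardoSeminorm N s u ≤ ‖u‖ := by
  rw [norm_def]
  exact le_add_of_nonneg_right (norm_toLp_nonneg u)

/-- The difference quotient as a linear map to `L²`. The seminorm of `u` is the norm of `quot u`,
so `quot` carries the Hilbert space structure. -/
def quot : GagliardoSpace hs hN →L[ℝ]
    Lp ℝ 2 (volume : Measure (EuclideanSpace ℝ (Fin N) × EuclideanSpace ℝ (Fin N))) :=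
  LinearMap.mkContinuous
    { toFun := fun u => (memLp_diffQuot u).toLp _
      map_add' := fun u v => by
        rw [← MemLp.toLp_add, MemLp.toLp_eq_toLp_iff, ← diffQuot_add]
        exact diffQuot_congr N s (coe_add u v)
      map_smul' := fun c u => by
        rw [RingHom.id_apply, ← MemLp.toLp_const_smul, MemLp.toLp_eq_toLp_iff, ← diffQuot_smul]
        exact diffQuot_congr N s (coe_smul c u) } 1 fun u => by
    change ‖(memLp_diffQuot u).toLp _‖ ≤ _
    rw [Lp.norm_toLp, toReal_eLpNorm (memLp_diffQuot u).1, ← seminorm_eq, one_mul]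
    exact seminorm_le_norm u

lemma quot_coe (u : GagliardoSpace hs hN) : quot u =ᵐ[volume] diffQuot N s u :=
  (memLp_diffQuot u).coeFn_toLp

lemma norm_quot (u : GagliardoSpace hs hN) : ‖quot u‖ = gagliardoSeminorm N s u := by
  change ‖(memLp_diffQuot u).toLp _‖ = _
  rw [Lp.norm_toLp, seminorm_eq, toReal_eLpNorm (memLp_diffQuot u).1]

lemma inner_quot (u v : GagliardoSpace hs hN) :
    inner ℝ (quot u) (quot v) = gagliardoForm N s u v := by
  rw [L2.inner_def, gagliardoForm]
  refine integral_congr_ae ?_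
  filter_upwards [quot_coe u, quot_coe v] with z hu hv
  rw [hu, hv, RCLike.inner_apply, conj_trivial, diffQuot, diffQuot, gagliardoIntegrand,
    div_mul_div_comm, ← Real.rpow_add_of_nonneg (norm_nonneg _), add_halves, mul_comm]
  all_goals positivity

lemma eLpNorm_diffQuot_le {M : ℝ} {u : GagliardoSpace hs hN} (hu : ‖u‖ ≤ M) :
    eLpNorm (diffQuot N s u) 2 volume ≤ ENNReal.ofReal M := by
  rw [← ENNReal.ofReal_toReal (memLp_diffQuot u).2.ne, toReal_eLpNorm (memLp_diffQuot u).1,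
    ← seminorm_eq]
  exact ENNReal.ofReal_le_ofReal ((seminorm_le_norm u).trans hu)

variable (hs hN) in
lemma exists_norm_le_seminorm : ∃ C > 0, ∀ u : GagliardoSpace hs hN,
    ‖u‖ ≤ C * gagliardoSeminorm N s u := by
  obtain ⟨C, hC, hsob⟩ := exists_sobolev_const hs hN
  refine ⟨1 + C, by positivity, fun u => ?_⟩
  have hu := hsob (toLp u) (Lp.memLp _) (memLp_diffQuot u)
  rw [toReal_eLpNorm (memLp_diffQuot u).1, ← seminorm_eq] at hu
  rw [norm_def, add_mul, one_mul]
  exact add_le_add le_rfl hu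

lemma ae_eq_diffQuot_of_tendsto [Fact (1 ≤ ENNReal.ofReal (critExp N s))]
    {u : ℕ → GagliardoSpace hs hN}
    {U : Lp ℝ (ENNReal.ofReal (critExp N s)) (volume : Measure (EuclideanSpace ℝ (Fin N)))}
    (hU : Tendsto (fun n => toLp (u n)) atTop (𝓝 U))
    {H : Lp ℝ 2 (volume : Measure (EuclideanSpace ℝ (Fin N) × EuclideanSpace ℝ (Fin N)))}
    (hH : Tendsto (fun n => quot (u n)) atTop (𝓝 H)) : H =ᵐ[volume] diffQuot N s U := by
  obtain ⟨k, hk, hkU⟩ := (tendstoInMeasure_of_tendsto_Lp hU).exists_seq_tendsto_ae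
  obtain ⟨j, hj, hjH⟩ := (tendstoInMeasure_of_tendsto_Lp
    (hH.comp hk.tendsto_atTop)).exists_seq_tendsto_ae
  have hfst : ∀ᵐ z : EuclideanSpace ℝ (Fin N) × EuclideanSpace ℝ (Fin N),
      Tendsto (fun n => toLp (u (k n)) z.1) atTop (𝓝 (U z.1)) :=
    Measure.quasiMeasurePreserving_fst.ae hkU
  have hsnd : ∀ᵐ z : EuclideanSpace ℝ (Fin N) × EuclideanSpace ℝ (Fin N),
      Tendsto (fun n => toLp (u (k n)) z.2) atTop (𝓝 (U z.2)) :=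
    Measure.quasiMeasurePreserving_snd.ae hkU
  filter_upwards [hfst, hsnd, ae_all_iff.2 fun n => quot_coe (u n), hjH] with z hz₁ hz₂ hq hz
  simp only [Function.comp_apply, hq] at hz
  exact tendsto_nhds_unique hz (((hz₁.sub hz₂).div_const _).comp hj.tendsto_atTop)

instance : CompleteSpace (GagliardoSpace hs hN) := by
  have hfact : Fact (1 ≤ ENNReal.ofReal (critExp N s)) := ⟨one_le_ofReal_critExp hs hN⟩
  refine Metric.complete_of_cauchySeq_tendsto fun u hu => ?_
  have hLp : CauchySeq fun n => toLp (u n) := by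
    rw [Metric.cauchySeq_iff] at hu ⊢
    intro ε hε
    obtain ⟨n₀, hn₀⟩ := hu ε hε
    refine ⟨n₀, fun m hm n hn => lt_of_le_of_lt ?_ (hn₀ m hm n hn)⟩
    rw [dist_eq_norm, dist_eq_norm]
    exact norm_toLp_le_norm (u m - u n)
  obtain ⟨U, hU⟩ := cauchySeq_tendsto_of_complete hLp
  obtain ⟨H, hH⟩ := cauchySeq_tendsto_of_complete (u := fun n => quot (u n))
    (hu.map (quot (hs := hs) (hN := hN)).uniformContinuous)
  have hHU := ae_eq_diffQuot_of_tendsto hU hH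
  have hmem : U ∈ gagliardoSubmodule N s :=
    (memLp_diffQuot_iff N s (Lp.aestronglyMeasurable _)).1 ((memLp_congr_ae hHU).1 (Lp.memLp H))
  set v : GagliardoSpace hs hN := (⟨U, hmem⟩ : gagliardoSubmodule N s)
  have hv : quot v = H := Lp.ext ((quot_coe v).trans hHU.symm)
  have hnorm (n : ℕ) : ‖u n - v‖ = ‖quot (u n) - H‖ + ‖toLp (u n) - U‖ := by
    rw [norm_def, ← norm_quot, map_sub, hv]
    rfl
  refine ⟨v, tendsto_iff_norm_sub_tendsto_zero.2 ?_⟩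
  simpa only [hnorm, add_zero] using
    (tendsto_iff_norm_sub_tendsto_zero.1 hH).add (tendsto_iff_norm_sub_tendsto_zero.1 hU)

end GagliardoSpace

section TestFunctions

variable {N : ℕ} {s : ℝ}

local notation "V" => EuclideanSpace ℝ (Fin N)

/-- The radial profile of a kernel dominating the squared difference quotients of functions whose
squared increments are at most `L |x - y|²` and at most `M`. -/
def gagliardoProfile (N : ℕ) (s L M t : ℝ) : ℝ := min (L * t ^ 2) M / t ^ ((N : ℝ) + 2 * s)

lemma measurable_gagliardoProfile (L M : ℝ) : Measurable (gagliardoProfile N s L M) := by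
  unfold gagliardoProfile
  fun_prop

lemma gagliardoProfile_nonneg {L M t : ℝ} (hL : 0 ≤ L) (hM : 0 ≤ M) (ht : 0 ≤ t) :
    0 ≤ gagliardoProfile N s L M t := by
  unfold gagliardoProfile
  positivity

lemma pow_smul_gagliardoProfile_le (hN : 0 < N) {L M t : ℝ} (ht : 0 < t) {b e : ℝ}
    (hb : min (L * t ^ 2) M ≤ b * t ^ e) :
    t ^ (N - 1) • gagliardoProfile N s L M t ≤ b * t ^ (e - 1 - 2 * s) := by
  have hpow : t ^ (N - 1) = t ^ ((N : ℝ) - 1) := by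
    rw [← Real.rpow_natCast, Nat.cast_sub hN, Nat.cast_one]
  calc t ^ (N - 1) • gagliardoProfile N s L M t
      ≤ t ^ ((N : ℝ) - 1) * (b * t ^ e / t ^ ((N : ℝ) + 2 * s)) := by
        rw [smul_eq_mul, hpow, gagliardoProfile]
        gcongr
    _ = b * (t ^ ((N : ℝ) - 1) * t ^ e / t ^ ((N : ℝ) + 2 * s)) := by ring
    _ = b * t ^ (e - 1 - 2 * s) := by
        rw [← Real.rpow_add ht, ← Real.rpow_sub ht]
        ring_nf

lemma integrable_gagliardoProfile_norm (hs0 : 0 < s) (hs1 : s < 1) (hN : 0 < N) {L M : ℝ}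
    (hL : 0 ≤ L) (hM : 0 ≤ M) :
    Integrable (fun x : V => gagliardoProfile N s L M ‖x‖) volume := by
  have : Nonempty (Fin N) := ⟨⟨0, hN⟩⟩
  have hmeas : Measurable fun t : ℝ => t ^ (N - 1) • gagliardoProfile N s L M t :=
    (measurable_id.pow_const _).smul (measurable_gagliardoProfile L M)
  have hdom {S : Set ℝ} (hS : MeasurableSet S) (hS0 : S ⊆ Ioi 0) {b e : ℝ}
      (hint : IntegrableOn (fun t : ℝ => b * t ^ (e - 1 - 2 * s)) S)
      (hb : ∀ t, min (L * t ^ 2) M ≤ b * t ^ e) :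
      IntegrableOn (fun t : ℝ => t ^ (N - 1) • gagliardoProfile N s L M t) S := by
    refine Integrable.mono' hint hmeas.aestronglyMeasurable
      ((ae_restrict_iff' hS).2 (ae_of_all _ fun t ht => ?_))
    have ht0 : 0 < t := hS0 ht
    rw [Real.norm_of_nonneg (smul_nonneg (by positivity) (gagliardoProfile_nonneg hL hM ht0.le))]
    exact pow_smul_gagliardoProfile_le hN ht0 (hb t)
  rw [integrable_fun_norm_addHaar volume (f := gagliardoProfile N s L M), finrank_euclideanSpace,
    Fintype.card_fin, ← Ioc_union_Ioi_eq_Ioi (zero_le_one (α := ℝ)), integrableOn_union]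
  constructor
  · refine hdom (b := L) (e := 2) measurableSet_Ioc (fun t ht => ht.1) ?_ fun t => ?_
    · exact ((intervalIntegrable_iff_integrableOn_Ioc_of_le zero_le_one).1
        (intervalIntegral.intervalIntegrable_rpow' (by linarith))).const_mul L
    · rw [Real.rpow_two]
      exact min_le_left _ _
  · refine hdom (b := M) (e := 0) measurableSet_Ioi (Ioi_subset_Ioi zero_le_one) ?_ fun t => ?_
    · exact (integrableOn_Ioi_rpow_of_lt (by linarith) one_pos).const_mul M
    · rw [Real.rpow_zero, mul_one]
      exact min_le_right _ _

lemma diffQuot_sq (u : V → ℝ) (z : V × V) :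
    diffQuot N s u z ^ 2 = (u z.1 - u z.2) ^ 2 / ‖z.1 - z.2‖ ^ ((N : ℝ) + 2 * s) := by
  rw [← congrFun (gagliardoIntegrand_self N s u) z, gagliardoIntegrand, sq]

lemma diffQuot_sq_le_gagliardoProfile {φ : V → ℝ} {L : NNReal} (hL : LipschitzWith L φ) {M : ℝ}
    (hM : ∀ x, ‖φ x‖ ≤ M) (z : V × V) :
    diffQuot N s φ z ^ 2 ≤ gagliardoProfile N s ((L : ℝ) ^ 2) ((2 * M) ^ 2) ‖z.1 - z.2‖ := by
  rw [diffQuot_sq, gagliardoProfile, ← sq_abs]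
  gcongr
  refine le_min ?_ ?_
  · have hlip := hL.dist_le_mul z.1 z.2
    rw [dist_eq_norm, dist_eq_norm, Real.norm_eq_abs] at hlip
    rw [← mul_pow]
    gcongr
  · gcongr
    calc |φ z.1 - φ z.2| ≤ |φ z.1| + |φ z.2| := abs_sub _ _
      _ ≤ 2 * M := by linarith [hM z.1, hM z.2, Real.norm_eq_abs (φ z.1), Real.norm_eq_abs (φ z.2)]

lemma integrable_indicator_snd_mul_comp_sub {K : Set V} (hK : MeasurableSet K)
    (hK' : volume K ≠ ⊤) {κ : V → ℝ} (hκ : Integrable κ volume) :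
    Integrable (fun z : V × V => K.indicator (fun _ => (1 : ℝ)) z.2 * κ (z.1 - z.2))
      (volume.prod volume) := by
  simpa only [ContinuousLinearMap.mul_apply'] using
    Integrable.convolution_integrand (ContinuousLinearMap.mul ℝ ℝ)
      ((integrable_indicator_iff hK).2 (integrableOn_const hK')) hκ

lemma memLp_diffQuot_of_contDiff (hs0 : 0 < s) (hs1 : s < 1) (hN : 0 < N) {φ : V → ℝ}
    (hφ : ContDiff ℝ 1 φ) (hc : HasCompactSupport φ) : MemLp (diffQuot N s φ) 2 volume := by
  obtain ⟨L, hL⟩ := hφ.lipschitzWith_of_hasCompactSupport hc one_ne_zero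
  obtain ⟨M, hM⟩ := hφ.continuous.bounded_above_of_compact_support hc
  set χ : V → ℝ := (tsupport φ).indicator fun _ => 1
  set κ : V → ℝ := fun x => gagliardoProfile N s ((L : ℝ) ^ 2) ((2 * M) ^ 2) ‖x‖
  have hκ : Integrable κ volume :=
    integrable_gagliardoProfile_norm hs0 hs1 hN (by positivity) (by positivity)
  have hsnd : Integrable (fun z : V × V => χ z.2 * κ (z.1 - z.2)) (volume.prod volume) :=
    integrable_indicator_snd_mul_comp_sub (isClosed_tsupport φ).measurableSet
      hc.isCompact.measure_lt_top.ne hκ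
  have hfst : Integrable (fun z : V × V => χ z.1 * κ (z.1 - z.2)) (volume.prod volume) := by
    refine hsnd.swap.congr (ae_of_all _ fun z => ?_)
    simp only [Function.comp_apply, Prod.fst_swap, Prod.snd_swap, κ, norm_sub_rev z.2 z.1]
  have hmeas : AEStronglyMeasurable φ (volume : Measure V) := hφ.continuous.aestronglyMeasurable
  rw [memLp_diffQuot_iff N s hmeas, gagliardoIntegrand_self, Measure.volume_eq_prod]
  refine Integrable.mono' (hfst.add hsnd)
    ((aestronglyMeasurable_diffQuot N s hmeas).pow 2) (ae_of_all _ fun z => ?_)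
  have hle : diffQuot N s φ z ^ 2 ≤ κ (z.1 - z.2) := diffQuot_sq_le_gagliardoProfile hL hM z
  have hχ (x : V) : 0 ≤ χ x := indicator_nonneg (fun _ _ => zero_le_one) x
  rw [Real.norm_of_nonneg (sq_nonneg _), Pi.add_apply, ← add_mul]
  by_cases hz : z.1 ∈ tsupport φ ∨ z.2 ∈ tsupport φ
  · have hone : 1 ≤ χ z.1 + χ z.2 := by
      rcases hz with hz | hz
      · linarith [hχ z.2, show χ z.1 = 1 from indicator_of_mem hz _]
      · linarith [hχ z.1, show χ z.2 = 1 from indicator_of_mem hz _]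
    exact hle.trans (le_mul_of_one_le_left ((sq_nonneg _).trans hle) hone)
  · obtain ⟨hz₁, hz₂⟩ := not_or.1 hz
    rw [diffQuot_sq, image_eq_zero_of_notMem_tsupport hz₁, image_eq_zero_of_notMem_tsupport hz₂,
      sub_zero, zero_pow two_ne_zero, zero_div]
    exact mul_nonneg (add_nonneg (hχ _) (hχ _)) ((sq_nonneg _).trans hle)

variable {hs : 0 < s} {hN : 2 * s < N}

lemma exists_testFunction (hs1 : s < 1) {φ : V → ℝ} (hφ : ContDiff ℝ 1 φ)
    (hc : HasCompactSupport φ) :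
    ∃ u : HDot hs hN, (u : GagliardoSpace hs hN) ∈ testFunctions hs hN ∧ u.fn =ᵐ[volume] φ := by
  have hN0 : 0 < N := Nat.cast_pos.1 (show (0 : ℝ) < N by linarith)
  have hLp : MemLp φ (ENNReal.ofReal (critExp N s)) volume :=
    hφ.continuous.memLp_of_hasCompactSupport hc
  have hmem : hLp.toLp φ ∈ gagliardoSubmodule N s :=
    (memLp_diffQuot_iff N s (Lp.aestronglyMeasurable _)).1
      ((memLp_congr_ae (diffQuot_congr N s hLp.coeFn_toLp)).2
        (memLp_diffQuot_of_contDiff hs hs1 hN0 hφ hc))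
  have htest : (⟨hLp.toLp φ, hmem⟩ : gagliardoSubmodule N s) ∈ testFunctions hs hN :=
    ⟨φ, hφ, hc, hLp.coeFn_toLp⟩
  exact ⟨⟨_, subset_closure htest⟩, htest, hLp.coeFn_toLp⟩

lemma HDot.dense_testFunctions :
    Dense {u : HDot hs hN | (u : GagliardoSpace hs hN) ∈ testFunctions hs hN} := by
  refine Subtype.dense_iff.2 fun u hu => ?_
  have hsub : (testFunctions hs hN : Set (GagliardoSpace hs hN)) ⊆
      Subtype.val '' {u : HDot hs hN | (u : GagliardoSpace hs hN) ∈ testFunctions hs hN} :=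
    fun v hv => ⟨⟨v, subset_closure hv⟩, hv, rfl⟩
  exact closure_mono hsub hu

end TestFunctions

/-! ### The homogeneous space as an energy space -/

/-- A `C¹` substitute for the negative part: nondecreasing, `1`-Lipschitz, zero on `[0, ∞)` and
within bounded distance of the identity on `(-∞, 0]`. Unlike the negative part, it maps `C_c^1` to
itself. -/
def softNeg (t : ℝ) : ℝ := ∫ τ in (0 : ℝ)..t, min 1 (max (-τ) 0)

lemma hasDerivAt_softNeg (t : ℝ) : HasDerivAt softNeg (min 1 (max (-t) 0)) t :=
  (Continuous.integral_hasStrictDerivAt (by fun_prop) 0 t).hasDerivAt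

lemma contDiff_softNeg : ContDiff ℝ 1 softNeg := by
  refine contDiff_one_iff_deriv.2 ⟨fun t => (hasDerivAt_softNeg t).differentiableAt, ?_⟩
  rw [show deriv softNeg = _ from funext fun t => (hasDerivAt_softNeg t).deriv]
  fun_prop

lemma monotone_softNeg : Monotone softNeg :=
  monotone_of_hasDerivAt_nonneg hasDerivAt_softNeg fun t => by positivity

lemma monotone_sub_softNeg : Monotone fun t => t - softNeg t :=
  monotone_of_hasDerivAt_nonneg (fun t => (hasDerivAt_id t).sub (hasDerivAt_softNeg t))
    fun _ => sub_nonneg.2 (min_le_left _ _)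

lemma softNeg_of_nonneg {t : ℝ} (ht : 0 ≤ t) : softNeg t = 0 := by
  refine intervalIntegral.integral_zero_ae (ae_of_all _ fun τ hτ => ?_)
  rw [uIoc_of_le ht] at hτ
  rw [max_eq_right (by linarith [hτ.1]), min_eq_right zero_le_one]

lemma softNeg_nonpos (t : ℝ) : softNeg t ≤ 0 :=
  (monotone_softNeg (le_max_left t 0)).trans_eq (softNeg_of_nonneg (le_max_right t 0))

lemma softNeg_le_add_one (t : ℝ) : softNeg t ≤ t + 1 := by
  rcases le_total (-1) t with ht | ht
  · linarith [softNeg_nonpos t]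
  · have hint (a b : ℝ) : IntervalIntegrable (fun τ : ℝ => min 1 (max (-τ) 0)) volume a b :=
      Continuous.intervalIntegrable (by fun_prop) a b
    have hadd : softNeg t + ∫ τ in t..-1, min 1 (max (-τ) 0) = softNeg (-1) :=
      intervalIntegral.integral_add_adjacent_intervals (hint 0 t) (hint t (-1))
    have hone : ∫ τ in t..-1, min 1 (max (-τ) 0) = -1 - t := by
      rw [intervalIntegral.integral_congr (g := fun _ => 1) fun τ hτ => ?_,
        intervalIntegral.integral_const, smul_eq_mul, mul_one]
      rw [uIcc_of_le ht] at hτ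
      exact min_eq_left (le_max_of_le_left (by linarith [hτ.2]))
    linarith [softNeg_nonpos (-1)]

lemma softNeg_sub_sq_le (a b : ℝ) :
    (softNeg a - softNeg b) * (softNeg a - softNeg b) ≤ (a - b) * (softNeg a - softNeg b) := by
  rcases le_total a b with h | h <;> nlinarith [monotone_softNeg h, monotone_sub_softNeg h]

namespace HDot

variable {N : ℕ} {s : ℝ} {hs : 0 < s} {hN : 2 * s < N}

lemma memLp_fn (u : HDot hs hN) : MemLp u.fn (ENNReal.ofReal (critExp N s)) volume := Lp.memLp _

lemma fn_add (u v : HDot hs hN) : (u + v).fn =ᵐ[volume] u.fn + v.fn :=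
  GagliardoSpace.coe_add _ _

lemma fn_smul (c : ℝ) (u : HDot hs hN) : (c • u).fn =ᵐ[volume] c • u.fn :=
  GagliardoSpace.coe_smul _ _

/-- The restriction of `GagliardoSpace.quot` to the homogeneous space. -/
def quot : HDot hs hN →L[ℝ]
    Lp ℝ 2 (volume : Measure (EuclideanSpace ℝ (Fin N) × EuclideanSpace ℝ (Fin N))) :=
  GagliardoSpace.quot ∘L Submodule.subtypeL _

lemma quot_ae_eq {u : HDot hs hN} {φ : EuclideanSpace ℝ (Fin N) → ℝ} (h : u.fn =ᵐ[volume] φ) :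
    quot u =ᵐ[volume] diffQuot N s φ :=
  (GagliardoSpace.quot_coe (u : GagliardoSpace hs hN)).trans (diffQuot_congr N s h)

/-- The Gagliardo form as a continuous bilinear form. -/
def form : HDot hs hN →L[ℝ] HDot hs hN →L[ℝ] ℝ := (innerSL ℝ).bilinearComp quot quot

lemma form_eq_inner (u v : HDot hs hN) : form u v = inner ℝ (quot u) (quot v) := rfl

lemma form_apply (u v : HDot hs hN) : form u v = gagliardoForm N s u.fn v.fn :=
  GagliardoSpace.inner_quot (u : GagliardoSpace hs hN) v

lemma form_self (u : HDot hs hN) : form u u = gagliardoSeminorm N s u.fn ^ 2 := by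
  rw [form_eq_inner, real_inner_self_eq_norm_sq]
  congr 1
  exact GagliardoSpace.norm_quot (u : GagliardoSpace hs hN)

variable (hs hN) in
lemma exists_lower : ∃ l > 0, ∀ u : HDot hs hN, l * ‖u‖ ^ 2 ≤ form u u := by
  obtain ⟨C, hC, h⟩ := GagliardoSpace.exists_norm_le_seminorm hs hN
  refine ⟨(C ^ 2)⁻¹, by positivity, fun u => ?_⟩
  rw [inv_mul_le_iff₀ (by positivity), form_self, ← mul_pow]
  exact pow_le_pow_left₀ (norm_nonneg _) (h (u : GagliardoSpace hs hN)) 2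

lemma exists_softNeg (hs1 : s < 1) {u : HDot hs hN}
    (hu : (u : GagliardoSpace hs hN) ∈ testFunctions hs hN) :
    ∃ v : HDot hs hN, v.fn =ᵐ[volume] softNeg ∘ u.fn ∧ form v v ≤ form u v := by
  obtain ⟨φ, hφ, hφc, huφ⟩ := hu
  have huφ' : u.fn =ᵐ[volume] φ := huφ
  obtain ⟨v, -, hv⟩ := exists_testFunction (hs := hs) (hN := hN) hs1
    (φ := softNeg ∘ φ) (contDiff_softNeg.comp hφ)
    (hφc.comp_left (g := softNeg) (softNeg_of_nonneg le_rfl))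
  refine ⟨v, hv.trans (huφ'.fun_comp softNeg).symm, ?_⟩
  rw [form_eq_inner, form_eq_inner, L2.inner_def, L2.inner_def]
  refine integral_mono_ae (L2.integrable_inner _ _) (L2.integrable_inner _ _) ?_
  filter_upwards [quot_ae_eq huφ', quot_ae_eq hv] with z hu hv
  rw [hu, hv]
  simp only [diffQuot, RCLike.inner_apply, conj_trivial, Function.comp_apply]
  rw [div_mul_div_comm, div_mul_div_comm, mul_comm (softNeg _ - softNeg _) (φ _ - φ _)]
  exact div_le_div_of_nonneg_right (softNeg_sub_sq_le _ _) (by positivity)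

variable {μ : Measure (EuclideanSpace ℝ (Fin N))} {c : ENNReal}

lemma memLp_fn_weight (hc : c ≠ ⊤) (hμ : μ ≤ c • volume) (u : HDot hs hN) :
    MemLp u.fn (ENNReal.ofReal (critExp N s)) μ :=
  (memLp_fn u).of_measure_le_smul hc hμ

lemma norm_toLp_fn_weight_le (hc : c ≠ ⊤) (hμ : μ ≤ c • volume) (u : HDot hs hN) :
    ‖(memLp_fn_weight hc hμ u).toLp‖ ≤
      (c ^ (1 / ENNReal.ofReal (critExp N s)).toReal).toReal * ‖u‖ := by
  have hu : ‖GagliardoSpace.toLp (u : GagliardoSpace hs hN)‖ ≤ ‖u‖ :=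
    GagliardoSpace.norm_toLp_le_norm _
  rw [Lp.norm_toLp]
  refine le_trans ?_ (mul_le_mul_of_nonneg_left hu ENNReal.toReal_nonneg)
  rw [Lp.norm_def, ← ENNReal.toReal_mul]
  exact ENNReal.toReal_mono (ENNReal.mul_ne_top (by finiteness) (memLp_fn u).2.ne)
    (eLpNorm_le_of_le_smul hμ ENNReal.ofReal_ne_top _)

/-- The embedding of the homogeneous space into a weighted Lebesgue space. -/
def embWeight [Fact (1 < critExp N s)] (hc : c ≠ ⊤) (hμ : μ ≤ c • volume) :
    HDot hs hN →L[ℝ] Lp ℝ (ENNReal.ofReal (critExp N s)) μ :=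
  LinearMap.mkContinuous
    { toFun := fun u => (memLp_fn_weight hc hμ u).toLp
      map_add' := fun u v => by
        rw [← MemLp.toLp_add, MemLp.toLp_eq_toLp_iff]
        exact (Measure.absolutelyContinuous_of_le_smul hμ).ae_eq (fn_add u v)
      map_smul' := fun a u => by
        rw [RingHom.id_apply, ← MemLp.toLp_const_smul, MemLp.toLp_eq_toLp_iff]
        exact (Measure.absolutelyContinuous_of_le_smul hμ).ae_eq (fn_smul a u) }
    (c ^ (1 / ENNReal.ofReal (critExp N s)).toReal).toReal (norm_toLp_fn_weight_le hc hμ)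

lemma embWeight_coe [Fact (1 < critExp N s)] (hc : c ≠ ⊤) (hμ : μ ≤ c • volume)
    (u : HDot hs hN) : embWeight hc hμ u =ᵐ[μ] u.fn :=
  (memLp_fn_weight hc hμ u).coeFn_toLp

lemma exists_trunc [Fact (1 < critExp N s)] (hs1 : s < 1) (hc : c ≠ ⊤) (hμ : μ ≤ c • volume)
    {u : HDot hs hN} (hu : (u : GagliardoSpace hs hN) ∈ testFunctions hs hN) :
    ∃ v : HDot hs hN, (∀ᵐ x ∂μ, embWeight hc hμ v x ≤ embWeight hc hμ u x + 1 ∧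
      (embWeight hc hμ v x = 0 ∨ embWeight hc hμ u x ≤ 0)) ∧ form v v ≤ form u v := by
  obtain ⟨v, hv, hform⟩ := exists_softNeg hs1 hu
  refine ⟨v, ?_, hform⟩
  filter_upwards [embWeight_coe hc hμ u, embWeight_coe hc hμ v,
    (Measure.absolutelyContinuous_of_le_smul hμ).ae_eq hv] with x hux hvx hvu
  rw [hux, hvx, hvu, Function.comp_apply]
  exact ⟨softNeg_le_add_one _, (le_total 0 (u.fn x)).imp softNeg_of_nonneg id⟩

variable (hs hN) in
/-- The homogeneous fractional Sobolev space is an energy space for finite measures with bounded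
density. -/
def energySpace [IsFiniteMeasure μ] [Fact (1 < critExp N s)] (hs1 : s < 1) (hc : c ≠ ⊤)
    (hμ : μ ≤ c • volume) : EnergySpace (HDot hs hN) μ (critExp N s) where
  form := form
  form_symm u v := by rw [form_eq_inner, form_eq_inner, real_inner_comm]
  lower := (exists_lower hs hN).choose
  lower_pos := (exists_lower hs hN).choose_spec.1
  le_form := (exists_lower hs hN).choose_spec.2
  emb := embWeight hc hμ
  exists_ae_tendsto w M hM := by
    obtain ⟨k, hk, v, hv⟩ := exists_subseq_ae_tendsto hs hc hμ
      (fun n => GagliardoSpace.toLp (w n : GagliardoSpace hs hN))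
      (fun n => (GagliardoSpace.norm_toLp_le_norm _).trans (hM n))
      (fun n => GagliardoSpace.eLpNorm_diffQuot_le (hM n))
    refine ⟨k, hk, v, ?_⟩
    filter_upwards [hv, ae_all_iff.2 fun n => embWeight_coe hc hμ (w n)] with x hx hcoe
    exact hx.congr fun n => (hcoe (k n)).symm
  exists_trunc := ⟨_, dense_testFunctions, fun _ hu => exists_trunc hs1 hc hμ hu⟩

end HDot

/-! ### Mountain pass geometry -/

lemma exists_pos_mul_rpow_le {m : ℝ} (hm : 2 < m) (C : ℝ) {ε : ℝ} (hε : 0 < ε) :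
    ∃ r > 0, C * r ^ m ≤ ε * r ^ 2 := by
  have hlim : Tendsto (fun r : ℝ => C * r ^ (m - 2)) (𝓝[>] 0) (𝓝 (C * 0 ^ (m - 2))) :=
    ((Real.continuousAt_rpow_const 0 (m - 2) (Or.inr (by linarith))).tendsto.const_mul
      C).mono_left nhdsWithin_le_nhds
  rw [Real.zero_rpow (by linarith), mul_zero] at hlim
  obtain ⟨r, hrε, hr⟩ := ((hlim.eventually_le_const hε).and self_mem_nhdsWithin).exists
  refine ⟨r, hr, ?_⟩
  calc C * r ^ m = C * r ^ (m - 2) * r ^ 2 := by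
        rw [mul_assoc, ← Real.rpow_two, ← Real.rpow_add hr, sub_add_cancel]
    _ ≤ ε * r ^ 2 := by gcongr

lemma integral_abs_rpow_eq_lpNorm_rpow {α : Type*} [MeasurableSpace α] {μ : Measure α} {m : ℝ}
    (hm : 0 < m) {u : α → ℝ} (hu : AEStronglyMeasurable u μ) :
    ∫ x, |u x| ^ m ∂μ = lpNorm u (ENNReal.ofReal m) μ ^ m := by
  rw [lpNorm_eq_integral_norm_rpow_toReal (ENNReal.ofReal_pos.2 hm).ne' ENNReal.ofReal_ne_top hu,
    ENNReal.toReal_ofReal hm.le, ← Real.rpow_mul (integral_nonneg fun x => by positivity),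
    inv_mul_cancel₀ hm.ne', Real.rpow_one]
  rfl

namespace EnergySpace

variable {E : Type*} [NormedAddCommGroup E] [NormedSpace ℝ E] {α : Type*}
    [MeasurableSpace α] {μ : Measure α} {p : ℝ} [Fact (1 < p)] (S : EnergySpace E μ p) {γ : ℝ}
    {f F : ℝ → ℝ}

lemma le_iSup_path_of_sphere {I : E → ℝ} (hI : Continuous I) {ρ β : ℝ}
    (h : ∀ v, S.form v v = ρ ^ 2 → β ≤ I v) {e : E} (he : ρ ^ 2 < S.form e e)
    (q : Path (0 : E) e) : β ≤ ⨆ t, I (q t) := by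
  have hcont : Continuous fun t => S.form (q t) (q t) :=
    (S.form.continuous.comp q.continuous).clm_apply q.continuous
  obtain ⟨t, ht⟩ := mem_range_of_exists_le_of_exists_ge hcont (c := ρ ^ 2)
    ⟨0, by rw [q.source, map_zero]; positivity⟩ ⟨1, by rw [q.target]; exact he.le⟩
  exact (h _ ht).trans (le_ciSup (isCompact_range (hI.comp q.continuous)).bddAbove t)

variable [IsFiniteMeasure μ]

lemma integrable_abs_emb_rpow {m : ℝ} (hm : 0 < m) (hmp : m ≤ p) (u : E) :
    Integrable (fun x => |S.emb u x| ^ m) μ :=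
  have hgrowth : PowerGrowth (fun t => |t| ^ m) m := ⟨1, zero_le_one, fun t => by
    rw [abs_of_nonneg (by positivity)]
    linarith⟩
  hgrowth.integrable_comp (continuous_abs.rpow_const fun _ => Or.inr hm.le) hm hmp
    (Lp.memLp (S.emb u))

lemma exists_integral_abs_emb_rpow_le {m : ℝ} (hm : 0 < m) (hmp : m ≤ p) :
    ∃ C ≥ 0, ∀ u, ∫ x, |S.emb u x| ^ m ∂μ ≤ C * ‖u‖ ^ m := by
  set e : ℝ := 1 / (ENNReal.ofReal m).toReal - 1 / (ENNReal.ofReal p).toReal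
  have he : 0 ≤ e := by
    simp only [e]
    rw [ENNReal.toReal_ofReal hm.le, ENNReal.toReal_ofReal (hm.le.trans hmp), sub_nonneg]
    exact one_div_le_one_div_of_le hm hmp
  refine ⟨(‖S.emb‖ * (μ univ ^ e).toReal) ^ m, by positivity, fun u => ?_⟩
  have hmeas : AEStronglyMeasurable (S.emb u) μ := Lp.aestronglyMeasurable _
  have hnorm : lpNorm (S.emb u) (ENNReal.ofReal m) μ ≤ ‖S.emb‖ * (μ univ ^ e).toReal * ‖u‖ := by
    have hholder := ENNReal.toReal_mono (ENNReal.mul_ne_top (Lp.memLp (S.emb u)).2.ne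
      (ENNReal.rpow_ne_top_of_nonneg he (measure_ne_top μ univ)))
      (eLpNorm_le_eLpNorm_mul_rpow_measure_univ (ENNReal.ofReal_le_ofReal hmp) hmeas)
    rw [ENNReal.toReal_mul, ← Lp.norm_def, toReal_eLpNorm hmeas] at hholder
    refine hholder.trans ?_
    rw [mul_right_comm]
    gcongr
    exact S.emb.le_opNorm u
  rw [integral_abs_rpow_eq_lpNorm_rpow hm hmeas, ← Real.mul_rpow (by positivity) (norm_nonneg _)]
  exact Real.rpow_le_rpow lpNorm_nonneg hnorm hm.le

lemma exists_pot_le (hf : IsNonlinearity p γ f F) {ε : ℝ} (hε : 0 < ε) :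
    ∃ C, 0 ≤ C ∧ ∀ u, S.pot F u ≤ ε * ‖u‖ ^ 2 + C * ‖u‖ ^ γ := by
  have hγ := hf.two_lt
  have hγp := hf.lt_crit
  obtain ⟨c₂, hc₂, h₂⟩ := S.exists_integral_abs_emb_rpow_le two_pos (hγ.trans hγp).le
  obtain ⟨cγ, hcγ, hγ⟩ := S.exists_integral_abs_emb_rpow_le (m := γ) (by linarith) hγp.le
  obtain ⟨C, hC, hF⟩ := hf.prim_le (ε / (c₂ + 1)) (by positivity)
  refine ⟨C * cγ, by positivity, fun u => ?_⟩
  have hint₂ := (S.integrable_abs_emb_rpow two_pos (by linarith) u).const_mul (ε / (c₂ + 1))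
  have hintγ := (S.integrable_abs_emb_rpow (m := γ) (by linarith) hγp.le u).const_mul C
  calc S.pot F u
      ≤ ∫ x, (ε / (c₂ + 1) * |S.emb u x| ^ (2 : ℝ) + C * |S.emb u x| ^ γ) ∂μ := by
        refine integral_mono (S.integrable_pot hf u) (hint₂.add hintγ) fun x => ?_
        simpa only [Real.rpow_two, sq_abs] using hF (S.emb u x)
    _ = ε / (c₂ + 1) * ∫ x, |S.emb u x| ^ (2 : ℝ) ∂μ + C * ∫ x, |S.emb u x| ^ γ ∂μ := by
        rw [integral_add hint₂ hintγ, integral_const_mul, integral_const_mul]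
    _ ≤ ε / (c₂ + 1) * ((c₂ + 1) * ‖u‖ ^ 2) + C * (cγ * ‖u‖ ^ γ) := by
        gcongr
        · refine (h₂ u).trans ?_
          rw [Real.rpow_two]
          gcongr
          linarith
        · exact hγ u
    _ = ε * ‖u‖ ^ 2 + C * cγ * ‖u‖ ^ γ := by field_simp

lemma exists_le_action (hf : IsNonlinearity p γ f F) : ∃ a₁ > 0, ∃ ρ > 0, ∃ β > 0,
    ∀ a ∈ Ioo 0 a₁, ∀ v, S.form v v = ρ ^ 2 → β ≤ S.action F a v := by
  have hl := S.lower_pos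
  obtain ⟨C, hC, hpot⟩ := S.exists_pot_le hf (ε := S.lower / 8) (by positivity)
  obtain ⟨r, hr, hCr⟩ := exists_pos_mul_rpow_le hf.two_lt C (ε := S.lower / 8) (by positivity)
  refine ⟨S.lower * r / (8 * (‖S.mass‖ + 1)), by positivity, √S.lower * r, by positivity,
    S.lower * r ^ 2 / 8, by positivity, fun a ha v hv => ?_⟩
  rw [mul_pow, Real.sq_sqrt hl.le] at hv
  have hvr : ‖v‖ ≤ r := (sq_le_sq₀ (norm_nonneg v) hr.le).1
    (le_of_mul_le_mul_left ((S.le_form v).trans_eq hv) hl)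
  have hpot_v : S.pot F v ≤ S.lower / 8 * r ^ 2 + S.lower / 8 * r ^ 2 := by
    refine (hpot v).trans (add_le_add ?_ (le_trans ?_ hCr))
    · gcongr
    · have := hf.two_lt
      gcongr
  have hmass : |a * S.mass v| ≤ S.lower * r ^ 2 / 8 :=
    calc |a * S.mass v|
        ≤ S.lower * r / (8 * (‖S.mass‖ + 1)) * ‖S.mass‖ * ‖v‖ :=
          S.abs_mul_mass_le ha.1.le ha.2.le v
      _ ≤ S.lower * r / (8 * (‖S.mass‖ + 1)) * (‖S.mass‖ + 1) * r := by
          gcongr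
          linarith
      _ = S.lower * r ^ 2 / 8 := by field_simp
  rw [action, hv]
  linarith [(abs_le.1 hmass).1]

lemma integral_posPart_sq_pos (hp : 2 ≤ p) {u : E} (hu : ¬ ∀ᵐ x ∂μ, S.emb u x ≤ 0) :
    0 < ∫ x, (max (S.emb u x) 0) ^ 2 ∂μ := by
  refine (integral_nonneg fun x => sq_nonneg _).lt_of_ne fun h => hu ?_
  have hzero := (integral_eq_zero_iff_of_nonneg (fun x => sq_nonneg _)
    (S.integrable_posPart_sq_emb hp u)).1 h.symm
  filter_upwards [hzero] with x hx
  exact max_eq_right_iff.1 (pow_eq_zero_iff two_ne_zero |>.1 hx)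

lemma exists_action_smul_le_sub_sq (hf : IsNonlinearity p γ f F) {u : E}
    (hu : ¬ ∀ᵐ x ∂μ, S.emb u x ≤ 0) :
    ∃ C, 0 ≤ C ∧ ∀ a ∈ Icc 0 1, ∀ T ≥ 0,
      S.action F a (T • u) ≤ ‖S.mass‖ * ‖u‖ * T + C - T ^ 2 := by
  have hq := S.integral_posPart_sq_pos (hf.two_lt.trans hf.lt_crit).le hu
  set q := ∫ x, (max (S.emb u x) 0) ^ 2 ∂μ
  obtain ⟨C, hC, hF⟩ := hf.superlinear ((‖S.form‖ / 2 * ‖u‖ ^ 2 + 1) / q)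
  refine ⟨C * μ.real univ, by positivity, fun a ha T hT => ?_⟩
  have hpot := S.mul_integral_posPart_sq_le_pot hf hC hF (T • u)
  rw [S.integral_posPart_sq_emb_smul hT] at hpot
  have hquad : (‖S.form‖ / 2 * ‖u‖ ^ 2 + 1) / q * (T ^ 2 * q) =
      ‖S.form‖ / 2 * (T * ‖u‖) ^ 2 + T ^ 2 := by field_simp
  have haction := S.action_le (F := F) ha.1 ha.2 (T • u)
  rw [norm_smul, Real.norm_of_nonneg hT] at haction
  linarith

lemma exists_action_neg (hf : IsNonlinearity p γ f F) {u : E} (hu : ¬ ∀ᵐ x ∂μ, S.emb u x ≤ 0)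
    (ρ : ℝ) : ∃ e, ρ ^ 2 < S.form e e ∧ ∀ a ∈ Icc 0 1, S.action F a e < 0 := by
  have hu0 : u ≠ 0 := by
    rintro rfl
    refine hu ?_
    rw [map_zero]
    exact (Lp.coeFn_zero _ _ _).le
  have hform : 0 < S.form u u :=
    (mul_pos S.lower_pos (by positivity)).trans_le (S.le_form u)
  obtain ⟨C, hC, hle⟩ := S.exists_action_smul_le_sub_sq hf hu
  set k := ‖S.mass‖ * ‖u‖
  have hk : 0 ≤ k := by positivity
  set T := 1 + k + C + ρ ^ 2 / S.form u u
  have hkT : 1 + k + C ≤ T := le_add_of_nonneg_right (by positivity)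
  have hρT : ρ ^ 2 / S.form u u < T := lt_add_of_pos_left _ (by positivity)
  refine ⟨T • u, ?_, fun a ha => (hle a ha T (by linarith)).trans_lt ?_⟩
  · simp only [map_smul, smul_apply, smul_eq_mul]
    rw [div_lt_iff₀ hform] at hρT
    nlinarith [mul_pos (by linarith : 0 < T) hform]
  · nlinarith

lemma action_le_action_zero_add {a : ℝ} (ha0 : 0 ≤ a) (ha1 : a ≤ 1) (u : E) :
    S.action F a u ≤ S.action F 0 u + |S.mass u| := by
  have hmass : a * S.mass u ≤ |S.mass u| :=
    (mul_le_mul_of_nonneg_left (le_abs_self _) ha0).trans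
      (mul_le_of_le_one_left (abs_nonneg _) ha1)
  rw [action, action]
  linarith

lemma exists_critical_of_sphere [CompleteSpace E] (hf : IsNonlinearity p γ f F) {a : ℝ}
    (ha : 0 ≤ a) {ρ β : ℝ} (hβ : 0 < β) (hsphere : ∀ v, S.form v v = ρ ^ 2 → β ≤ S.action F a v)
    {e : E} (he : ρ ^ 2 < S.form e e) (hneg : S.action F a e < 0) :
    ∃ u, β ≤ S.action F a u ∧ S.dAction hf a u = 0 ∧
      IsGLB (range fun q : Path (0 : E) e => ⨆ t, S.action F a (q t)) (S.action F a u) := by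
  have hlow := S.le_iSup_path_of_sphere (S.contDiff_action hf a).continuous hsphere he
  have : Nonempty (Path (0 : E) e) := PathConnectedSpace.joined 0 e
  have hglb := isGLB_ciInf (f := fun q : Path (0 : E) e => ⨆ t, S.action F a (q t))
    ⟨β, forall_mem_range.2 hlow⟩
  have hc := hβ.trans_le (le_ciInf hlow)
  obtain ⟨u, hu, hcrit⟩ := S.exists_critical_of_mountainPass hf ha hglb hc (hneg.trans hc)
  rw [← hu] at hglb
  exact ⟨u, hglb.2 (forall_mem_range.2 hlow), hcrit, hglb⟩

theorem exists_mountainPass [CompleteSpace E] (hf : IsNonlinearity p γ f F) {u₀ : E}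
    (hu₀ : ¬ ∀ᵐ x ∂μ, S.emb u₀ x ≤ 0) :
    ∃ a₁ > 0, ∃ ρ > 0, ∃ β > 0, ∃ e, ∃ C > 0, ρ ^ 2 < S.form e e ∧ ∀ a ∈ Ioo 0 a₁,
      (∀ v, S.form v v = ρ ^ 2 → β ≤ S.action F a v) ∧ S.action F a e < 0 ∧
      ∃ u, β ≤ S.action F a u ∧ ‖u‖ ≤ C ∧ S.dAction hf a u = 0 ∧
        IsGLB (range fun q : Path (0 : E) e => ⨆ t, S.action F a (q t)) (S.action F a u) := by
  obtain ⟨a₁, ha₁, ρ, hρ, β, hβ, hsphere⟩ := S.exists_le_action hf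
  obtain ⟨e, he, hneg⟩ := S.exists_action_neg hf hu₀ ρ
  obtain ⟨q₀⟩ : Nonempty (Path (0 : E) e) := PathConnectedSpace.joined 0 e
  have hbdd := (isCompact_range (((S.contDiff_action hf 0).continuous.add
    S.mass.continuous.abs).comp q₀.continuous)).bddAbove
  set Λ := ⨆ t, (S.action F 0 (q₀ t) + |S.mass (q₀ t)|)
  obtain ⟨C, hC, hbound⟩ := S.exists_norm_bound hf 1 Λ
  refine ⟨min a₁ 1, by positivity, ρ, hρ, β, hβ, e, C, hC, he, fun a ha => ?_⟩
  have ha1 : a ≤ 1 := (ha.2.trans_le (min_le_right _ _)).le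
  have hsphere_a := hsphere a ⟨ha.1, ha.2.trans_le (min_le_left _ _)⟩
  have hneg_a := hneg a ⟨ha.1.le, ha1⟩
  obtain ⟨u, hβu, hcrit, hglb⟩ := S.exists_critical_of_sphere hf ha.1.le hβ hsphere_a he hneg_a
  have huΛ : S.action F a u ≤ Λ := (hglb.1 (mem_range_self q₀)).trans
    (ciSup_mono hbdd fun t => S.action_le_action_zero_add ha.1.le ha1 (q₀ t))
  have hΛ : 0 ≤ Λ := hβ.le.trans (hβu.trans huΛ)
  refine ⟨hsphere_a, hneg_a, u, hβu, hbound a ha.1.le ha1 u ?_ ?_, hcrit, hglb⟩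
  · rwa [abs_of_pos (hβ.trans_le hβu)]
  · rwa [hcrit, norm_zero, zero_mul]

end EnergySpace

/-! ### The nonlinearity -/

/-- The extension of `f` to the negative half-line by the constant `f 0`, which is `0` in the
application. -/
def extendLeft (f : ℝ → ℝ) (t : ℝ) : ℝ := f (max t 0)

/-- The primitive of `extendLeft f` vanishing at `0`: the function `F_a` of the problem is
`primitiveLeft f t - a * t`. -/
def primitiveLeft (f : ℝ → ℝ) (t : ℝ) : ℝ := ∫ τ in (0 : ℝ)..t, extendLeft f τ

lemma exists_le_add_of_monotoneOn {H : ℝ → ℝ} {T : ℝ} (hT : 0 ≤ T)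
    (hH : ContinuousOn H (Icc 0 T)) (hmono : MonotoneOn H (Ici T)) :
    ∃ C ≥ 0, ∀ x t, 0 ≤ x → x ≤ t → H x ≤ H t + C := by
  obtain ⟨B, hB⟩ := isCompact_Icc.exists_bound_of_continuousOn hH
  have hB0 : 0 ≤ B := (norm_nonneg _).trans (hB 0 ⟨le_rfl, hT⟩)
  have hlower {t : ℝ} (ht : 0 ≤ t) : -B ≤ H t := by
    rcases le_total t T with htT | htT
    · exact (abs_le.1 (hB t ⟨ht, htT⟩)).1
    · exact (abs_le.1 (hB T ⟨hT, le_rfl⟩)).1.trans (hmono self_mem_Ici htT htT)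
  refine ⟨2 * B, by positivity, fun x t hx hxt => ?_⟩
  rcases le_total x T with hxT | hxT
  · linarith [(abs_le.1 (hB x ⟨hx, hxT⟩)).2, hlower (hx.trans hxt)]
  · linarith [hmono hxT (hxT.trans hxt) hxt]

section ExtendLeft

variable {f : ℝ → ℝ}

lemma extendLeft_of_nonneg {t : ℝ} (ht : 0 ≤ t) : extendLeft f t = f t := by
  rw [extendLeft, max_eq_left ht]

lemma extendLeft_of_nonpos (hf0 : f 0 = 0) {t : ℝ} (ht : t ≤ 0) : extendLeft f t = 0 := by
  rw [extendLeft, max_eq_right ht, hf0]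

lemma continuous_extendLeft (hfc : ContinuousOn f (Ici 0)) : Continuous (extendLeft f) :=
  hfc.comp_continuous (by fun_prop) fun t => le_max_right t 0

lemma primitiveLeft_zero : primitiveLeft f 0 = 0 := intervalIntegral.integral_same

lemma primitiveLeft_of_nonpos (hf0 : f 0 = 0) {t : ℝ} (ht : t ≤ 0) : primitiveLeft f t = 0 := by
  refine intervalIntegral.integral_zero_ae (ae_of_all _ fun τ hτ => ?_)
  rw [uIoc_of_ge ht] at hτ
  exact extendLeft_of_nonpos hf0 hτ.2

lemma hasDerivAt_primitiveLeft (hfc : ContinuousOn f (Ici 0)) (t : ℝ) :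
    HasDerivAt (primitiveLeft f) (extendLeft f t) t :=
  ((continuous_extendLeft hfc).integral_hasStrictDerivAt 0 t).hasDerivAt

lemma continuous_primitiveLeft (hfc : ContinuousOn f (Ici 0)) : Continuous (primitiveLeft f) :=
  continuous_iff_continuousAt.2 fun t => (hasDerivAt_primitiveLeft hfc t).continuousAt

lemma hasDerivAt_primitiveLeft_sub_mul_sq (hfc : ContinuousOn f (Ici 0)) (M t : ℝ) :
    HasDerivAt (fun t => primitiveLeft f t - M * t ^ 2) (extendLeft f t - M * (2 * t)) t := by
  have hsq : HasDerivAt (fun t : ℝ => t ^ 2) (2 * t) t := by simpa using hasDerivAt_pow 2 t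
  exact (hasDerivAt_primitiveLeft hfc t).sub (hsq.const_mul M)

lemma continuous_primitiveLeft_sub_mul_sq (hfc : ContinuousOn f (Ici 0)) (M : ℝ) :
    Continuous fun t => primitiveLeft f t - M * t ^ 2 := by
  have := continuous_primitiveLeft hfc
  fun_prop

lemma powerGrowth_extendLeft (hfc : ContinuousOn f (Ici 0)) (hf0 : f 0 = 0) {m L : ℝ}
    (hlim : Tendsto (fun t => f t / t ^ m) atTop (𝓝 L)) : PowerGrowth (extendLeft f) m := by
  obtain ⟨T, hT⟩ := eventually_atTop.1
    ((hlim.abs.eventually_lt_const (lt_add_one |L|)).and (eventually_gt_atTop 0))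
  obtain ⟨B, hB⟩ := (isCompact_Icc (a := (0 : ℝ)) (b := T)).exists_bound_of_continuousOn
    (continuous_extendLeft hfc).continuousOn
  refine ⟨|B| + (|L| + 1), by positivity, fun t => ?_⟩
  have hpow : 0 ≤ |t| ^ m := by positivity
  rcases le_total t 0 with ht | ht
  · rw [extendLeft_of_nonpos hf0 ht, abs_zero]
    positivity
  rcases le_total t T with htT | htT
  · calc |extendLeft f t| ≤ |B| := (hB t ⟨ht, htT⟩).trans (le_abs_self B)
      _ ≤ |B| + (|L| + 1) := le_add_of_nonneg_right (by positivity)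
      _ ≤ (|B| + (|L| + 1)) * (1 + |t| ^ m) :=
        le_mul_of_one_le_right (by positivity) (le_add_of_nonneg_right hpow)
  · obtain ⟨hft, ht0⟩ := hT t htT
    have htm : 0 < t ^ m := Real.rpow_pos_of_pos ht0 m
    rw [abs_div, abs_of_pos htm, div_lt_iff₀ htm] at hft
    rw [extendLeft_of_nonneg ht, abs_of_pos ht0]
    calc |f t| ≤ (|L| + 1) * t ^ m := hft.le
      _ ≤ (|B| + (|L| + 1)) * (1 + t ^ m) :=
        mul_le_mul (le_add_of_nonneg_left (abs_nonneg B)) (le_add_of_nonneg_left zero_le_one)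
          htm.le (by positivity)

lemma exists_primitiveLeft_le_mul_sq (hzero : Tendsto (fun t => f t / t) (𝓝[>] 0) (𝓝 0))
    {ε : ℝ} (hε : 0 < ε) : ∃ δ > 0, ∀ t ∈ Icc 0 δ, primitiveLeft f t ≤ ε * t ^ 2 := by
  have hev : ∀ᶠ t in 𝓝[>] (0 : ℝ), |f t / t| < ε :=
    hzero.abs.eventually_lt_const (by rwa [abs_zero])
  obtain ⟨δ, hδ, hsmall⟩ := mem_nhdsGT_iff_exists_Ioc_subset.1 hev
  refine ⟨δ, hδ, fun t ht => ?_⟩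
  have hbound : ‖∫ τ in (0 : ℝ)..t, extendLeft f τ‖ ≤ ε * t * |t - 0| := by
    refine intervalIntegral.norm_integral_le_of_norm_le_const fun τ hτ => ?_
    rw [uIoc_of_le ht.1] at hτ
    have hfτ : |f τ / τ| < ε := hsmall ⟨hτ.1, hτ.2.trans ht.2⟩
    rw [abs_div, abs_of_pos hτ.1, div_lt_iff₀ hτ.1] at hfτ
    rw [extendLeft_of_nonneg hτ.1.le]
    exact hfτ.le.trans (mul_le_mul_of_nonneg_left hτ.2 hε.le)
  rw [sub_zero, abs_of_nonneg ht.1, mul_assoc, ← sq] at hbound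
  exact (le_abs_self _).trans hbound

lemma exists_primitiveLeft_le (hf0 : f 0 = 0)
    (hzero : Tendsto (fun t => f t / t) (𝓝[>] 0) (𝓝 0)) {γ : ℝ} (hγ : 0 ≤ γ)
    (hgrowth : PowerGrowth (primitiveLeft f) γ) {ε : ℝ} (hε : 0 < ε) :
    ∃ C ≥ 0, ∀ t, primitiveLeft f t ≤ ε * t ^ 2 + C * |t| ^ γ := by
  obtain ⟨δ, hδ, hsmall⟩ := exists_primitiveLeft_le_mul_sq hzero hε
  obtain ⟨C, hC, hbound⟩ := hgrowth
  refine ⟨C * (1 / δ ^ γ + 1), by positivity, fun t => ?_⟩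
  rcases le_total t 0 with ht | ht
  · rw [primitiveLeft_of_nonpos hf0 ht]
    positivity
  rcases le_total t δ with htδ | htδ
  · exact (hsmall t ⟨ht, htδ⟩).trans (le_add_of_nonneg_right (by positivity))
  have hone : 1 ≤ 1 / δ ^ γ * |t| ^ γ := by
    rw [abs_of_nonneg ht, one_div_mul_eq_div, one_le_div (by positivity)]
    exact Real.rpow_le_rpow hδ.le htδ hγ
  calc primitiveLeft f t ≤ C * (1 + |t| ^ γ) := (le_abs_self _).trans (hbound t)
    _ ≤ C * (1 / δ ^ γ * |t| ^ γ + |t| ^ γ) := by gcongr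
    _ = C * (1 / δ ^ γ + 1) * |t| ^ γ := by ring
    _ ≤ ε * t ^ 2 + C * (1 / δ ^ γ + 1) * |t| ^ γ := le_add_of_nonneg_left (by positivity)

lemma exists_le_primitiveLeft (hfc : ContinuousOn f (Ici 0))
    (htop : Tendsto (fun t => f t / t) atTop atTop) (M : ℝ) :
    ∃ C ≥ 0, ∀ t ≥ 0, M * t ^ 2 - C ≤ primitiveLeft f t := by
  obtain ⟨T, hT⟩ := eventually_atTop.1
    ((htop.eventually_ge_atTop (2 * M)).and (eventually_gt_atTop 0))
  have hderiv := hasDerivAt_primitiveLeft_sub_mul_sq hfc M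
  have hcont := continuous_primitiveLeft_sub_mul_sq hfc M
  have hmono : MonotoneOn (fun t => primitiveLeft f t - M * t ^ 2) (Ici T) := by
    refine monotoneOn_of_hasDerivWithinAt_nonneg (convex_Ici T) hcont.continuousOn
      (fun t _ => (hderiv t).hasDerivWithinAt) fun t ht => ?_
    obtain ⟨hft, ht0⟩ := hT t (interior_subset ht)
    rw [le_div_iff₀ ht0] at hft
    rw [extendLeft_of_nonneg ht0.le]
    linarith
  obtain ⟨C, hC, hle⟩ := exists_le_add_of_monotoneOn (hT T le_rfl).2.le hcont.continuousOn hmono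
  refine ⟨C, hC, fun t ht => ?_⟩
  have hle := hle 0 t le_rfl ht
  simp only [primitiveLeft_zero] at hle
  linarith

/- For `x ≤ t` put `k = f t / t`. On `[x, t]` the function `F y - k * y ^ 2 / 2` is nonincreasing,
since its derivative `f y - k * y` is nonpositive; hence `2 * F t - k * t ^ 2` is at most
`2 * F x - k * x ^ 2`, and `k * t ^ 2 = t * f t` while `k * x ^ 2 ≥ x * f x`. -/
lemma monotoneOn_mul_sub_two_mul_primitiveLeft (hfc : ContinuousOn f (Ici 0)) {R : ℝ} (hR : 0 ≤ R)
    (hmono : MonotoneOn (fun t => f t / t) (Ioi R)) :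
    MonotoneOn (fun t => t * extendLeft f t - 2 * primitiveLeft f t) (Ioi R) := by
  intro x hx t ht hxt
  have hx0 : 0 < x := hR.trans_lt hx
  have ht0 : 0 < t := hx0.trans_le hxt
  set k := f t / t with hk
  have hle {y : ℝ} (hxy : x ≤ y) (hyt : y ≤ t) : f y ≤ k * y :=
    (div_le_iff₀ (hx0.trans_le hxy)).1 (hmono (lt_of_lt_of_le hx hxy) ht hyt)
  have hanti : AntitoneOn (fun y => primitiveLeft f y - k / 2 * y ^ 2) (Icc x t) := by
    refine antitoneOn_of_hasDerivWithinAt_nonpos (convex_Icc x t)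
      (continuous_primitiveLeft_sub_mul_sq hfc _).continuousOn
      (fun y _ => (hasDerivAt_primitiveLeft_sub_mul_sq hfc _ y).hasDerivWithinAt) fun y hy => ?_
    rw [interior_Icc, mem_Ioo] at hy
    rw [extendLeft_of_nonneg (hx0.trans hy.1).le]
    linarith [hle hy.1.le hy.2.le]
  have hF : primitiveLeft f t - k / 2 * t ^ 2 ≤ primitiveLeft f x - k / 2 * x ^ 2 :=
    hanti ⟨le_rfl, hxt⟩ ⟨hxt, le_rfl⟩ hxt
  have hft : f t = k * t := by rw [hk, div_mul_cancel₀ _ ht0.ne']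
  have hfx : x * f x ≤ x * (k * x) := mul_le_mul_of_nonneg_left (hle le_rfl hxt) hx0.le
  simp only [extendLeft_of_nonneg hx0.le, extendLeft_of_nonneg ht0.le, hft]
  linarith

lemma exists_mul_sub_two_mul_primitiveLeft_le (hfc : ContinuousOn f (Ici 0)) (hf0 : f 0 = 0)
    (hf2 : HypF2 f) :
    ∃ C ≥ 0, ∀ t θ, 0 ≤ θ → θ ≤ 1 →
      θ * t * extendLeft f (θ * t) - 2 * primitiveLeft f (θ * t) ≤
        t * extendLeft f t - 2 * primitiveLeft f t + C := by
  obtain ⟨R, hR, hmono⟩ := hf2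
  have hcont : Continuous fun t => t * extendLeft f t - 2 * primitiveLeft f t :=
    (continuous_id.mul (continuous_extendLeft hfc)).sub
      (continuous_const.mul (continuous_primitiveLeft hfc))
  obtain ⟨C, hC, hle⟩ := exists_le_add_of_monotoneOn (T := R + 1) (by positivity)
    hcont.continuousOn ((monotoneOn_mul_sub_two_mul_primitiveLeft hfc hR.le hmono).mono
      (Ici_subset_Ioi.2 (lt_add_one R)))
  refine ⟨C, hC, fun t θ hθ hθ1 => ?_⟩
  rcases le_total 0 t with ht | ht
  · exact hle _ _ (by positivity) (mul_le_of_le_one_left ht hθ1)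
  · have hθt := mul_nonpos_of_nonneg_of_nonpos hθ ht
    simp only [extendLeft_of_nonpos hf0 ht, extendLeft_of_nonpos hf0 hθt,
      primitiveLeft_of_nonpos hf0 ht, primitiveLeft_of_nonpos hf0 hθt]
    linarith

lemma exists_isNonlinearity_extendLeft {N : ℕ} {s : ℝ} (hfc : ContinuousOn f (Ici 0))
    (hf0 : f 0 = 0) (hf1 : HypF1 N s f) (hf2 : HypF2 f) :
    ∃ γ, IsNonlinearity (critExp N s) γ (extendLeft f) (primitiveLeft f) := by
  obtain ⟨hzero, htop, γ, hγ, hγc, -, -, L, -, hlim⟩ := hf1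
  have hgrowth := powerGrowth_extendLeft hfc hf0 hlim
  have hprim := hgrowth.primitive (by linarith) (hasDerivAt_primitiveLeft hfc) primitiveLeft_zero
  rw [sub_add_cancel] at hprim
  exact ⟨γ,
    { two_lt := hγ
      lt_crit := hγc
      cont := continuous_extendLeft hfc
      hasDerivAt := hasDerivAt_primitiveLeft hfc
      zero_of_nonpos := fun _ => extendLeft_of_nonpos hf0
      prim_zero_of_nonpos := fun _ => primitiveLeft_of_nonpos hf0
      growth := hgrowth
      prim_le := fun _ => exists_primitiveLeft_le hf0 hzero (by linarith) hprim
      superlinear := exists_le_primitiveLeft hfc htop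
      quasi_mono := exists_mul_sub_two_mul_primitiveLeft_le hfc hf0 hf2 }⟩

lemma fShift_eq (hf0 : f 0 = 0) (a t : ℝ) : fShift f a t = extendLeft f t - a := by
  rw [fShift]
  split_ifs with h
  · rw [extendLeft_of_nonneg h]
  · rw [extendLeft_of_nonpos hf0 (not_le.1 h).le, zero_sub]

lemma FShift_eq (hfc : ContinuousOn f (Ici 0)) (hf0 : f 0 = 0) (a t : ℝ) :
    FShift f a t = primitiveLeft f t - a * t := by
  simp_rw [FShift, primitiveLeft, fShift_eq hf0]
  rw [intervalIntegral.integral_sub ((continuous_extendLeft hfc).intervalIntegrable _ _)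
    intervalIntegrable_const, intervalIntegral.integral_const, smul_eq_mul, sub_zero, mul_comm t]

end ExtendLeft

/-! ### The problem in the homogeneous fractional Sobolev space -/

section Weight

variable {α : Type*} [MeasurableSpace α] {ν : Measure α} {g : α → ℝ}

/-- The measure `g ν`, with respect to which the nonlinear terms of the energy are integrals of
functions of `u` alone. It only sees the positive part of `g`. -/
def weightMeasure (ν : Measure α) (g : α → ℝ) : Measure α :=
  ν.withDensity fun x => ENNReal.ofReal (g x)

lemma isFiniteMeasure_weightMeasure (hg : Integrable g ν) : IsFiniteMeasure (weightMeasure ν g) :=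
  isFiniteMeasure_withDensity_ofReal hg.2

lemma weightMeasure_le : weightMeasure ν g ≤ eLpNorm g ⊤ ν • ν := by
  rw [← withDensity_const]
  refine withDensity_mono ?_
  rw [eLpNorm_exponent_top]
  filter_upwards [ae_le_eLpNormEssSup (f := g) (μ := ν)] with x hx
  exact (Real.ofReal_le_enorm _).trans hx

lemma weightMeasure_ne_zero (hg : AEMeasurable g ν) (hg0 : 0 ≤ᵐ[ν] g) (hne : ¬ g =ᵐ[ν] 0) :
    weightMeasure ν g ≠ 0 := fun hzero => hne <| by
  filter_upwards [(withDensity_eq_zero_iff hg.ennreal_ofReal).1 hzero, hg0] with x hx hx0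
  exact le_antisymm (ENNReal.ofReal_eq_zero.1 hx) hx0

lemma integral_weightMeasure (hg : AEMeasurable g ν) (hg0 : 0 ≤ᵐ[ν] g) (h : α → ℝ) :
    ∫ x, h x ∂weightMeasure ν g = ∫ x, g x * h x ∂ν := by
  rw [weightMeasure, integral_withDensity_eq_integral_toReal_smul₀ hg.ennreal_ofReal
    (ae_of_all _ fun _ => ENNReal.ofReal_lt_top)]
  refine integral_congr_ae ?_
  filter_upwards [hg0] with x hx
  rw [ENNReal.toReal_ofReal hx, smul_eq_mul]

lemma integrable_weightMeasure (hg : AEMeasurable g ν) (hg0 : 0 ≤ᵐ[ν] g) {h : α → ℝ} :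
    Integrable h (weightMeasure ν g) ↔ Integrable (fun x => g x * h x) ν := by
  rw [weightMeasure, integrable_withDensity_iff_integrable_smul₀' hg.ennreal_ofReal
    (ae_of_all _ fun _ => ENNReal.ofReal_lt_top)]
  refine integrable_congr ?_
  filter_upwards [hg0] with x hx
  rw [ENNReal.toReal_ofReal hx, smul_eq_mul]

end Weight

section HDotEnergySpace

variable {N : ℕ} {s : ℝ} {hs : 0 < s} {hN : 2 * s < N} [Fact (1 < critExp N s)]

lemma exists_not_ae_emb_nonpos (hs1 : s < 1) {μ : Measure (EuclideanSpace ℝ (Fin N))}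
    (hμ : μ ≠ 0) (hac : μ ≪ volume) {S : EnergySpace (HDot hs hN) μ (critExp N s)}
    (hemb : ∀ u, S.emb u =ᵐ[μ] u.fn) : ∃ u, ¬ ∀ᵐ x ∂μ, S.emb u x ≤ 0 := by
  obtain ⟨n, hn⟩ := exists_pos_ball 0 hμ
  let b : ContDiffBump (0 : EuclideanSpace ℝ (Fin N)) :=
    ⟨(n : ℝ) + 1, (n : ℝ) + 2, by positivity, by linarith⟩
  obtain ⟨u, -, hu⟩ := exists_testFunction (hs := hs) (hN := hN) hs1 (φ := b) b.contDiff
    b.hasCompactSupport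
  refine ⟨u, fun hle => hn.ne' (measure_mono_null (fun x hx => ?_)
    (ae_iff.1 (hle.congr ((((hemb u).trans (hac.ae_eq hu))).mono fun x hx => by rw [hx]))))⟩
  rw [Set.mem_ofPred_eq, not_le]
  exact b.pos_of_mem_ball (Metric.ball_subset_ball (by simp only [b]; linarith) hx)

variable {f : ℝ → ℝ} {g : EuclideanSpace ℝ (Fin N) → ℝ}
  {S : EnergySpace (HDot hs hN) (weightMeasure volume g) (critExp N s)} {γ : ℝ}

lemma form_self_eq_gagliardoSeminorm_sq (hform : ∀ u v, S.form u v = gagliardoForm N s u.fn v.fn)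
    (u : HDot hs hN) : S.form u u = gagliardoSeminorm N s u.fn ^ 2 := by
  rw [gagliardoSeminorm, ← hform, Real.sq_sqrt]
  exact (mul_nonneg S.lower_pos.le (sq_nonneg ‖u‖)).trans (S.le_form u)

variable [IsFiniteMeasure (weightMeasure volume g)]

lemma integrable_mul_FShift (hg : AEMeasurable g) (hg0 : 0 ≤ᵐ[volume] g)
    (hfc : ContinuousOn f (Ici 0)) (hf0 : f 0 = 0)
    (hf : IsNonlinearity (critExp N s) γ (extendLeft f) (primitiveLeft f))
    (hemb : ∀ u, S.emb u =ᵐ[weightMeasure volume g] u.fn) (a : ℝ) (u : HDot hs hN) :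
    Integrable (fun x => g x * FShift f a (u.fn x)) := by
  rw [← integrable_weightMeasure hg hg0 (h := fun x => FShift f a (u.fn x))]
  refine ((S.integrable_pot hf u).sub ((S.integrable_emb u).const_mul a)).congr ?_
  filter_upwards [hemb u] with x hx
  rw [Pi.sub_apply, hx, FShift_eq hfc hf0]

lemma energy_eq_action (hg : AEMeasurable g) (hg0 : 0 ≤ᵐ[volume] g)
    (hfc : ContinuousOn f (Ici 0)) (hf0 : f 0 = 0)
    (hf : IsNonlinearity (critExp N s) γ (extendLeft f) (primitiveLeft f))
    (hform : ∀ u v, S.form u v = gagliardoForm N s u.fn v.fn)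
    (hemb : ∀ u, S.emb u =ᵐ[weightMeasure volume g] u.fn) (a : ℝ) :
    energy f g a = S.action (primitiveLeft f) a := by
  funext u
  have hpot : ∫ x, g x * FShift f a (u.fn x) = S.pot (primitiveLeft f) u - a * S.mass u := by
    rw [← integral_weightMeasure hg hg0 (fun x => FShift f a (u.fn x)), EnergySpace.pot,
      S.mass_apply, ← integral_const_mul,
      ← integral_sub (S.integrable_pot hf u) ((S.integrable_emb u).const_mul a)]
    refine integral_congr_ae ?_
    filter_upwards [hemb u] with x hx
    rw [hx, FShift_eq hfc hf0]
  rw [energy, hpot, EnergySpace.action, form_self_eq_gagliardoSeminorm_sq hform]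
  ring

lemma isWeakSolution_of_dAction_eq_zero (hg : AEMeasurable g) (hg0 : 0 ≤ᵐ[volume] g)
    (hf0 : f 0 = 0)
    (hf : IsNonlinearity (critExp N s) γ (extendLeft f) (primitiveLeft f))
    (hform : ∀ u v, S.form u v = gagliardoForm N s u.fn v.fn)
    (hemb : ∀ u, S.emb u =ᵐ[weightMeasure volume g] u.fn) {a : ℝ} {u : HDot hs hN}
    (hu : S.dAction hf a u = 0) : IsWeakSolution f g a u := by
  intro φ
  have hae : (fun x => extendLeft f (S.emb u x) * S.emb φ x - a * S.emb φ x)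
      =ᵐ[weightMeasure volume g] fun x => fShift f a (u.fn x) * φ.fn x := by
    filter_upwards [hemb u, hemb φ] with x hux hφx
    rw [hux, hφx, fShift_eq hf0]
    ring
  have hpot := S.integrable_dPot hf u φ
  have hmass := (S.integrable_emb φ).const_mul a
  simp only [mul_assoc]
  rw [← integrable_weightMeasure hg hg0 (h := fun x => fShift f a (u.fn x) * φ.fn x),
    ← integral_weightMeasure hg hg0 (fun x => fShift f a (u.fn x) * φ.fn x),
    ← integral_congr_ae hae, integral_sub hpot hmass, integral_const_mul, ← S.dPot_apply hf,
    ← S.mass_apply, ← hform]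
  refine ⟨(hpot.sub hmass).congr hae, ?_⟩
  have hcrit := S.dAction_apply hf a u φ
  rw [hu, zero_apply] at hcrit
  linarith

lemma satisfiesCerami_action {f F : ℝ → ℝ} (hf : IsNonlinearity (critExp N s) γ f F) {a : ℝ}
    (ha : 0 ≤ a) : SatisfiesCerami (S.action F a) := by
  intro c
  rw [S.fderiv_action hf]
  refine ⟨fun w hw _ hd => ?_, ?_⟩
  · obtain ⟨M, hM⟩ := hw.exists_norm_le
    exact S.exists_subseq_tendsto hf (fun n => hM _ (mem_range_self n)) hd
  obtain ⟨ρ, hρ, hbound⟩ := S.exists_norm_bound hf a (|c| + 1)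
  obtain ⟨C, hC, hle⟩ := GagliardoSpace.exists_norm_le_seminorm hs hN
  refine ⟨1, one_pos, (|c| + 1) / C, by positivity, ρ + 1, by positivity, fun v hv hvρ => ?_⟩
  have hlarge : ρ < ‖v‖ := (lt_add_one ρ).trans_le
    (hvρ.trans (GagliardoSpace.seminorm_le_norm (v : GagliardoSpace hs hN)))
  have haction : |S.action F a v| ≤ |c| + 1 := by
    rw [abs_le]
    constructor <;> linarith [hv.1, hv.2, neg_abs_le c, le_abs_self c]
  have hgrad : |c| + 1 ≤ ‖S.dAction hf a v‖ * ‖v‖ := by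
    by_contra! hsmall
    exact hlarge.not_ge (hbound a ha le_rfl v haction hsmall.le)
  rw [div_le_iff₀ hC, mul_assoc, mul_comm _ C]
  exact hgrad.trans (mul_le_mul_of_nonneg_left (hle (v : GagliardoSpace hs hN))
    (norm_nonneg (S.dAction hf a v)))

lemma isMountainPassSolution_of_dAction_eq_zero (hg : AEMeasurable g) (hg0 : 0 ≤ᵐ[volume] g)
    (hfc : ContinuousOn f (Ici 0)) (hf0 : f 0 = 0)
    (hf : IsNonlinearity (critExp N s) γ (extendLeft f) (primitiveLeft f))
    (hform : ∀ u v, S.form u v = gagliardoForm N s u.fn v.fn)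
    (hemb : ∀ u, S.emb u =ᵐ[weightMeasure volume g] u.fn) {a : ℝ} (ha : 0 ≤ a) {ρ β : ℝ}
    (hρ : 0 < ρ) (hβ : 0 < β)
    (hsphere : ∀ v, S.form v v = ρ ^ 2 → β ≤ S.action (primitiveLeft f) a v) {e : HDot hs hN}
    (he : ρ ^ 2 < S.form e e) (hneg : S.action (primitiveLeft f) a e < 0) {u : HDot hs hN}
    (hβu : β ≤ S.action (primitiveLeft f) a u) (hu : S.dAction hf a u = 0)
    (hglb : IsGLB (range fun q : Path 0 e => ⨆ t, S.action (primitiveLeft f) a (q t))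
      (S.action (primitiveLeft f) a u)) :
    IsMountainPassSolution f g a u := by
  rw [IsMountainPassSolution, energy_eq_action hg hg0 hfc hf0 hf hform hemb,
    S.fderiv_action hf]
  rw [form_self_eq_gagliardoSeminorm_sq hform] at he
  exact ⟨isWeakSolution_of_dAction_eq_zero hg hg0 hf0 hf hform hemb hu,
    integrable_mul_FShift hg hg0 hfc hf0 hf hemb a, S.contDiff_action hf a, hu,
    satisfiesCerami_action hf ha, ρ, hρ, β, hβ, e, S.action_zero hf a,
    fun v hv => hsphere v (by rw [form_self_eq_gagliardoSeminorm_sq hform, hv]),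
    lt_of_pow_lt_pow_left₀ 2 (Real.sqrt_nonneg _) he, hneg, hβu, hglb⟩

end HDotEnergySpace

end

theorem theorem1p1 (N : ℕ) (s : ℝ) (hs0 : 0 < s) (hs1 : s < 1) (hN : 2 * s < N)
    (f : ℝ → ℝ) (hfc : ContinuousOn f (Ici 0)) (hf0 : f 0 = 0)
    (hf1 : HypF1 N s f) (hf2 : HypF2 f)
    (g : EuclideanSpace ℝ (Fin N) → ℝ)
    (hg1 : MemLp g 1 volume) (hginf : MemLp g ⊤ volume)
    (hgnonneg : 0 ≤ᵐ[volume] g) (hgne : ¬ g =ᵐ[volume] 0) :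
    ∃ a₁ > 0, ∃ u : ℝ → HDot hs0 hN,
      (∀ a ∈ Ioo 0 a₁, IsMountainPassSolution f g a (u a)) ∧
      ∃ a₂ ∈ Ioo 0 a₁, ∃ C > 0, ∀ a ∈ Ioo 0 a₂, ‖u a‖ ≤ C := by
  have hgm : AEMeasurable g := hg1.1.aemeasurable
  have := isFiniteMeasure_weightMeasure (memLp_one_iff_integrable.1 hg1)
  have : Fact (1 < critExp N s) := ⟨one_lt_two.trans (critExp_gt_two hs0 hN)⟩
  obtain ⟨γ, hf⟩ := exists_isNonlinearity_extendLeft hfc hf0 hf1 hf2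
  let S := HDot.energySpace hs0 hN hs1 hginf.2.ne weightMeasure_le
  have hemb : ∀ u, S.emb u =ᵐ[weightMeasure volume g] u.fn :=
    HDot.embWeight_coe hginf.2.ne weightMeasure_le
  obtain ⟨u₀, hu₀⟩ := exists_not_ae_emb_nonpos hs1 (weightMeasure_ne_zero hgm hgnonneg hgne)
    (withDensity_absolutelyContinuous _ _) hemb
  obtain ⟨a₁, ha₁, ρ, hρ, β, hβ, e, C, hC, he, h⟩ := S.exists_mountainPass hf hu₀
  choose! hsphere hneg u hβu huC hcrit hglb using h
  refine ⟨a₁, ha₁, u, fun a ha => ?_, a₁ / 2, ⟨half_pos ha₁, half_lt_self ha₁⟩, C, hC, fun a ha =>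
    huC a ⟨ha.1, ha.2.trans (half_lt_self ha₁)⟩⟩
  exact isMountainPassSolution_of_dAction_eq_zero hgm hgnonneg hfc hf0 hf HDot.form_apply hemb
    ha.1.le hρ hβ (hsphere a ha) he (hneg a ha) (hβu a ha) (hcrit a ha) (hglb a ha)
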